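/- Let $-\infty\le a<b\le\infty$ and let $\rho,\Psi$ be real-valued functions of class $C^\infty$ on the open interval $(a,b)$. Consider the one-parameter family of equations $$z''+\rho(z)=\frac{1}{K^2}\Psi(z),\qquad K\in\mathbb R\setminus\{0\}, \tag{$*$}$$ on $(a,b)$, where $z=z(\varphi)$. **Definitions.** A *bounded* solution is a solution defined on all of $\mathbb R$ whose image lies in a compact segment $[a',b']\subset(a,b)$. A set of nonconstant functions is called *commensurably periodic* if all its members are periodic and any two periods of any two members have rational ratio. A point $z_0\in(a,b)$ is an *equilibrium* for $K$ if $\rho(z_0)=\Psi(z_0)/K^2$; it is *stable* if it is Lyapunov stable (in the variables $(z,z')$), and *nondegenerate stable* if it is a nondegenerate local minimum of the potential, i.e. if moreover $\rho'(z_0)-\Psi'(z_0)/K^2>0$. Consider the following conditions on $\Psi$: * $(\exists)$: for some $K=\hat K\neq0$ there is a bounded nonconstant solution $\hat z$; * $(\forall)$: the set of all bounded nonconstant solutions, for all values of $K\ne0$, is commensurably periodic; * $(\exists^{\rm loc})$: for some $K=K_0\ne0$ there is a nondegenerate stable equilibrium $z_0\in(a,b)$; * $(\forall^{\rm loc})$: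 for every $(K_0,z_0)$ such that $z_0$ is a nondegenerate stable equilibrium for $K_0$ there are $\varepsilon,\delta>0$ such that the set of all bounded nonconstant solutions with $K\in(K_0-\delta,K_0+\delta)$, $K\ne0$, and image in $[z_0-\varepsilon,z_0+\varepsilon]$ is commensurably periodic; * $(\forall^{\rm s\text{-}loc})$: for $\hat K,\hat z$ from $(\exists)$, the set of all bounded nonconstant solutions with $K=\hat K$ and image contained in $\hat z(\mathbb R)$ is commensurably periodic. $\Psi$ is called *$\rho$-closing* if $(\exists)$ and $(\forall)$ hold; *locally $\rho$-closing* if $(\exists^{\rm loc})$ and $(\forall^{\rm loc})$ hold; *semilocally $\rho$-closing* if $(\forall^{\rm loc})$ holds, and $(\exists)$ and $(\forall^{\rm s\text{-}loc})$ hold for some pair $(\hat K,\hat z)$; *strongly $\rho$-closing* if every $z_0\in(a,b)$ is a nondegenerate stable equilibrium for some $K_0$ (depending on $z_0$) and $(\forall^{\rm loc})$ holds; *weakly $\rho$-closing* if every $z_0\in(a,b)$ is a stable equilibrium for some $K_0$ and the analogue of $(\forall^{\rm loc})$, with "stable" in place of "nondegenerate stable", holds. **Theorem.** Every semilocally $\rho$-closing,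 $\rho$-closing, strongly $\rho$-closing or weakly $\rho$-closing function $\Psi$ is locally $\rho$-closing. Suppose that $\rho$ has no zeros on $(a,b)$. Then the five classes of $\rho$-closing, semilocally, locally, strongly and weakly $\rho$-closing functions $\Psi\in C^\infty(a,b)$ coincide, and up to positive multiplicative constants there are at most two $\rho$-closing functions. More precisely: (a) If $\rho'$ is a positive constant on $(a,b)$, then up to a positive multiplicative constant there are exactly two $\rho$-closing functions, namely $\Psi_i=A_i/\rho^{\,i^2-1}$, $i=1,2$, where $A_i\neq0$ is any constant with $A_i\rho^i>0$ on $(a,b)$ (and such constants exist). For $\Psi=\Psi_i$ the minimal positive period of every bounded nonconstant solution of $(*)$ is $2\pi/(i\sqrt{\rho'})$. (b) If $\rho(z)=\dfrac{(z-\zeta)^4+D}{\mu^2(z-\zeta)^3}$ on $(a,b)$ with constants $D\neq0$, $\mu>0$, $\zeta\notin(a,b)$, then up to a positive multiplicative constant there is exactly one $\rho$-closing function, namely $\Psi(z)=A/(z-\zeta)^3$, where $A\ne0$ is any constant with $A((z-\zeta)^4+D)>0$ on $(a,b)$. The minimal positive period of every bounded nonconstant solution of $(*)$ is then $\pi\mu$.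 (c) If $\rho$ has neither of the forms in (a), (b), then there are no $\rho$-closing functions on $(a,b)$. In cases (a) and (b), for these functions $\Psi$, every point $z\in(a,b)$ is a nondegenerate stable equilibrium of $(*)$ for $K=\pm\sqrt{A_i/\rho(z)^{i^2}}$ in case (a), and for $K=\pm\mu\sqrt{A/((z-\zeta)^4+D)}$ in case (b), and is not an equilibrium for any other value of $K$. -/

import Mathlib

open Set Real
open scoped ContDiff

namespace Bertrand

/-- The open interval `(a, b)` of the real line; `a = -∞` and `b = +∞` are allowed. -/
def interval (a b : EReal) : Set ℝ := {z : ℝ | a < (z : EReal) ∧ (z : EReal) < b}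

/-- On the open set `J` of times, `z` takes values in `I` and solves
`z'' + ρ(z) = Ψ(z) / K ^ 2`. -/
def IsSolutionOn (I : Set ℝ) (ρ Ψ : ℝ → ℝ) (K : ℝ) (z : ℝ → ℝ) (J : Set ℝ) : Prop :=
  ∀ t ∈ J, z t ∈ I ∧ DifferentiableAt ℝ z t ∧ DifferentiableAt ℝ (deriv z) t ∧
    deriv (deriv z) t + ρ (z t) = Ψ (z t) / K ^ 2

/-- `z` is a bounded nonconstant solution of the equation with parameter `K ≠ 0`: it is defined on
the whole line and its image lies in a compact segment `[a', b'] ⊆ I`. -/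
def IsBddNonconstSolution (I : Set ℝ) (ρ Ψ : ℝ → ℝ) (K : ℝ) (z : ℝ → ℝ) : Prop :=
  K ≠ 0 ∧ IsSolutionOn I ρ Ψ K z univ ∧
    (∃ a' b' : ℝ, Icc a' b' ⊆ I ∧ range z ⊆ Icc a' b') ∧ ¬ ∃ c : ℝ, ∀ t, z t = c

/-- All functions in `S` are periodic, and their periods are pairwise commensurable. -/
def PeriodicCommensurable (S : Set (ℝ → ℝ)) : Prop :=
  (∀ z ∈ S, ∃ T : ℝ, 0 < T ∧ Function.Periodic z T) ∧
  ∀ z ∈ S, ∀ w ∈ S, ∀ T T' : ℝ, 0 < T → Function.Periodic z T →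
    0 < T' → Function.Periodic w T' → ∃ q : ℚ, T / T' = (q : ℝ)

/-- `T` is the least positive period of `z`. -/
def IsMinimalPeriod (z : ℝ → ℝ) (T : ℝ) : Prop :=
  IsLeast {T' : ℝ | 0 < T' ∧ Function.Periodic z T'} T

/-- `z₀ ∈ I` is an equilibrium of the equation with parameter `K ≠ 0`. -/
def IsEquilibrium (I : Set ℝ) (ρ Ψ : ℝ → ℝ) (K z₀ : ℝ) : Prop :=
  K ≠ 0 ∧ z₀ ∈ I ∧ ρ z₀ = Ψ z₀ / K ^ 2

/-- Nondegenerate stable equilibrium: a nondegenerate local minimum (`U' = 0`, `U'' > 0`) of the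
potential `U` of the equation, where `z'' = -U'(z)`, i.e. `U' = ρ - Ψ / K ^ 2`. -/
def IsNondegStableEquilibrium (I : Set ℝ) (ρ Ψ : ℝ → ℝ) (K z₀ : ℝ) : Prop :=
  IsEquilibrium I ρ Ψ K z₀ ∧ 0 < deriv (fun z => ρ z - Ψ z / K ^ 2) z₀

/-- (Lyapunov) stable equilibrium. The condition is imposed on all solutions, including those
that are a priori defined only on a finite interval of times. -/
def IsStableEquilibrium (I : Set ℝ) (ρ Ψ : ℝ → ℝ) (K z₀ : ℝ) : Prop :=
  IsEquilibrium I ρ Ψ K z₀ ∧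
  ∀ ε : ℝ, 0 < ε → ∃ δ : ℝ, 0 < δ ∧
    ∀ (z : ℝ → ℝ) (s T : ℝ), s < 0 → 0 < T → IsSolutionOn I ρ Ψ K z (Ioo s T) →
      |z 0 - z₀| < δ → |deriv z 0| < δ →
      ∀ t ∈ Ico 0 T, |z t - z₀| < ε ∧ |deriv z t| < ε

/-- For some `ε, δ > 0`, the bounded nonconstant solutions with parameter in
`(K₀ - δ, K₀ + δ) \ {0}` and image in `[z₀ - ε, z₀ + ε]` are periodic with pairwise commensurable
periods. -/
def ClosesNear (I : Set ℝ) (ρ Ψ : ℝ → ℝ) (K₀ z₀ : ℝ) : Prop :=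
  ∃ ε δ : ℝ, 0 < ε ∧ 0 < δ ∧
    PeriodicCommensurable {z | ∃ K ∈ Ioo (K₀ - δ) (K₀ + δ),
      IsBddNonconstSolution I ρ Ψ K z ∧ range z ⊆ Icc (z₀ - ε) (z₀ + ε)}

/-- `Ψ` is `ρ`-closing on `I`. -/
def IsClosing (I : Set ℝ) (ρ Ψ : ℝ → ℝ) : Prop :=
  (∃ (K : ℝ) (z : ℝ → ℝ), IsBddNonconstSolution I ρ Ψ K z) ∧
  PeriodicCommensurable {z | ∃ K : ℝ, IsBddNonconstSolution I ρ Ψ K z}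

/-- `Ψ` is locally `ρ`-closing on `I`. -/
def IsLocallyClosing (I : Set ℝ) (ρ Ψ : ℝ → ℝ) : Prop :=
  (∃ K₀ z₀ : ℝ, IsNondegStableEquilibrium I ρ Ψ K₀ z₀) ∧
  ∀ K₀ z₀ : ℝ, IsNondegStableEquilibrium I ρ Ψ K₀ z₀ → ClosesNear I ρ Ψ K₀ z₀

/-- `Ψ` is semilocally `ρ`-closing on `I`. -/
def IsSemilocallyClosing (I : Set ℝ) (ρ Ψ : ℝ → ℝ) : Prop :=
  (∃ (K : ℝ) (w : ℝ → ℝ), IsBddNonconstSolution I ρ Ψ K w ∧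
    PeriodicCommensurable {z | IsBddNonconstSolution I ρ Ψ K z ∧ range z ⊆ range w}) ∧
  ∀ K₀ z₀ : ℝ, IsNondegStableEquilibrium I ρ Ψ K₀ z₀ → ClosesNear I ρ Ψ K₀ z₀

/-- `Ψ` is strongly `ρ`-closing on `I`. -/
def IsStronglyClosing (I : Set ℝ) (ρ Ψ : ℝ → ℝ) : Prop :=
  (∀ z₀ ∈ I, ∃ K₀ : ℝ, IsNondegStableEquilibrium I ρ Ψ K₀ z₀) ∧
  ∀ K₀ z₀ : ℝ, IsNondegStableEquilibrium I ρ Ψ K₀ z₀ → ClosesNear I ρ Ψ K₀ z₀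

/-- `Ψ` is weakly `ρ`-closing on `I`. -/
def IsWeaklyClosing (I : Set ℝ) (ρ Ψ : ℝ → ℝ) : Prop :=
  (∀ z₀ ∈ I, ∃ K₀ : ℝ, IsStableEquilibrium I ρ Ψ K₀ z₀) ∧
  ∀ K₀ z₀ : ℝ, IsStableEquilibrium I ρ Ψ K₀ z₀ → ClosesNear I ρ Ψ K₀ z₀

/-- `Ψ₁` and `Ψ₂` coincide on `I` up to a positive multiplicative constant. -/
def PosProportional (I : Set ℝ) (Ψ₁ Ψ₂ : ℝ → ℝ) : Prop :=
  ∃ c : ℝ, 0 < c ∧ ∀ z ∈ I, Ψ₁ z = c * Ψ₂ z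

/-- `Ψ` is a function of class `C^∞` on `I` which is `ρ`-closing on `I`. -/
def IsSmoothClosing (I : Set ℝ) (ρ Ψ : ℝ → ℝ) : Prop :=
  ContDiffOn ℝ ∞ Ψ I ∧ IsClosing I ρ Ψ

/-- `ρ` has on `I` the form `((z - ζ) ^ 4 + D) / (μ ^ 2 (z - ζ) ^ 3)`, with `D ≠ 0`, `μ > 0`,
`ζ ∉ I`. -/
def HasRationalForm (I : Set ℝ) (ρ : ℝ → ℝ) (ζ D μ : ℝ) : Prop :=
  D ≠ 0 ∧ 0 < μ ∧ ζ ∉ I ∧ ∀ z ∈ I, ρ z = ((z - ζ) ^ 4 + D) / (μ ^ 2 * (z - ζ) ^ 3)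

end Bertrand

open Bertrand

namespace Bertrand

open Filter Topology
open scoped NNReal

/-- `x` is a solution of `x'' = -F(x)` on the whole line, with velocity `v`. -/
def IsOrbit (F x v : ℝ → ℝ) : Prop :=
  (∀ t, HasDerivAt x (v t) t) ∧ ∀ t, HasDerivAt v (-F (x t)) t

/-- The vector field on the phase plane of `x'' = -F(x)`. -/
def phaseField (F : ℝ → ℝ) (p : ℝ × ℝ) : ℝ × ℝ := (p.2, -F p.1)

theorem phaseField_lipschitz {F : ℝ → ℝ} {L : ℝ≥0} (hF : LipschitzWith L F) :
    LipschitzWith (max 1 L) (phaseField F) := by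
  have h := (LipschitzWith.prod_snd (α := ℝ) (β := ℝ)).prodMk
    ((hF.comp LipschitzWith.prod_fst).neg)
  simpa [phaseField, Function.comp_def] using! h

theorem IsOrbit.hasDerivAt_phase {F x v : ℝ → ℝ} (h : IsOrbit F x v) (t : ℝ) :
    HasDerivAt (fun t => (x t, v t)) (phaseField F (x t, v t)) t :=
  (h.1 t).prodMk (h.2 t)

theorem IsOrbit.unique {F x v y w : ℝ → ℝ} {L : ℝ≥0} (hF : LipschitzWith L F)
    (h : IsOrbit F x v) (h' : IsOrbit F y w) {t₀ : ℝ} (hx : x t₀ = y t₀) (hv : v t₀ = w t₀) :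
    x = y ∧ v = w := by
  have := ODE_solution_unique_univ (v := fun _ => phaseField F) (s := fun _ => univ)
    (t₀ := t₀) (K := max 1 L) (fun _ => (phaseField_lipschitz hF).lipschitzOnWith)
    (fun t => ⟨h.hasDerivAt_phase t, trivial⟩) (fun t => ⟨h'.hasDerivAt_phase t, trivial⟩)
    (by simp [hx, hv])
  exact ⟨funext fun t => congrArg Prod.fst (congrFun this t),
    funext fun t => congrArg Prod.snd (congrFun this t)⟩

theorem IsOrbit.dist_le {F x v y w : ℝ → ℝ} {L : ℝ≥0} (hF : LipschitzWith L F)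
    (h : IsOrbit F x v) (h' : IsOrbit F y w) {δ : ℝ} (hx : |x 0 - y 0| ≤ δ)
    (hv : |v 0 - w 0| ≤ δ) {t : ℝ} (ht : 0 ≤ t) :
    |x t - y t| ≤ δ * exp (max 1 L * t) ∧ |v t - w t| ≤ δ * exp (max 1 L * t) := by
  have hc : ∀ {x v : ℝ → ℝ}, IsOrbit F x v → ContinuousOn (fun t => (x t, v t)) (Icc 0 t) :=
    fun h => (continuous_iff_continuousAt.2 fun t =>
      (h.hasDerivAt_phase t).continuousAt).continuousOn
  have := dist_le_of_trajectories_ODE (v := fun _ => phaseField F) (K := max 1 L) (a := 0)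
    (b := t) (δ := δ) (fun _ => phaseField_lipschitz hF) (hc h)
    (fun t _ => (h.hasDerivAt_phase t).hasDerivWithinAt) (hc h')
    (fun t _ => (h'.hasDerivAt_phase t).hasDerivWithinAt)
    (by rw [Prod.dist_eq]; exact max_le hx hv) t ⟨ht, le_rfl⟩
  rw [Prod.dist_eq, sub_zero] at this
  have h1 := (le_max_left _ _).trans this
  have h2 := (le_max_right _ _).trans this
  rw [Real.dist_eq] at h1 h2
  exact ⟨by simpa using h1, by simpa using h2⟩

theorem abs_clamp_sub_le (R x y : ℝ) :
    |max (-R) (min R x) - max (-R) (min R y)| ≤ |x - y| := by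
  rw [max_comm (-R), max_comm (-R)]
  refine (abs_max_sub_max_le_abs _ _ _).trans ?_
  simpa using abs_min_sub_min_le_max R x R y

theorem exists_orbit_Icc {F : ℝ → ℝ} {L M : ℝ≥0} (hF : LipschitzWith L F)
    (hM : ∀ x, |F x| ≤ M) (x₀ v₀ : ℝ) {T : ℝ} (hT : 0 < T) :
    ∃ α : ℝ → ℝ × ℝ, α 0 = (x₀, v₀) ∧
      ∀ t ∈ Icc (-T) T, HasDerivWithinAt α (phaseField F (α t)) (Icc (-T) T) t := by
  set R : ℝ := |v₀| + M * T with hR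
  have hR0 : 0 ≤ R := by positivity
  let G : ℝ × ℝ → ℝ × ℝ := fun p => (max (-R) (min R p.2), -F p.1)
  have hG : LipschitzWith (max 1 L) G := by
    have h1 : LipschitzWith 1 fun y : ℝ => max (-R) (min R y) := by
      apply LipschitzWith.of_dist_le_mul
      intro x y
      simpa [Real.dist_eq] using abs_clamp_sub_le R x y
    have h := (h1.comp (LipschitzWith.prod_snd (α := ℝ) (β := ℝ))).prodMk
      ((hF.comp LipschitzWith.prod_fst).neg)
    simpa [G, Function.comp_def] using! h
  let B : ℝ≥0 := max ⟨R, hR0⟩ M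
  have hGB : ∀ p, ‖G p‖ ≤ B := by
    intro p
    rw [Prod.norm_def]
    refine max_le ?_ ?_
    · refine le_trans ?_ (NNReal.coe_le_coe.2 (le_max_left _ _))
      rw [Real.norm_eq_abs, abs_le]
      exact ⟨le_max_left _ _, max_le (show -R ≤ R by linarith) (min_le_left _ _)⟩
    · refine le_trans ?_ (NNReal.coe_le_coe.2 (le_max_right _ _))
      simpa [G] using hM p.1
  have hpl : IsPicardLindelof (fun _ => G) (tmin := -T) (tmax := T)
      ⟨0, by constructor <;> linarith⟩ ((x₀, v₀) : ℝ × ℝ) (B * ⟨T, hT.le⟩) 0 B (max 1 L) :=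
    { lipschitzOnWith := fun _ _ => hG.lipschitzOnWith
      continuousOn := fun _ _ => continuousOn_const
      norm_le := fun _ _ p _ => hGB p
      mul_max_le := by
        simp only [sub_zero, zero_sub, neg_neg, max_self, NNReal.coe_zero]
        exact le_rfl }
  obtain ⟨α, h0, hα⟩ := hpl.exists_eq_forall_mem_Icc_hasDerivWithinAt₀
  refine ⟨α, h0, fun t ht => ?_⟩
  have hv : |(α t).2 - v₀| ≤ M * |t| := by
    have := Convex.norm_image_sub_le_of_norm_hasDerivWithin_le (f := fun t => (α t).2)
      (f' := fun t => (G (α t)).2) (s := Icc (-T) T) (C := M) (x := 0) (y := t)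
      (fun u hu => (hα u hu).snd) (fun u _ => by simpa [G] using hM (α u).1) (convex_Icc _ _)
      ⟨by linarith, hT.le⟩ ht
    have h0' : α 0 = (x₀, v₀) := h0
    simpa [h0'] using this
  have h2 : |(α t).2| ≤ R := by
    have h3 : |t| ≤ T := abs_le.2 ht
    have h4 : (M : ℝ) * |t| ≤ M * T := by gcongr
    have h5 := abs_sub_abs_le_abs_sub (α t).2 v₀
    linarith
  have h6 : G (α t) = phaseField F (α t) := by
    rw [abs_le] at h2
    simp [G, phaseField, min_eq_right h2.2, max_eq_right h2.1]
  rw [← h6]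
  exact hα t ht

theorem exists_orbit {F : ℝ → ℝ} {L M : ℝ≥0} (hF : LipschitzWith L F)
    (hM : ∀ x, |F x| ≤ M) (x₀ v₀ : ℝ) :
    ∃ x v : ℝ → ℝ, IsOrbit F x v ∧ x 0 = x₀ ∧ v 0 = v₀ := by
  have key : ∀ n : ℕ, ∃ α : ℝ → ℝ × ℝ, α 0 = (x₀, v₀) ∧
      ∀ t ∈ Ioo (-(n + 1 : ℝ)) (n + 1), HasDerivAt α (phaseField F (α t)) t := by
    intro n
    obtain ⟨α, h0, hα⟩ := exists_orbit_Icc hF hM x₀ v₀ (T := n + 1) (by positivity)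
    exact ⟨α, h0, fun t ht => (hα t (Ioo_subset_Icc_self ht)).hasDerivAt
      (Icc_mem_nhds ht.1 ht.2)⟩
  choose α h0 hα using key
  have hag : ∀ m n : ℕ, m ≤ n → ∀ t : ℝ, |t| < m + 1 → α m t = α n t := by
    intro m n hmn t ht
    have hmn' : (m : ℝ) ≤ n := by exact_mod_cast hmn
    exact ODE_solution_unique_of_mem_Ioo (v := fun _ => phaseField F) (s := fun _ => univ)
      (K := max 1 L) (t₀ := 0) (a := -(m + 1 : ℝ)) (b := m + 1)
      (fun _ _ => (phaseField_lipschitz hF).lipschitzOnWith)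
      ⟨by have : (0:ℝ) ≤ m := by positivity
          linarith, by positivity⟩
      (fun t ht => ⟨hα m t ht, trivial⟩)
      (fun t ht => ⟨hα n t ⟨by linarith [ht.1], by linarith [ht.2]⟩, trivial⟩)
      (by rw [h0, h0]) (abs_lt.1 ht)
  let β : ℝ → ℝ × ℝ := fun t => α ⌈|t|⌉₊ t
  have hβ : ∀ t, HasDerivAt β (phaseField F (β t)) t := by
    intro t
    set N := ⌈|t|⌉₊ with hN
    have htN : |t| ≤ N := Nat.le_ceil _
    have h1 : ∀ u : ℝ, |u| < N + 1 → β u = α (N + 1) u := by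
      intro u hu
      refine hag _ _ ?_ u (by linarith [Nat.le_ceil |u|])
      exact Nat.ceil_le.2 (by push_cast; exact hu.le)
    have h2 : β =ᶠ[𝓝 t] α (N + 1) := by
      have : ∀ᶠ u : ℝ in 𝓝 t, |u| < (N : ℝ) + 1 :=
        continuous_abs.continuousAt.eventually_lt_const (by linarith)
      filter_upwards [this] with u hu using h1 u hu
    rw [h1 t (by linarith)]
    refine (hα (N + 1) t ?_).congr_of_eventuallyEq h2
    have := abs_le.1 htN
    push_cast
    exact ⟨by linarith, by linarith⟩
  refine ⟨fun t => (β t).1, fun t => (β t).2, ⟨fun t => (hβ t).fst, fun t => (hβ t).snd⟩, ?_, ?_⟩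
  · simp [β, h0]
  · simp [β, h0]

theorem isOrbit_const {F : ℝ → ℝ} {c : ℝ} (hc : F c = 0) :
    IsOrbit F (fun _ => c) (fun _ => 0) :=
  ⟨fun t => hasDerivAt_const t c, fun t => by simpa [hc] using hasDerivAt_const t (0 : ℝ)⟩

theorem IsOrbit.continuous {F x v : ℝ → ℝ} (h : IsOrbit F x v) : Continuous x ∧ Continuous v :=
  ⟨continuous_iff_continuousAt.2 fun t => (h.1 t).continuousAt,
    continuous_iff_continuousAt.2 fun t => (h.2 t).continuousAt⟩

theorem IsOrbit.reflect {F x v : ℝ → ℝ} (h : IsOrbit F x v) (c : ℝ) :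
    IsOrbit F (fun t => x (c - t)) (fun t => -v (c - t)) := by
  constructor
  · intro t
    simpa using (h.1 (c - t)).comp_const_sub c t
  · intro t
    simpa using! ((h.2 (c - t)).comp_const_sub c t).neg

theorem IsOrbit.symm_of_velocity_eq_zero {F x v : ℝ → ℝ} {L : ℝ≥0} (hF : LipschitzWith L F)
    (h : IsOrbit F x v) {c : ℝ} (hc : v c = 0) (t : ℝ) :
    x (2 * c - t) = x t ∧ v (2 * c - t) = -v t := by
  have := (h.reflect (2 * c)).unique hF h (t₀ := c) (by simp [two_mul]) (by simp [two_mul, hc])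
  refine ⟨congrFun this.1 t, ?_⟩
  have h2 := congrFun this.2 t
  linarith

theorem IsOrbit.force_ne_zero {F x v : ℝ → ℝ} {L : ℝ≥0} (hF : LipschitzWith L F)
    (h : IsOrbit F x v) (hn : ¬ ∃ c, ∀ t, x t = c) {t : ℝ} (ht : v t = 0) : F (x t) ≠ 0 := by
  intro h0
  have := h.unique hF (isOrbit_const h0) (t₀ := t) rfl ht
  exact hn ⟨x t, fun u => congrFun this.1 u⟩

theorem IsOrbit.not_const {F x v : ℝ → ℝ} (h : IsOrbit F x v) {t : ℝ} (ht : F (x t) ≠ 0) :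
    ¬ ∃ c, ∀ t, x t = c := by
  rintro ⟨c, hc⟩
  have h1 : v = 0 := by
    funext u
    have : HasDerivAt x 0 u := (funext hc : x = fun _ => c) ▸ hasDerivAt_const u c
    exact (h.1 u).unique this
  have h2 := h.2 t
  rw [h1] at h2
  have := h2.unique (hasDerivAt_const t (0 : ℝ))
  exact ht (by linarith)

theorem IsOrbit.velocity_pos {F x v : ℝ → ℝ} (h : IsOrbit F x v) {a b : ℝ} (ha : v a = 0)
    (hF : ∀ t ∈ Icc a b, F (x t) < 0) {t : ℝ} (ht : t ∈ Ioc a b) : 0 < v t := by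
  have hm : StrictMonoOn v (Icc a b) := by
    apply strictMonoOn_of_deriv_pos (convex_Icc a b) h.continuous.2.continuousOn
    intro u hu
    rw [interior_Icc] at hu
    rw [(h.2 u).deriv]
    linarith [hF u (Ioo_subset_Icc_self hu)]
  rw [← ha]
  exact hm ⟨le_rfl, ht.1.le.trans ht.2⟩ ⟨ht.1.le, ht.2⟩ ht.1

/-- An orbit that starts at rest with positive acceleration and returns has a first turning point,
where the acceleration is negative. -/
theorem IsOrbit.exists_turning_point {F x v : ℝ → ℝ} {L : ℝ≥0} (hF : LipschitzWith L F)
    (h : IsOrbit F x v) (h0 : v 0 = 0) (hneg : F (x 0) < 0) {T : ℝ} (hT : 0 < T)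
    (hp : Function.Periodic x T) :
    ∃ τ, 0 < τ ∧ v τ = 0 ∧ (∀ t ∈ Ioo 0 τ, 0 < v t) ∧ 0 < F (x τ) := by
  have hcx := h.continuous.1
  have hcv := h.continuous.2
  obtain ⟨e, he, hneg'⟩ : ∃ e > 0, ∀ t ∈ Icc 0 e, F (x t) < 0 := by
    have : ∀ᶠ t in 𝓝 (0 : ℝ), F (x t) < 0 :=
      (hF.continuous.comp hcx).continuousAt.eventually_lt_const hneg
    obtain ⟨e, he, h⟩ := Metric.eventually_nhds_iff.1 this
    refine ⟨e / 2, by positivity, fun t ht => h ?_⟩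
    rw [Real.dist_eq, sub_zero, abs_of_nonneg ht.1]
    linarith [ht.2]
  have hpos : ∀ t ∈ Ioc 0 e, 0 < v t := fun t ht => h.velocity_pos h0 hneg' ht
  let A : Set ℝ := {t | e ≤ t ∧ v t = 0}
  have hA : IsClosed A := (isClosed_le continuous_const continuous_id).inter
    (isClosed_eq hcv continuous_const)
  have hne : A.Nonempty := by
    obtain ⟨c, hc, hc'⟩ := exists_hasDerivAt_eq_zero hT hcx.continuousOn
      (by simpa using (hp 0).symm) (fun t _ => h.1 t)
    refine ⟨c, ?_, hc'⟩
    by_contra hlt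
    exact (hpos c ⟨hc.1, (not_le.1 hlt).le⟩).ne' hc'
  have hbd : BddBelow A := ⟨e, fun t ht => ht.1⟩
  have hmem := hA.csInf_mem hne hbd
  set τ := sInf A with hτ
  have hτ0 : 0 < τ := he.trans_le hmem.1
  have hbefore : ∀ t ∈ Ioo 0 τ, 0 < v t := by
    intro t ht
    rcases le_or_gt t e with hte | hte
    · exact hpos t ⟨ht.1, hte⟩
    by_contra hle
    have h1 : (0 : ℝ) ∈ v '' Icc e t := intermediate_value_Icc' hte.le hcv.continuousOn
      ⟨not_lt.1 hle, (hpos e ⟨he, le_rfl⟩).le⟩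
    obtain ⟨u, hu, hu0⟩ := h1
    have : τ ≤ u := csInf_le hbd ⟨hu.1, hu0⟩
    linarith [hu.2, ht.2]
  refine ⟨τ, hτ0, hmem.2, hbefore, ?_⟩
  have hne0 := h.force_ne_zero hF (h.not_const hneg.ne) hmem.2
  by_contra hle
  have hlt : F (x τ) < 0 := lt_of_le_of_ne (not_lt.1 hle) hne0
  have : ∀ᶠ t in 𝓝 τ, F (x t) < 0 :=
    (hF.continuous.comp hcx).continuousAt.eventually_lt_const hlt
  obtain ⟨d, hd, hd'⟩ := Metric.eventually_nhds_iff.1 this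
  have h1 : StrictMonoOn v (Icc (τ - d / 2) τ) := by
    apply strictMonoOn_of_deriv_pos (convex_Icc _ _) hcv.continuousOn
    intro u hu
    rw [interior_Icc] at hu
    rw [(h.2 u).deriv]
    have := @hd' u (by rw [Real.dist_eq, abs_lt]; constructor <;> linarith [hu.1, hu.2])
    linarith
  have h2 := hbefore (max (τ / 2) (τ - d / 2))
    ⟨lt_max_of_lt_left (by linarith), max_lt (by linarith) (by linarith)⟩
  have h3 := h1 ⟨le_max_right (τ / 2) (τ - d / 2), max_le (by linarith) (by linarith)⟩
    ⟨by linarith, le_rfl⟩ (max_lt (by linarith) (by linarith))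
  linarith [hmem.2]

section Family

variable {F : ℝ → ℝ} {L : ℝ≥0} {φ ψ : ℝ → ℝ → ℝ}

theorem dist_le_of_family (hF : LipschitzWith L F) (hφ : ∀ s, IsOrbit F (φ s) (ψ s))
    (h0 : ∀ s, φ s 0 = s) (h0' : ∀ s, ψ s 0 = 0) (s s' t : ℝ) :
    |φ s t - φ s' t| ≤ |s - s'| * exp (max 1 L * |t|) ∧
      |ψ s t - ψ s' t| ≤ |s - s'| * exp (max 1 L * |t|) := by
  have key : ∀ {t : ℝ}, 0 ≤ t → |φ s t - φ s' t| ≤ |s - s'| * exp (max 1 L * t) ∧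
      |ψ s t - ψ s' t| ≤ |s - s'| * exp (max 1 L * t) := fun ht =>
    (hφ s).dist_le hF (hφ s') (by rw [h0, h0]) (by simp [h0']) ht
  have heven : ∀ s t, φ s t = φ s (-t) ∧ ψ s t = -ψ s (-t) := by
    intro s t
    have := (hφ s).symm_of_velocity_eq_zero hF (h0' s) (-t)
    simpa using this
  rcases le_or_gt 0 t with ht | ht
  · rw [abs_of_nonneg ht]
    exact key ht
  · rw [abs_of_neg ht, (heven s t).1, (heven s' t).1, (heven s t).2, (heven s' t).2]
    have := key (neg_nonneg.2 ht.le)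
    refine ⟨this.1, ?_⟩
    rw [show -ψ s (-t) - -ψ s' (-t) = -(ψ s (-t) - ψ s' (-t)) by ring, abs_neg]
    exact this.2

theorem continuous_family (hF : LipschitzWith L F) (hφ : ∀ s, IsOrbit F (φ s) (ψ s))
    (h0 : ∀ s, φ s 0 = s) (h0' : ∀ s, ψ s 0 = 0) :
    Continuous (fun q : ℝ × ℝ => φ q.1 q.2) ∧ Continuous (fun q : ℝ × ℝ => ψ q.1 q.2) := by
  have key : ∀ (χ : ℝ → ℝ → ℝ), (∀ s, Continuous (χ s)) →
      (∀ s s' t, |χ s t - χ s' t| ≤ |s - s'| * exp (max 1 L * |t|)) →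
      Continuous (fun q : ℝ × ℝ => χ q.1 q.2) := by
    intro χ hc hd
    rw [continuous_iff_continuousAt]
    rintro ⟨s, t⟩
    rw [ContinuousAt, tendsto_iff_dist_tendsto_zero]
    have hlim : Tendsto (fun q : ℝ × ℝ => |q.1 - s| * exp (max 1 L * |q.2|) + |χ s q.2 - χ s t|)
        (𝓝 (s, t)) (𝓝 0) := by
      have hc' : Continuous (fun q : ℝ × ℝ =>
          |q.1 - s| * exp (max 1 L * |q.2|) + |χ s q.2 - χ s t|) := by
        have := hc s
        fun_prop
      simpa using hc'.tendsto (s, t)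
    refine squeeze_zero (fun _ => dist_nonneg) (fun q => ?_) hlim
    rw [Real.dist_eq]
    calc |χ q.1 q.2 - χ s t| ≤ |χ q.1 q.2 - χ s q.2| + |χ s q.2 - χ s t| := abs_sub_le _ _ _
      _ ≤ _ := by gcongr; exact hd _ _ _
  exact ⟨key φ (fun s => (hφ s).continuous.1) fun s s' t =>
      (dist_le_of_family hF hφ h0 h0' s s' t).1,
    key ψ (fun s => (hφ s).continuous.2) fun s s' t =>
      (dist_le_of_family hF hφ h0 h0' s s' t).2⟩

/-- If all orbits of a one-parameter family are periodic with pairwise commensurable periods, then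
they have a common period. -/
theorem exists_common_period (hF : LipschitzWith L F) (hφ : ∀ s, IsOrbit F (φ s) (ψ s))
    (h0 : ∀ s, φ s 0 = s) (h0' : ∀ s, ψ s 0 = 0) {α p : ℝ} (hαp : α < p)
    (hneg : ∀ s ∈ Ioo α p, F s < 0)
    (hper : ∀ s ∈ Ioo α p, ∃ T, 0 < T ∧ Function.Periodic (φ s) T)
    (hcomm : ∀ s ∈ Ioo α p, ∀ s' ∈ Ioo α p, ∀ T T', 0 < T → Function.Periodic (φ s) T →
      0 < T' → Function.Periodic (φ s') T' → ∃ q : ℚ, T / T' = q) :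
    ∃ T, 0 < T ∧ ∀ s ∈ Ioo α p, Function.Periodic (φ s) T := by
  obtain ⟨hcφ, hcψ⟩ := continuous_family hF hφ h0 h0'
  have hτ : ∀ s ∈ Ioo α p, ∃ τ, 0 < τ ∧ ψ s τ = 0 ∧ (∀ t ∈ Ioo 0 τ, 0 < ψ s t) ∧
      0 < F (φ s τ) := by
    intro s hs
    obtain ⟨T, hT, hp⟩ := hper s hs
    exact (hφ s).exists_turning_point hF (h0' s) (by rw [h0]; exact hneg s hs) hT hp
  choose! τ hτpos hτ0 hτbefore hτF using hτ
  have hperiod : ∀ s ∈ Ioo α p, Function.Periodic (φ s) (2 * τ s) := by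
    intro s hs t
    have h1 := ((hφ s).symm_of_velocity_eq_zero hF (hτ0 s hs) (-t)).1
    have h2 := ((hφ s).symm_of_velocity_eq_zero hF (h0' s) t).1
    rw [show t + 2 * τ s = 2 * τ s - -t by ring, h1, ← h2]
    simp
  have hcont : ContinuousOn τ (Ioo α p) := by
    intro s hs
    apply ContinuousAt.continuousWithinAt
    have hnhds : ∀ᶠ s' in 𝓝 s, s' ∈ Ioo α p := Ioo_mem_nhds hs.1 hs.2
    rw [ContinuousAt, tendsto_order]
    constructor
    · intro c hc
      obtain ⟨e, he, heF⟩ : ∃ e > 0, ∀ t ∈ Icc 0 e, F (φ s t) < 0 := by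
        have : ∀ᶠ t in 𝓝 (0 : ℝ), F (φ s t) < 0 :=
          (hF.continuous.comp (hφ s).continuous.1).continuousAt.eventually_lt_const
            (by simpa [h0] using hneg s hs)
        obtain ⟨e, he, h⟩ := Metric.eventually_nhds_iff.1 this
        refine ⟨e / 2, by positivity, fun t ht => h ?_⟩
        rw [Real.dist_eq, sub_zero, abs_of_nonneg ht.1]
        linarith [ht.2]
      have e1 : ∀ᶠ s' in 𝓝 s, ∀ t ∈ Icc 0 e, F (φ s' t) < 0 := by
        apply isCompact_Icc.eventually_forall_of_forall_eventually
        intro t ht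
        exact (hF.continuous.comp hcφ).continuousAt.eventually_lt_const (heF t ht)
      have e2 : ∀ᶠ s' in 𝓝 s, ∀ t ∈ Icc e c, 0 < ψ s' t := by
        apply isCompact_Icc.eventually_forall_of_forall_eventually
        intro t ht
        exact hcψ.continuousAt.eventually_const_lt
          (hτbefore s hs t ⟨he.trans_le ht.1, ht.2.trans_lt hc⟩)
      filter_upwards [e1, e2, hnhds] with s' h1 h2 h3
      by_contra hle
      rw [not_lt] at hle
      rcases le_or_gt (τ s') e with h4 | h4
      · exact ((hφ s').velocity_pos (h0' s') h1 ⟨hτpos s' h3, h4⟩).ne' (hτ0 s' h3)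
      · exact (h2 _ ⟨h4.le, hle⟩).ne' (hτ0 s' h3)
    · intro c hc
      obtain ⟨u, hu, hu'⟩ : ∃ u ∈ Ioo (τ s) c, ψ s u < 0 := by
        have : ∀ᶠ t in 𝓝 (τ s), 0 < F (φ s t) :=
          (hF.continuous.comp (hφ s).continuous.1).continuousAt.eventually_const_lt (hτF s hs)
        obtain ⟨d, hd, hd'⟩ := Metric.eventually_nhds_iff.1 this
        have h1 : StrictAntiOn (ψ s) (Icc (τ s) (τ s + d / 2)) := by
          apply strictAntiOn_of_deriv_neg (convex_Icc _ _) (hφ s).continuous.2.continuousOn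
          intro u hu
          rw [interior_Icc] at hu
          rw [((hφ s).2 u).deriv]
          have := @hd' u (by rw [Real.dist_eq, abs_lt]; constructor <;> linarith [hu.1, hu.2])
          linarith
        have hm : τ s < min ((τ s + c) / 2) (τ s + d / 2) := lt_min (by linarith) (by linarith)
        refine ⟨min ((τ s + c) / 2) (τ s + d / 2), ⟨hm, ?_⟩, ?_⟩
        · exact (min_le_left _ _).trans_lt (by linarith)
        · have := h1 ⟨le_rfl, by linarith⟩ ⟨hm.le, min_le_right _ _⟩ hm
          linarith [hτ0 s hs]
      have e1 : ∀ᶠ s' in 𝓝 s, ψ s' u < 0 :=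
        (hcψ.comp (by fun_prop : Continuous fun s' : ℝ => (s', u))).continuousAt.eventually_lt_const
          hu'
      filter_upwards [e1, hnhds] with s' h1 h2
      by_contra hle
      rw [not_lt] at hle
      have hu0 : 0 < u := (hτpos s hs).trans hu.1
      exact absurd (hτbefore s' h2 u ⟨hu0, hu.2.trans_le hle⟩) (by linarith)
  set s₁ := (α + p) / 2 with hs₁
  have hs₁' : s₁ ∈ Ioo α p := ⟨by linarith, by linarith⟩
  have hcount : (τ '' Ioo α p).Countable := by
    refine (countable_range fun q : ℚ => (q : ℝ) * τ s₁).mono ?_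
    rintro _ ⟨s, hs, rfl⟩
    obtain ⟨q, hq⟩ := hcomm s hs s₁ hs₁' (2 * τ s) (2 * τ s₁) (by linarith [hτpos s hs])
      (hperiod s hs) (by linarith [hτpos s₁ hs₁']) (hperiod s₁ hs₁')
    refine ⟨q, ?_⟩
    have := (hτpos s₁ hs₁').ne'
    simp only
    rw [← hq]
    field_simp
  have hsub := hcount.isTotallyDisconnected _ subset_rfl (isPreconnected_Ioo.image τ hcont)
  refine ⟨2 * τ s₁, by linarith [hτpos s₁ hs₁'], fun s hs => ?_⟩
  rw [← hsub (mem_image_of_mem τ hs) (mem_image_of_mem τ hs₁')]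
  exact hperiod s hs

end Family

theorem abs_sub_le_of_abs_deriv_le {y w : ℝ → ℝ} {G t : ℝ} (ht : 0 ≤ t)
    (hy : ∀ u, HasDerivAt y (w u) u) (hw : ∀ u ∈ Icc 0 t, |w u| ≤ G) : |y t - y 0| ≤ G * t := by
  have := Convex.norm_image_sub_le_of_norm_hasDerivWithin_le (f := y) (f' := w) (s := Icc 0 t)
    (C := G) (x := 0) (y := t) (fun u _ => (hy u).hasDerivWithinAt) hw (convex_Icc _ _)
    ⟨le_rfl, ht⟩ ⟨ht, le_rfl⟩
  simpa [abs_of_nonneg ht] using this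

theorem hasDerivAt_cos_mul (ν t : ℝ) :
    HasDerivAt (fun t => cos (ν * t)) (-(ν * sin (ν * t))) t := by
  have := ((hasDerivAt_id t).const_mul ν).cos
  simp only [id, mul_one] at this
  convert this using 1
  ring

theorem hasDerivAt_sin_mul (ν t : ℝ) :
    HasDerivAt (fun t => sin (ν * t)) (ν * cos (ν * t)) t := by
  have := ((hasDerivAt_id t).const_mul ν).sin
  simp only [id, mul_one] at this
  convert this using 1
  ring

/-- The forced oscillator, starting at rest at the origin, grows at most linearly. -/
theorem forced_oscillator_le {ν G t : ℝ} (hν : 0 < ν) (ht : 0 ≤ t) {y w g : ℝ → ℝ}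
    (hy : ∀ u, HasDerivAt y (w u) u) (hw : ∀ u, HasDerivAt w (g u - ν ^ 2 * y u) u)
    (y0 : y 0 = 0) (w0 : w 0 = 0) (hg : ∀ u ∈ Icc 0 t, |g u| ≤ G) : |y t| ≤ G * t / ν := by
  have hd : ∀ u, HasDerivAt (fun u => w u * sin (ν * (t - u)) + ν * (y u * cos (ν * (t - u))))
      (g u * sin (ν * (t - u))) u := by
    intro u
    have h1 : HasDerivAt (fun u => t - u) (-1) u := by
      simpa using (hasDerivAt_id u).const_sub t
    have hs := (h1.const_mul ν).sin
    have hc := (h1.const_mul ν).cos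
    refine HasDerivAt.congr_deriv (((hw u).mul hs).add (((hy u).mul hc).const_mul ν)) ?_
    ring
  have := abs_sub_le_of_abs_deriv_le (G := G) ht hd (fun u hu => by
    rw [abs_mul]
    exact (mul_le_of_le_one_right (abs_nonneg _) (abs_sin_le_one _)).trans (hg u hu))
  simp only [y0, w0, sub_self, mul_zero, sin_zero, cos_zero, mul_one, zero_mul, zero_add,
    add_zero, sub_zero] at this
  rw [abs_mul, abs_of_pos hν] at this
  rw [le_div_iff₀ hν]
  linarith

theorem eq_zero_of_abs_le_mul_small {c K : ℝ}
    (h : ∀ ε > 0, ∃ e, 0 < e ∧ e < ε ∧ |c| ≤ K * e) : c = 0 := by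
  by_contra hc
  have hc' : 0 < |c| := abs_pos.2 hc
  obtain ⟨e, he, he', hle⟩ := h (|c| / (|K| + 1)) (by positivity)
  rw [lt_div_iff₀ (by positivity)] at he'
  have : K * e ≤ |K| * e := by gcongr; exact le_abs_self K
  nlinarith

theorem IsOrbit.velocity_periodic {f x v : ℝ → ℝ} (h : IsOrbit f x v) {T : ℝ}
    (hp : Function.Periodic x T) : Function.Periodic v T := by
  intro t
  have h1 := (h.1 (t + T)).comp_add_const t T
  rw [show (fun t => x (t + T)) = x from funext hp] at h1
  exact h1.unique (h.1 t)

/-- There are `T`-periodic orbits of arbitrarily small amplitude, starting at rest near `0`. -/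
def HasSmallPeriodicOrbits (f : ℝ → ℝ) (T C : ℝ) : Prop :=
  ∀ ε > 0, ∃ x v : ℝ → ℝ, IsOrbit f x v ∧ v 0 = 0 ∧ 0 < |x 0| ∧ |x 0| < ε ∧
    Function.Periodic x T ∧ ∀ t, |x t| ≤ C * |x 0|

theorem HasSmallPeriodicOrbits.cos_eq_one {f : ℝ → ℝ} {T C ν B r : ℝ} (hν : 0 < ν) (hT : 0 < T)
    (hC : 0 < C) (hr : 0 < r) (hf : ∀ u, |u| ≤ r → |f u - ν ^ 2 * u| ≤ B * u ^ 2)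
    (h : HasSmallPeriodicOrbits f T C) : cos (ν * T) = 1 := by
  have hB : 0 ≤ B := by
    have := (abs_nonneg _).trans (hf r (abs_of_pos hr).le)
    exact nonneg_of_mul_nonneg_left this (by positivity)
  have : 1 - cos (ν * T) = 0 := by
    refine eq_zero_of_abs_le_mul_small (K := B * C ^ 2 * T / ν) fun ε hε => ?_
    obtain ⟨x, v, ho, hv0, hx0, hxε, hp, hamp⟩ := h (min ε (r / C)) (by positivity)
    have hxr : C * |x 0| ≤ r := by
      have := hxε.trans_le (min_le_right _ _)
      rw [lt_div_iff₀ hC] at this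
      linarith
    refine ⟨|x 0|, hx0, hxε.trans_le (min_le_left _ _), ?_⟩
    have h1 := forced_oscillator_le (ν := ν) (G := B * (C * |x 0|) ^ 2) hν hT.le
      (y := fun t => x t - x 0 * cos (ν * t)) (w := fun t => v t + x 0 * (ν * sin (ν * t)))
      (g := fun t => -(f (x t) - ν ^ 2 * x t))
      (fun u => by
        refine HasDerivAt.congr_deriv ((ho.1 u).sub ((hasDerivAt_cos_mul ν u).const_mul (x 0))) ?_
        ring)
      (fun u => by
        refine HasDerivAt.congr_deriv ((ho.2 u).add (((hasDerivAt_sin_mul ν u).const_mul ν).const_mul (x 0))) ?_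
        ring)
      (by simp) (by simp [hv0])
      (fun u _ => by
        rw [abs_neg]
        refine (hf _ ((hamp u).trans hxr)).trans ?_
        gcongr ?_ * ?_
        rw [← sq_abs]
        gcongr
        exact hamp u)
    have h2 : x T = x 0 := by simpa using hp 0
    simp only [h2] at h1
    rw [show x 0 - x 0 * cos (ν * T) = x 0 * (1 - cos (ν * T)) by ring, abs_mul] at h1
    have h3 : |x 0| * |1 - cos (ν * T)| ≤ |x 0| * (B * C ^ 2 * T / ν * |x 0|) := by
      refine h1.trans (le_of_eq ?_)
      field_simp
    exact le_of_mul_le_mul_left h3 hx0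
  linarith

/-- The second order condition for isochronism: if orbits of arbitrarily small amplitude have the
same period as the linearized oscillator, then the quadratic and the cubic coefficients of the
force are related. -/
theorem HasSmallPeriodicOrbits.coeff_relation {f : ℝ → ℝ} {T C ν a₂ a₃ M r : ℝ} (hν : 0 < ν)
    (hT : 0 < T) (hC : 0 < C) (hr : 0 < r) (hr1 : r ≤ 1)
    (hf : ∀ u, |u| ≤ r → |f u - ν ^ 2 * u - a₂ * u ^ 2 - a₃ * u ^ 3| ≤ M * u ^ 4)
    (h : HasSmallPeriodicOrbits f T C) (hcos : cos (ν * T) = 1) :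
    9 * a₃ * ν ^ 2 = 10 * a₂ ^ 2 := by
  have hM : 0 ≤ M := by
    have := (abs_nonneg _).trans (hf r (abs_of_pos hr).le)
    exact nonneg_of_mul_nonneg_left this (by positivity)
  have hsin : sin (ν * T) = 0 := by
    have := sin_sq_add_cos_sq (ν * T)
    rw [hcos] at this
    nlinarith
  have hf2 : ∀ u, |u| ≤ r → |f u - ν ^ 2 * u - a₂ * u ^ 2| ≤ (|a₃| + M) * |u| ^ 3 := by
    intro u hu
    have e : f u - ν ^ 2 * u - a₂ * u ^ 2
        = (f u - ν ^ 2 * u - a₂ * u ^ 2 - a₃ * u ^ 3) + a₃ * u ^ 3 := by ring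
    rw [e]
    have h1 := abs_add_le (f u - ν ^ 2 * u - a₂ * u ^ 2 - a₃ * u ^ 3) (a₃ * u ^ 3)
    have h2 : |a₃ * u ^ 3| = |a₃| * |u| ^ 3 := by rw [abs_mul, abs_pow]
    have h3 : u ^ 4 ≤ |u| ^ 3 := by
      rw [← (by decide : Even 4).pow_abs]
      exact pow_le_pow_of_le_one (abs_nonneg u) (hu.trans hr1) (by norm_num)
    nlinarith [hf u hu]
  have hf1 : ∀ u, |u| ≤ r → |f u - ν ^ 2 * u| ≤ (|a₂| + |a₃| + M) * |u| ^ 2 := by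
    intro u hu
    have e : f u - ν ^ 2 * u = (f u - ν ^ 2 * u - a₂ * u ^ 2) + a₂ * u ^ 2 := by ring
    rw [e]
    have h1 := abs_add_le (f u - ν ^ 2 * u - a₂ * u ^ 2) (a₂ * u ^ 2)
    have h2 : |a₂ * u ^ 2| = |a₂| * |u| ^ 2 := by rw [abs_mul, abs_pow]
    have h3 : |u| ^ 3 ≤ |u| ^ 2 :=
      pow_le_pow_of_le_one (abs_nonneg u) (hu.trans hr1) (by norm_num)
    have h4 : 0 ≤ |a₃| + M := by positivity
    nlinarith [hf2 u hu]
  set B := |a₂| + |a₃| + M with hBdef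
  have hB : 0 ≤ B := by positivity
  set K₁ := B * C ^ 2 * T / ν with hK₁
  have hK₁0 : 0 ≤ K₁ := by positivity
  set G₂ := (|a₃| + M) * C ^ 3 + |a₂| * (K₁ * (C + 1)) with hG₂
  have hG₂0 : 0 ≤ G₂ := by positivity
  set K₂ := G₂ * T / ν with hK₂
  have hK₂0 : 0 ≤ K₂ := by positivity
  set G₃ := M * C ^ 4 + |a₂| * (K₁ ^ 2 + 2 * K₂) + |a₃| * (K₁ * (C ^ 2 + C + 1)) with hG₃
  set γ := a₂ / (3 * ν ^ 2) with hγ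
  have hγ' : a₂ = 3 * ν ^ 2 * γ := by rw [hγ]; field_simp
  set Y : ℝ → ℝ := fun t => -2 * γ + γ * cos (ν * t) + γ * cos (ν * t) ^ 2 with hY
  set Y' : ℝ → ℝ := fun t => -(γ * (ν * sin (ν * t))) - 2 * γ * (ν * (sin (ν * t) * cos (ν * t)))
    with hY'
  have hdY : ∀ t, HasDerivAt Y (Y' t) t := by
    intro t
    have h1 := hasDerivAt_cos_mul ν t
    refine HasDerivAt.congr_deriv ((h1.const_mul γ).const_add (-2 * γ) |>.add ((h1.pow 2).const_mul γ)) ?_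
    simp only [hY']
    push_cast
    ring
  have hdY' : ∀ t, HasDerivAt Y' (-(a₂ * cos (ν * t) ^ 2) - ν ^ 2 * Y t) t := by
    intro t
    have h1 := hasDerivAt_cos_mul ν t
    have h2 := hasDerivAt_sin_mul ν t
    refine HasDerivAt.congr_deriv (((h2.const_mul ν).const_mul γ).neg.sub
      (((h2.mul h1).const_mul ν).const_mul (2 * γ))) ?_
    simp only [hY]
    rw [hγ']
    have := sin_sq_add_cos_sq (ν * t)
    linear_combination (2 * ν ^ 2 * γ) * this
  have key : 2 * a₂ * (-2 * γ / 2 + γ * (3 / 8)) + a₃ * (3 / 8) = 0 := by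
    refine eq_zero_of_abs_le_mul_small (K := G₃) fun ε hε => ?_
    obtain ⟨x, v, ho, hv0, hx0, hxε, hp, hamp⟩ := h (min ε (r / C)) (by positivity)
    set e := |x 0| with he
    have hxr : C * e ≤ r := by
      have := hxε.trans_le (min_le_right _ _)
      rw [lt_div_iff₀ hC] at this
      linarith
    have hamp' : ∀ t, |x t| ≤ r := fun t => (hamp t).trans hxr
    have hce : ∀ t, |x 0 * cos (ν * t)| ≤ e := fun t => by
      rw [abs_mul]
      exact mul_le_of_le_one_right (abs_nonneg _) (abs_cos_le_one _)
    refine ⟨e, hx0, hxε.trans_le (min_le_left _ _), ?_⟩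
    have b1 : ∀ t ∈ Icc 0 T, |x t - x 0 * cos (ν * t)| ≤ K₁ * e ^ 2 := by
      intro t ht
      have h1 := forced_oscillator_le (ν := ν) (G := B * (C * e) ^ 2) hν ht.1
        (y := fun t => x t - x 0 * cos (ν * t)) (w := fun t => v t + x 0 * (ν * sin (ν * t)))
        (g := fun t => -(f (x t) - ν ^ 2 * x t))
        (fun u => by
          refine HasDerivAt.congr_deriv ((ho.1 u).sub ((hasDerivAt_cos_mul ν u).const_mul (x 0))) ?_
          ring)
        (fun u => by
          refine HasDerivAt.congr_deriv ((ho.2 u).add (((hasDerivAt_sin_mul ν u).const_mul ν).const_mul (x 0))) ?_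
          ring)
        (by simp) (by simp [hv0])
        (fun u _ => by
          rw [abs_neg]
          refine (hf1 _ (hamp' u)).trans ?_
          gcongr
          exact hamp u)
      refine h1.trans ?_
      rw [hK₁]
      have : B * (C * e) ^ 2 * t / ν ≤ B * (C * e) ^ 2 * T / ν := by
        gcongr
        exact ht.2
      refine this.trans (le_of_eq ?_)
      ring
    have b2 : ∀ t ∈ Icc 0 T, |x t - x 0 * cos (ν * t) - x 0 ^ 2 * Y t| ≤ K₂ * e ^ 3 := by
      intro t ht
      have h1 := forced_oscillator_le (ν := ν) (G := G₂ * e ^ 3) hν ht.1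
        (y := fun t => x t - x 0 * cos (ν * t) - x 0 ^ 2 * Y t)
        (w := fun t => v t + x 0 * (ν * sin (ν * t)) - x 0 ^ 2 * Y' t)
        (g := fun t => -(f (x t) - ν ^ 2 * x t - a₂ * x t ^ 2)
          - a₂ * ((x t - x 0 * cos (ν * t)) * (x t + x 0 * cos (ν * t))))
        (fun u => by
          refine HasDerivAt.congr_deriv (((ho.1 u).sub ((hasDerivAt_cos_mul ν u).const_mul (x 0))).sub
            ((hdY u).const_mul (x 0 ^ 2))) ?_
          ring)
        (fun u => by
          refine HasDerivAt.congr_deriv (((ho.2 u).add (((hasDerivAt_sin_mul ν u).const_mul ν).const_mul (x 0))).sub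
            ((hdY' u).const_mul (x 0 ^ 2))) ?_
          ring)
        (by simp only [hY, mul_zero, cos_zero]; ring) (by simp [hv0, hY'])
        (fun u hu => by
          have h2 : |f (x u) - ν ^ 2 * x u - a₂ * x u ^ 2| ≤ (|a₃| + M) * (C * e) ^ 3 := by
            refine (hf2 _ (hamp' u)).trans ?_
            gcongr
            exact hamp u
          have h3 : |a₂ * ((x u - x 0 * cos (ν * u)) * (x u + x 0 * cos (ν * u)))|
              ≤ |a₂| * ((K₁ * e ^ 2) * (C * e + e)) := by
            rw [abs_mul, abs_mul]
            gcongr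
            · exact b1 u ⟨hu.1, hu.2.trans ht.2⟩
            · exact (abs_add_le _ _).trans (add_le_add (hamp u) (hce u))
          refine (abs_sub _ _).trans ?_
          rw [abs_neg]
          refine (add_le_add h2 h3).trans (le_of_eq ?_)
          rw [hG₂]
          ring)
      refine h1.trans ?_
      rw [hK₂]
      have : G₂ * e ^ 3 * t / ν ≤ G₂ * e ^ 3 * T / ν := by
        gcongr
        exact ht.2
      refine this.trans (le_of_eq ?_)
      ring
    let P₂ : ℝ → ℝ := fun t => t / 2 + sin (ν * t) * cos (ν * t) / (2 * ν)
    let P₃ : ℝ → ℝ := fun t => (sin (ν * t) - sin (ν * t) ^ 3 / 3) / ν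
    let P₄ : ℝ → ℝ := fun t => 3 * t / 8 +
      (sin (ν * t) * cos (ν * t) ^ 3 / 4 + 3 * (sin (ν * t) * cos (ν * t)) / 8) / ν
    have hP₂ : ∀ t, HasDerivAt P₂ (cos (ν * t) ^ 2) t := by
      intro t
      have h1 := hasDerivAt_cos_mul ν t
      have h2 := hasDerivAt_sin_mul ν t
      refine HasDerivAt.congr_deriv (((hasDerivAt_id t).div_const 2).add ((h2.mul h1).div_const (2 * ν))) ?_
      have := sin_sq_add_cos_sq (ν * t)
      field_simp
      linear_combination -this
    have hP₃ : ∀ t, HasDerivAt P₃ (cos (ν * t) ^ 3) t := by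
      intro t
      have h2 := hasDerivAt_sin_mul ν t
      refine HasDerivAt.congr_deriv (((h2.sub ((h2.pow 3).div_const 3)).div_const ν)) ?_
      have := sin_sq_add_cos_sq (ν * t)
      push_cast
      field_simp
      linear_combination -cos (ν * t) * this
    have hP₄ : ∀ t, HasDerivAt P₄ (cos (ν * t) ^ 4) t := by
      intro t
      have h1 := hasDerivAt_cos_mul ν t
      have h2 := hasDerivAt_sin_mul ν t
      refine HasDerivAt.congr_deriv ((((hasDerivAt_id t).const_mul 3).div_const 8).add
        ((((h2.mul (h1.pow 3)).div_const 4).add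
          (((h2.mul h1).const_mul 3).div_const 8)).div_const ν)) ?_
      have := sin_sq_add_cos_sq (ν * t)
      push_cast
      simp only [Pi.pow_apply]
      field_simp
      linear_combination (-24 * cos (ν * t) ^ 2 - 12) * this
    have h1 := abs_sub_le_of_abs_deriv_le (t := T) (G := G₃ * e ^ 4) hT.le
      (y := fun t => (v t * cos (ν * t) + ν * (x t * sin (ν * t))) + (a₂ * x 0 ^ 2 * P₃ t +
        x 0 ^ 3 * (2 * a₂ * (-2 * γ * P₂ t + γ * P₃ t + γ * P₄ t) + a₃ * P₄ t)))
      (w := fun t => -cos (ν * t) * ((f (x t) - ν ^ 2 * x t - a₂ * x t ^ 2 - a₃ * x t ^ 3)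
        + a₂ * ((x t - x 0 * cos (ν * t)) ^ 2
          + 2 * (x 0 * cos (ν * t)) * (x t - x 0 * cos (ν * t) - x 0 ^ 2 * Y t))
        + a₃ * ((x t - x 0 * cos (ν * t)) * (x t ^ 2 + x t * (x 0 * cos (ν * t))
          + (x 0 * cos (ν * t)) ^ 2))))
      (fun u => by
        have hc := hasDerivAt_cos_mul ν u
        have hs := hasDerivAt_sin_mul ν u
        have hA := ((((hP₂ u).const_mul (-2 * γ)).add ((hP₃ u).const_mul γ)).add
          ((hP₄ u).const_mul γ)).const_mul (2 * a₂) |>.add ((hP₄ u).const_mul a₃)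
        refine HasDerivAt.congr_deriv ((((ho.2 u).mul hc).add (((ho.1 u).mul hs).const_mul ν)).add
          (((hP₃ u).const_mul (a₂ * x 0 ^ 2)).add (hA.const_mul (x 0 ^ 3)))) ?_
        simp only [hY]
        ring)
      (fun u hu => by
        have q1 : |f (x u) - ν ^ 2 * x u - a₂ * x u ^ 2 - a₃ * x u ^ 3| ≤ M * (C * e) ^ 4 := by
          refine (hf _ (hamp' u)).trans ?_
          rw [← (by decide : Even 4).pow_abs]
          gcongr
          exact hamp u
        have q2 : |a₂ * ((x u - x 0 * cos (ν * u)) ^ 2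
            + 2 * (x 0 * cos (ν * u)) * (x u - x 0 * cos (ν * u) - x 0 ^ 2 * Y u))|
            ≤ |a₂| * ((K₁ * e ^ 2) ^ 2 + 2 * e * (K₂ * e ^ 3)) := by
          rw [abs_mul]
          gcongr
          refine (abs_add_le _ _).trans ?_
          rw [abs_pow, abs_mul, abs_mul, abs_two]
          gcongr
          · exact b1 u hu
          · exact hce u
          · exact b2 u hu
        have q3 : |a₃ * ((x u - x 0 * cos (ν * u)) * (x u ^ 2 + x u * (x 0 * cos (ν * u))
            + (x 0 * cos (ν * u)) ^ 2))|
            ≤ |a₃| * ((K₁ * e ^ 2) * ((C * e) ^ 2 + C * e * e + e ^ 2)) := by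
          rw [abs_mul, abs_mul]
          gcongr
          · exact b1 u hu
          · refine (abs_add_le _ _).trans ?_
            refine (add_le_add_left (abs_add_le _ _) _).trans ?_
            rw [abs_pow, abs_mul (x u), abs_pow]
            gcongr
            · exact hamp u
            · exact hamp u
            · exact hce u
            · exact hce u
        rw [abs_mul, abs_neg]
        refine (mul_le_of_le_one_left (abs_nonneg _) (abs_cos_le_one _)).trans ?_
        refine (abs_add_three _ _ _).trans ?_
        refine (add_le_add (add_le_add q1 q2) q3).trans (le_of_eq ?_)
        rw [hG₃]
        ring)
    have hvT : v T = 0 := by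
      have := ho.velocity_periodic hp 0
      rw [zero_add] at this
      rw [this, hv0]
    simp only [P₂, P₃, P₄, hvT, hv0, hsin, mul_zero, sin_zero, cos_zero, zero_mul, zero_add,
      add_zero, sub_zero, zero_div, ne_eq, OfNat.ofNat_ne_zero, not_false_eq_true, zero_pow]
      at h1
    rw [show x 0 ^ 3 * (2 * a₂ * (-2 * γ * (T / 2) + γ * (3 * T / 8)) + a₃ * (3 * T / 8))
      = x 0 ^ 3 * (T * (2 * a₂ * (-2 * γ / 2 + γ * (3 / 8)) + a₃ * (3 / 8))) by ring, abs_mul,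
      abs_mul, abs_pow, abs_of_pos hT] at h1
    have h3 : e ^ 3 * T * |2 * a₂ * (-2 * γ / 2 + γ * (3 / 8)) + a₃ * (3 / 8)|
        ≤ e ^ 3 * T * (G₃ * e) := by
      refine le_of_eq_of_le ?_ (h1.trans (le_of_eq ?_)) <;> ring
    exact le_of_mul_le_mul_left h3 (by positivity)
  have : a₂ * γ * ν ^ 2 * 3 = a₂ ^ 2 := by
    rw [hγ]
    field_simp
  linear_combination 24 * ν ^ 2 * key + 10 * this

/-- Near a degenerate equilibrium there are no orbits of a fixed period. -/
theorem no_common_period_of_deriv_eq_zero {F : ℝ → ℝ} {L : ℝ≥0} (hF : LipschitzWith L F)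
    {φ ψ : ℝ → ℝ → ℝ} (hφ : ∀ s, IsOrbit F (φ s) (ψ s)) (h0 : ∀ s, φ s 0 = s)
    (h0' : ∀ s, ψ s 0 = 0) {α p T : ℝ} (hαp : α < p) (hneg : ∀ s ∈ Ioo α p, F s < 0)
    (hT : 0 < T) (hper : ∀ s ∈ Ioo α p, Function.Periodic (φ s) T) (hp : F p = 0)
    (hd : HasDerivWithinAt F 0 (Iic p) p) : False := by
  set C := exp (max 1 L * T) with hC
  have hC1 : 1 ≤ C := by
    rw [hC]
    apply one_le_exp
    positivity
  have hd' : ∀ᶠ u in 𝓝[Iic p] p, |F u| ≤ 1 / (2 * C * T ^ 2) * |u - p| := by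
    have := hd.isLittleO.bound (c := 1 / (2 * C * T ^ 2)) (by positivity)
    simpa [hp] using this
  obtain ⟨d, hd0, hd''⟩ := Metric.eventually_nhds_iff.1 (eventually_nhdsWithin_iff.1 hd')
  set e := min (d / (2 * C)) ((p - α) / (2 * C)) with he
  have he0 : 0 < e := by
    have : 0 < p - α := by linarith
    positivity
  have hed : C * e < d := by
    have : e ≤ d / (2 * C) := min_le_left _ _
    rw [le_div_iff₀ (by positivity)] at this
    linarith
  have heα : C * e < p - α := by
    have : e ≤ (p - α) / (2 * C) := min_le_right _ _
    rw [le_div_iff₀ (by positivity)] at this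
    linarith
  have hs : p - e ∈ Ioo α p := ⟨by nlinarith, by linarith⟩
  have hamp : ∀ t ∈ Icc 0 T, |φ (p - e) t - p| ≤ C * e := by
    intro t ht
    have h1 := (hφ (p - e)).dist_le hF (isOrbit_const hp) (δ := e) (by simp [h0, abs_of_pos he0])
      (by simp [h0', he0.le]) ht.1
    refine h1.1.trans ?_
    rw [mul_comm, hC]
    gcongr
    exact ht.2
  have hcx := (hφ (p - e)).continuous.1
  have hlt : ∀ t ∈ Icc 0 T, φ (p - e) t < p := by
    by_contra hcon
    push Not at hcon
    obtain ⟨t₁, ht₁, hle⟩ := hcon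
    let A : Set ℝ := {t | 0 ≤ t ∧ p ≤ φ (p - e) t}
    have hA : IsClosed A := (isClosed_le continuous_const continuous_id).inter
      (isClosed_le continuous_const hcx)
    have hbd : BddBelow A := ⟨0, fun t ht => ht.1⟩
    have hmem := hA.csInf_mem ⟨t₁, ht₁.1, hle⟩ hbd
    set σ := sInf A with hσ
    have hσT : σ ≤ T := (csInf_le hbd ⟨ht₁.1, hle⟩).trans ht₁.2
    have hbefore : ∀ t ∈ Ico 0 σ, φ (p - e) t < p := by
      intro t ht
      by_contra h
      exact absurd (csInf_le hbd (show t ∈ A from ⟨ht.1, not_lt.1 h⟩)) (not_le.2 ht.2)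
    have hσ0 : 0 < σ := by
      rcases hmem.1.lt_or_eq with h | h
      · exact h
      · have := hmem.2
        rw [← h, h0] at this
        linarith
    have hle' : ∀ t ∈ Icc 0 σ, φ (p - e) t ≤ p := by
      intro t ht
      have hcl : Icc 0 σ ⊆ closure (Ico 0 σ) := by rw [closure_Ico hσ0.ne]
      exact closure_minimal (fun u hu => (hbefore u hu).le)
        (isClosed_le hcx continuous_const) (hcl ht)
    have hforce : ∀ t ∈ Icc 0 σ, |F (φ (p - e) t)| ≤ 1 / (2 * C * T ^ 2) * (C * e) := by
      intro t ht
      have h1 := hamp t ⟨ht.1, ht.2.trans hσT⟩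
      refine (hd'' ?_ (hle' t ht)).trans (by gcongr)
      rw [Real.dist_eq]
      linarith
    have hvel : ∀ t ∈ Icc 0 σ, |ψ (p - e) t| ≤ 1 / (2 * C * T ^ 2) * (C * e) * T := by
      intro t ht
      have h1 := abs_sub_le_of_abs_deriv_le ht.1 (hφ (p - e)).2
        (fun u hu => by rw [abs_neg]; exact hforce u ⟨hu.1, hu.2.trans ht.2⟩)
      rw [h0', sub_zero] at h1
      refine h1.trans ?_
      gcongr
      exact ht.2.trans hσT
    have hpos := abs_sub_le_of_abs_deriv_le hσ0.le (hφ (p - e)).1 hvel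
    rw [h0] at hpos
    have h2 : 1 / (2 * C * T ^ 2) * (C * e) * T * σ ≤ 1 / (2 * C * T ^ 2) * (C * e) * T * T := by
      gcongr
    have h3 : 1 / (2 * C * T ^ 2) * (C * e) * T * T = e / 2 := by
      field_simp
    have h4 := le_abs_self (φ (p - e) σ - (p - e))
    linarith [hmem.2]
  have h1 := (hφ (p - e)).velocity_pos (h0' _) (a := 0) (b := T) (fun t ht => hneg _
    ⟨by have := (abs_le.1 (hamp t ht)).1; linarith, hlt t ht⟩) ⟨hT, le_rfl⟩
  have h2 := (hφ (p - e)).velocity_periodic (hper _ hs) 0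
  rw [zero_add, h0'] at h2
  linarith

/-- The equation is `z'' = -force(z)`. -/
noncomputable def force (ρ Ψ : ℝ → ℝ) (K z : ℝ) : ℝ := ρ z - Ψ z / K ^ 2

theorem isOpen_interval (a b : EReal) : IsOpen (interval a b) :=
  (isOpen_lt continuous_const continuous_coe_real_ereal).inter
    (isOpen_lt continuous_coe_real_ereal continuous_const)

theorem ordConnected_interval (a b : EReal) : (interval a b).OrdConnected := by
  refine ⟨fun x hx y hy z hz => ⟨hx.1.trans_le ?_, lt_of_le_of_lt ?_ hy.2⟩⟩
  · exact_mod_cast hz.1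
  · exact_mod_cast hz.2

theorem nonempty_interval {a b : EReal} (h : a < b) : (interval a b).Nonempty := by
  obtain ⟨x, hx, hx'⟩ := EReal.lt_iff_exists_real_btwn.1 h
  exact ⟨x, hx, hx'⟩

theorem contDiffOn_force {I : Set ℝ} {ρ Ψ : ℝ → ℝ} (hρ : ContDiffOn ℝ ∞ ρ I)
    (hΨ : ContDiffOn ℝ ∞ Ψ I) (K : ℝ) : ContDiffOn ℝ ∞ (force ρ Ψ K) I :=
  hρ.sub (hΨ.div_const _)

theorem IsSolutionOn.hasDerivAt {I J : Set ℝ} {ρ Ψ z : ℝ → ℝ} {K : ℝ}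
    (h : IsSolutionOn I ρ Ψ K z J) {t : ℝ} (ht : t ∈ J) :
    z t ∈ I ∧ HasDerivAt z (deriv z t) t ∧ HasDerivAt (deriv z) (-force ρ Ψ K (z t)) t := by
  obtain ⟨h1, h2, h3, h4⟩ := h t ht
  refine ⟨h1, h2.hasDerivAt, ?_⟩
  have : deriv (deriv z) t = -force ρ Ψ K (z t) := by
    rw [force]
    linarith
  rw [← this]
  exact h3.hasDerivAt

theorem isSolutionOn_of_hasDerivAt {I J : Set ℝ} (hJ : IsOpen J) {ρ Ψ z v : ℝ → ℝ} {K : ℝ}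
    (h : ∀ t ∈ J, z t ∈ I ∧ HasDerivAt z (v t) t ∧ HasDerivAt v (-force ρ Ψ K (z t)) t) :
    IsSolutionOn I ρ Ψ K z J := by
  intro t ht
  obtain ⟨h1, h2, h3⟩ := h t ht
  have he : deriv z =ᶠ[𝓝 t] v := by
    filter_upwards [hJ.mem_nhds ht] with u hu using (h u hu).2.1.deriv
  have h4 := h3.congr_of_eventuallyEq he
  refine ⟨h1, h2.differentiableAt, h4.differentiableAt, ?_⟩
  rw [h4.deriv, force]
  ring

theorem IsOrbit.isBddNonconstSolution {I : Set ℝ} {ρ Ψ F x v : ℝ → ℝ} {K α β : ℝ} (hK : K ≠ 0)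
    (hsub : Icc α β ⊆ I) (hF : ∀ x ∈ Icc α β, F x = force ρ Ψ K x) (h : IsOrbit F x v)
    (hr : range x ⊆ Icc α β) (h0 : F (x 0) ≠ 0) : IsBddNonconstSolution I ρ Ψ K x := by
  refine ⟨hK, isSolutionOn_of_hasDerivAt isOpen_univ (v := v) fun t _ => ?_, ⟨α, β, hsub, hr⟩,
    h.not_const h0⟩
  have ht := hr (mem_range_self t)
  exact ⟨hsub ht, h.1 t, by rw [← hF _ ht]; exact h.2 t⟩

theorem IsSolutionOn.isOrbit {I : Set ℝ} {ρ Ψ F z : ℝ → ℝ} {K : ℝ}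
    (h : IsSolutionOn I ρ Ψ K z univ) (hF : ∀ x ∈ range z, F x = force ρ Ψ K x) :
    IsOrbit F z (deriv z) :=
  ⟨fun t => (h.hasDerivAt (mem_univ t)).2.1, fun t => by
    rw [hF _ (mem_range_self t)]
    exact (h.hasDerivAt (mem_univ t)).2.2⟩

theorem hasDerivAt_of_contDiffOn {I : Set ℝ} (hI : IsOpen I) {f : ℝ → ℝ}
    (hf : ContDiffOn ℝ ∞ f I) {x : ℝ} (hx : x ∈ I) : HasDerivAt f (deriv f x) x :=
  ((hf.differentiableOn (by norm_num)).differentiableAt (hI.mem_nhds hx)).hasDerivAt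

theorem contDiffOn_deriv {I : Set ℝ} (hI : IsOpen I) {f : ℝ → ℝ}
    (hf : ContDiffOn ℝ ∞ f I) : ContDiffOn ℝ ∞ (deriv f) I :=
  hf.deriv_of_isOpen hI le_rfl

theorem exists_bounded_lipschitz_extension {I : Set ℝ} (hI : IsOpen I) {f : ℝ → ℝ}
    (hf : ContDiffOn ℝ ∞ f I) {α β : ℝ} (hαβ : α ≤ β) (hsub : Icc α β ⊆ I) :
    ∃ (F : ℝ → ℝ) (L M : ℝ≥0), LipschitzWith L F ∧ (∀ x, |F x| ≤ M) ∧
      ∀ x ∈ Icc α β, F x = f x := by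
  obtain ⟨L, hL⟩ := isCompact_Icc.exists_bound_of_continuousOn
    ((contDiffOn_deriv hI hf).continuousOn.mono hsub)
  obtain ⟨M, hM⟩ := isCompact_Icc.exists_bound_of_continuousOn (hf.continuousOn.mono hsub)
  have hlip : LipschitzOnWith L.toNNReal f (Icc α β) := by
    refine (convex_Icc α β).lipschitzOnWith_of_nnnorm_hasDerivWithin_le
      (f' := deriv f) (fun x hx => (hasDerivAt_of_contDiffOn hI hf (hsub hx)).hasDerivWithinAt) ?_
    intro x hx
    rw [← NNReal.coe_le_coe, coe_nnnorm]
    exact (hL x hx).trans (le_coe_toNNReal L)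
  refine ⟨fun x => f (projIcc α β hαβ x), L.toNNReal * 1, M.toNNReal, ?_, ?_, ?_⟩
  · exact (lipschitzOnWith_iff_restrict.1 hlip).comp (LipschitzWith.projIcc hαβ)
  · exact fun x => (hM _ (projIcc α β hαβ x).2).trans (le_coe_toNNReal M)
  · intro x hx
    simp only [projIcc_of_mem hαβ hx]

theorem energy_const {I J : Set ℝ} (hJ : IsOpen J) (hJc : IsPreconnected J) {f U z v : ℝ → ℝ}
    (hU : ∀ x ∈ I, HasDerivAt U (f x) x)
    (hz : ∀ t ∈ J, z t ∈ I ∧ HasDerivAt z (v t) t ∧ HasDerivAt v (-f (z t)) t) {t₀ t : ℝ}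
    (ht₀ : t₀ ∈ J) (ht : t ∈ J) : v t ^ 2 / 2 + U (z t) = v t₀ ^ 2 / 2 + U (z t₀) := by
  have hd : ∀ t ∈ J, HasDerivAt (fun t => v t ^ 2 / 2 + U (z t)) 0 t := by
    intro t ht
    obtain ⟨h1, h2, h3⟩ := hz t ht
    refine (((h3.pow 2).div_const 2).add ((hU _ h1).comp t h2)).congr_deriv ?_
    push_cast
    ring
  exact hJ.is_const_of_deriv_eq_zero hJc
    (fun t ht => (hd t ht).differentiableAt.differentiableWithinAt)
    (fun t ht => (hd t ht).deriv) ht ht₀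

theorem energy_trap {I J : Set ℝ} (hJ : IsOpen J) (hJc : IsPreconnected J) {f U z v : ℝ → ℝ}
    (hU : ∀ x ∈ I, HasDerivAt U (f x) x)
    (hz : ∀ t ∈ J, z t ∈ I ∧ HasDerivAt z (v t) t ∧ HasDerivAt v (-f (z t)) t) {t₀ t α β : ℝ}
    (ht₀ : t₀ ∈ J) (ht : t ∈ J) (hmem : z t₀ ∈ Ioo α β)
    (hα : v t₀ ^ 2 / 2 + U (z t₀) < U α) (hβ : v t₀ ^ 2 / 2 + U (z t₀) < U β) :
    z t ∈ Ioo α β := by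
  have hle : ∀ u ∈ J, U (z u) ≤ v t₀ ^ 2 / 2 + U (z t₀) := by
    intro u hu
    have := energy_const hJ hJc hU hz ht₀ hu
    nlinarith [sq_nonneg (v u)]
  have hord : (z '' J).OrdConnected :=
    (hJc.image z fun t ht => (hz t ht).2.1.continuousAt.continuousWithinAt).ordConnected
  have ha : α ∉ z '' J := by
    rintro ⟨u, hu, rfl⟩
    linarith [hle u hu]
  have hb : β ∉ z '' J := by
    rintro ⟨u, hu, rfl⟩
    linarith [hle u hu]
  constructor
  · by_contra h
    exact ha (hord.out (mem_image_of_mem z ht) (mem_image_of_mem z ht₀)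
      ⟨not_lt.1 h, hmem.1.le⟩)
  · by_contra h
    exact hb (hord.out (mem_image_of_mem z ht₀) (mem_image_of_mem z ht)
      ⟨hmem.2.le, not_lt.1 h⟩)

theorem exists_antideriv {F : ℝ → ℝ} (hF : Continuous F) : ∃ U : ℝ → ℝ, ∀ x, HasDerivAt U (F x) x :=
  ⟨fun x => ∫ t in (0 : ℝ)..x, F t, fun x => (hF.integral_hasStrictDerivAt 0 x).hasDerivAt⟩

theorem nonneg_of_mul_deriv_nonneg {h h' : ℝ → ℝ} {r : ℝ} (h0 : h 0 = 0)
    (hd : ∀ x, |x| ≤ r → HasDerivAt h (h' x) x) (hs : ∀ x, |x| ≤ r → 0 ≤ x * h' x) {x : ℝ}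
    (hx : |x| ≤ r) : 0 ≤ h x := by
  have hb : ∀ u ∈ uIcc 0 x, |u| ≤ r := by
    intro u hu
    have := abs_sub_left_of_mem_uIcc hu
    rw [sub_zero, sub_zero] at this
    exact this.trans hx
  have hc : ContinuousOn h (uIcc 0 x) := fun u hu =>
    (hd u (hb u hu)).continuousAt.continuousWithinAt
  rcases le_total 0 x with h1 | h1
  · rw [uIcc_of_le h1] at hb hc
    have : MonotoneOn h (Icc 0 x) := by
      apply monotoneOn_of_deriv_nonneg (convex_Icc _ _) hc
        (fun u hu => (hd u (hb u (interior_subset hu))).differentiableAt.differentiableWithinAt)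
      intro u hu
      have hu' := hb u (interior_subset hu)
      rw [interior_Icc] at hu
      rw [(hd u hu').deriv]
      exact nonneg_of_mul_nonneg_right (hs u hu') hu.1
    rw [← h0]
    exact this ⟨le_rfl, h1⟩ ⟨h1, le_rfl⟩ h1
  · rw [uIcc_of_ge h1] at hb hc
    have : AntitoneOn h (Icc x 0) := by
      apply antitoneOn_of_deriv_nonpos (convex_Icc _ _) hc
        (fun u hu => (hd u (hb u (interior_subset hu))).differentiableAt.differentiableWithinAt)
      intro u hu
      have hu' := hb u (interior_subset hu)
      rw [interior_Icc] at hu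
      rw [(hd u hu').deriv]
      nlinarith [hu.2, hs u hu']
    rw [← h0]
    exact this ⟨le_rfl, h1⟩ ⟨h1, le_rfl⟩ h1

/-- Quadratic bounds for a potential whose force is nearly linear. -/
theorem potential_bounds {F U : ℝ → ℝ} {p l r : ℝ}
    (hU : ∀ x, |x| ≤ r → HasDerivAt U (F (p + x)) (p + x))
    (hF : ∀ x, |x| ≤ r → |F (p + x) - l * x| ≤ l / 2 * |x|) {x : ℝ} (hx : |x| ≤ r) :
    l / 4 * x ^ 2 ≤ U (p + x) - U p ∧ U (p + x) - U p ≤ 3 * l / 4 * x ^ 2 := by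
  have hd : ∀ x, |x| ≤ r → HasDerivAt (fun x => U (p + x) - U p) (F (p + x)) x := fun x hx =>
    ((hU x hx).comp_const_add p x).sub_const _
  have hmul : ∀ x, |x| ≤ r → |x * F (p + x) - l * x ^ 2| ≤ l / 2 * x ^ 2 := by
    intro x hx
    rw [show x * F (p + x) - l * x ^ 2 = x * (F (p + x) - l * x) by ring, abs_mul]
    calc |x| * |F (p + x) - l * x| ≤ |x| * (l / 2 * |x|) := by gcongr; exact hF x hx
      _ = l / 2 * x ^ 2 := by rw [← sq_abs x]; ring
  constructor
  · have := nonneg_of_mul_deriv_nonneg (h := fun x => U (p + x) - U p - l / 4 * x ^ 2)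
      (h' := fun x => F (p + x) - l / 4 * (2 * x)) (r := r) (by simp)
      (fun x hx => (hd x hx).sub (by simpa using (hasDerivAt_pow 2 x).const_mul (l / 4)))
      (fun x hx => by have := (abs_le.1 (hmul x hx)).1; nlinarith) hx
    linarith
  · have := nonneg_of_mul_deriv_nonneg (h := fun x => 3 * l / 4 * x ^ 2 - (U (p + x) - U p))
      (h' := fun x => 3 * l / 4 * (2 * x) - F (p + x)) (r := r) (by simp)
      (fun x hx => HasDerivAt.sub
        (by simpa using (hasDerivAt_pow 2 x).const_mul (3 * l / 4)) (hd x hx))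
      (fun x hx => by have := (abs_le.1 (hmul x hx)).2; nlinarith) hx
    linarith

theorem exists_linear_bound {I : Set ℝ} (hI : IsOpen I) {f : ℝ → ℝ}
    (hf : ContDiffOn ℝ ∞ f I) {p ε : ℝ} (hp : p ∈ I) (hfp : f p = 0) (hd : 0 < deriv f p)
    (hε : 0 < ε) : ∃ r, 0 < r ∧ r ≤ ε ∧ ∀ x ∈ Icc (p - r) (p + r),
      |f x - deriv f p * (x - p)| ≤ deriv f p / 2 * |x - p| ∧ x ∈ I := by
  set l := deriv f p with hl
  have hlin : ∀ᶠ x in 𝓝 p, |f x - l * (x - p)| ≤ l / 2 * |x - p| := by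
    have := (hasDerivAt_of_contDiffOn hI hf hp).isLittleO.bound (c := l / 2) (by positivity)
    simpa [hfp, mul_comm] using this
  obtain ⟨d, hd0, hd'⟩ := Metric.eventually_nhds_iff.1 (hlin.and (hI.mem_nhds hp))
  refine ⟨min (d / 2) ε, by positivity, min_le_right _ _, fun x hx => hd' ?_⟩
  have hrd : min (d / 2) ε < d := (min_le_left _ _).trans_lt (by linarith)
  rw [Real.dist_eq, abs_lt]
  constructor <;> linarith [hx.1, hx.2]

/-- Small oscillations about a nondegenerate minimum of the potential. -/
theorem exists_small_oscillations {I : Set ℝ} (hI : IsOpen I) {f : ℝ → ℝ}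
    (hf : ContDiffOn ℝ ∞ f I) {p ε : ℝ} (hp : p ∈ I) (hfp : f p = 0) (hd : 0 < deriv f p)
    (hε : 0 < ε) :
    ∃ (r : ℝ) (F : ℝ → ℝ) (L : ℝ≥0) (φ ψ : ℝ → ℝ → ℝ), 0 < r ∧ r ≤ ε ∧
      Icc (p - r) (p + r) ⊆ I ∧ LipschitzWith L F ∧ (∀ x ∈ Icc (p - r) (p + r), F x = f x) ∧
      (∀ s, IsOrbit F (φ s) (ψ s)) ∧ (∀ s, φ s 0 = s) ∧ (∀ s, ψ s 0 = 0) ∧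
      ∀ s ∈ Ioo (p - r / 2) p, F s < 0 ∧ ∀ t, |φ s t - p| ≤ 2 * |s - p| := by
  obtain ⟨r, hr0, hrε, hd'⟩ := exists_linear_bound hI hf hp hfp hd hε
  set l := deriv f p with hl
  have hsub : Icc (p - r) (p + r) ⊆ I := fun x hx => (hd' x hx).2
  obtain ⟨F, L, M, hFL, hFM, hFf⟩ := exists_bounded_lipschitz_extension hI hf
    (by linarith : p - r ≤ p + r) hsub
  choose φ ψ hφ using fun s => exists_orbit hFL hFM s 0
  have hFlin : ∀ x, |x| ≤ r → |F (p + x) - l * x| ≤ l / 2 * |x| := by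
    intro x hx
    rw [abs_le] at hx
    have hx' : p + x ∈ Icc (p - r) (p + r) := ⟨by linarith, by linarith⟩
    rw [hFf _ hx']
    simpa using (hd' _ hx').1
  obtain ⟨U, hU⟩ := exists_antideriv hFL.continuous
  have hb := fun x hx => potential_bounds (fun x _ => hU (p + x)) hFlin (x := x) hx
  refine ⟨r, F, L, φ, ψ, hr0, hrε, hsub, hFL, hFf, fun s => (hφ s).1,
    fun s => (hφ s).2.1, fun s => (hφ s).2.2, fun s hs => ⟨?_, fun t => ?_⟩⟩
  · have h1 := hFlin (s - p) (by rw [abs_le]; constructor <;> linarith [hs.1, hs.2])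
    rw [abs_of_neg (by linarith [hs.2] : s - p < 0), abs_le] at h1
    have h2 := h1.2
    simp only [add_sub_cancel] at h2
    nlinarith [hs.2]
  · have hz : ∀ t ∈ (univ : Set ℝ), φ s t ∈ (univ : Set ℝ) ∧ HasDerivAt (φ s) (ψ s t) t ∧
        HasDerivAt (ψ s) (-F (φ s t)) t := fun t _ => ⟨trivial, (hφ s).1.1 t, (hφ s).1.2 t⟩
    have hE : ψ s 0 ^ 2 / 2 + U (φ s 0) = U s := by rw [(hφ s).2.2, (hφ s).2.1]; simp
    have hsr : |s - p| ≤ r := by rw [abs_le]; constructor <;> linarith [hs.1, hs.2]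
    have hUs := (hb (s - p) hsr).2
    rw [add_sub_cancel] at hUs
    have hsq : (s - p) ^ 2 < (r / 2) ^ 2 := by
      rw [sq_lt_sq, abs_of_pos (by positivity : 0 < r / 2), abs_lt]
      constructor <;> linarith [hs.1, hs.2]
    have hUr : ∀ x, |x| = r → U s < U (p + x) := by
      intro x hx
      have := (hb x hx.le).1
      rw [← sq_abs, hx] at this
      nlinarith
    have htrap := energy_trap isOpen_univ isPreconnected_univ (fun x _ => hU x) hz
      (mem_univ 0) (mem_univ t) (α := p - r) (β := p + r)
      (by rw [(hφ s).2.1]; constructor <;> linarith [hs.1, hs.2])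
      (by rw [hE, sub_eq_add_neg]; exact hUr _ (by rw [abs_neg, abs_of_pos hr0]))
      (by rw [hE]; exact hUr _ (abs_of_pos hr0))
    have hxr : |φ s t - p| ≤ r := by rw [abs_le]; constructor <;> linarith [htrap.1, htrap.2]
    have hEt := energy_const isOpen_univ isPreconnected_univ (fun x _ => hU x) hz
      (mem_univ 0) (mem_univ t)
    rw [hE] at hEt
    have hlow := (hb _ hxr).1
    rw [add_sub_cancel] at hlow
    apply abs_le_of_sq_le_sq' _ (by positivity) |> abs_le.2
    rw [mul_pow, sq_abs]
    nlinarith [sq_nonneg (ψ s t), sq_nonneg (s - p)]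

theorem range_subset_Icc {x : ℝ → ℝ} {p r : ℝ} (h : ∀ t, |x t - p| ≤ r) :
    range x ⊆ Icc (p - r) (p + r) := by
  rintro _ ⟨t, rfl⟩
  have := abs_le.1 (h t)
  exact ⟨by linarith, by linarith⟩

theorem IsNondegStableEquilibrium.force_eq {I : Set ℝ} {ρ Ψ : ℝ → ℝ} {K p : ℝ}
    (h : IsNondegStableEquilibrium I ρ Ψ K p) :
    force ρ Ψ K p = 0 ∧ 0 < deriv (force ρ Ψ K) p :=
  ⟨by rw [force, h.1.2.2, sub_self], h.2⟩

theorem exists_bdd_solution_near {I : Set ℝ} (hI : IsOpen I) {ρ Ψ : ℝ → ℝ}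
    (hρ : ContDiffOn ℝ ∞ ρ I) (hΨ : ContDiffOn ℝ ∞ Ψ I) {K p ε : ℝ}
    (h : IsNondegStableEquilibrium I ρ Ψ K p) (hε : 0 < ε) :
    ∃ z, IsBddNonconstSolution I ρ Ψ K z ∧ range z ⊆ Icc (p - ε) (p + ε) := by
  obtain ⟨r, F, L, φ, ψ, hr, hrε, hsub, -, hFf, hφ, h0, -, hs⟩ := exists_small_oscillations hI
    (contDiffOn_force hρ hΨ K) h.1.2.1 h.force_eq.1 h.force_eq.2 hε
  have hmem : p - r / 4 ∈ Ioo (p - r / 2) p := ⟨by linarith, by linarith⟩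
  obtain ⟨hneg, hamp⟩ := hs _ hmem
  have hamp' : ∀ t, |φ (p - r / 4) t - p| ≤ r := fun t => (hamp t).trans (by
    rw [show p - r / 4 - p = -(r / 4) by ring, abs_neg, abs_of_pos (by positivity)]
    linarith)
  refine ⟨φ (p - r / 4), (hφ _).isBddNonconstSolution h.1.1 hsub hFf (range_subset_Icc hamp') ?_,
    range_subset_Icc fun t => (hamp' t).trans hrε⟩
  rw [h0]
  exact hneg.ne

theorem abs_le_of_deriv_bound {h h' : ℝ → ℝ} {r M : ℝ} {n : ℕ} (h0 : h 0 = 0) (hM : 0 ≤ M)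
    (hd : ∀ u, |u| ≤ r → HasDerivAt h (h' u) u) (hb : ∀ u, |u| ≤ r → |h' u| ≤ M * |u| ^ n)
    {u : ℝ} (hu : |u| ≤ r) : |h u| ≤ M * |u| ^ (n + 1) := by
  have hball : ∀ y ∈ uIcc 0 u, |y| ≤ |u| := by
    intro y hy
    have := abs_sub_left_of_mem_uIcc hy
    simpa using this
  have := (convex_uIcc 0 u).norm_image_sub_le_of_norm_hasDerivWithin_le (f := h) (f' := h')
    (C := M * |u| ^ n) (x := 0) (y := u)
    (fun y hy => (hd y ((hball y hy).trans hu)).hasDerivWithinAt)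
    (fun y hy => (hb y ((hball y hy).trans hu)).trans (mul_le_mul_of_nonneg_left
      (pow_le_pow_left₀ (abs_nonneg _) (hball y hy) n) hM))
    left_mem_uIcc right_mem_uIcc
  rw [h0, sub_zero, sub_zero] at this
  refine this.trans (le_of_eq ?_)
  rw [Real.norm_eq_abs]
  ring

/-- Third order Taylor expansion of a smooth function at a zero. -/
theorem taylor_third {I : Set ℝ} (hI : IsOpen I) {f : ℝ → ℝ} (hf : ContDiffOn ℝ ∞ f I) {p : ℝ}
    (hp : p ∈ I) (hfp : f p = 0) :
    ∃ r M, 0 < r ∧ r ≤ 1 ∧ ∀ u, |u| ≤ r → |f (p + u) - deriv f p * u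
      - deriv (deriv f) p / 2 * u ^ 2 - deriv (deriv (deriv f)) p / 6 * u ^ 3| ≤ M * u ^ 4 := by
  have hf1 := contDiffOn_deriv hI hf
  have hf2 := contDiffOn_deriv hI hf1
  have hf3 := contDiffOn_deriv hI hf2
  have hO := (hasDerivAt_of_contDiffOn hI hf3 hp).differentiableAt.isBigO_sub
  obtain ⟨M, hM0, hM⟩ := hO.exists_pos
  obtain ⟨d, hd, hd'⟩ := Metric.eventually_nhds_iff.1 (hM.bound.and (hI.mem_nhds hp))
  have hr : ∀ u, |u| ≤ min (d / 2) 1 → dist (p + u) p < d := by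
    intro u hu
    rw [Real.dist_eq, add_sub_cancel_left]
    exact (hu.trans (min_le_left _ _)).trans_lt (by linarith)
  have hc : ∀ {g : ℝ → ℝ}, ContDiffOn ℝ ∞ g I → ∀ u, |u| ≤ min (d / 2) 1 →
      HasDerivAt (fun u => g (p + u)) (deriv g (p + u)) u := fun hg u hu =>
    (hasDerivAt_of_contDiffOn hI hg (hd' (hr u hu)).2).comp_const_add p u
  have b3 : ∀ u, |u| ≤ min (d / 2) 1 → |deriv (deriv (deriv f)) (p + u)
      - deriv (deriv (deriv f)) p| ≤ M * |u| ^ 1 := by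
    intro u hu
    simpa using (hd' (hr u hu)).1
  have b2 := fun u hu => abs_le_of_deriv_bound (u := u) (r := min (d / 2) 1)
    (h := fun u => deriv (deriv f) (p + u) - deriv (deriv f) p - deriv (deriv (deriv f)) p * u)
    (by simp) hM0.le
    (fun u hu => (((hc hf2 u hu).sub_const _).sub
      ((hasDerivAt_id u).const_mul _)).congr_deriv (by ring)) b3 hu
  have b1 := fun u hu => abs_le_of_deriv_bound (u := u) (r := min (d / 2) 1)
    (h := fun u => deriv f (p + u) - deriv f p - deriv (deriv f) p * u
      - deriv (deriv (deriv f)) p / 2 * u ^ 2)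
    (by simp) hM0.le
    (fun u hu => ((((hc hf1 u hu).sub_const _).sub
      ((hasDerivAt_id u).const_mul _)).sub ((hasDerivAt_pow 2 u).const_mul _)).congr_deriv
      (by push_cast; ring)) b2 hu
  have b0 := fun u hu => abs_le_of_deriv_bound (u := u) (r := min (d / 2) 1)
    (h := fun u => f (p + u) - deriv f p * u - deriv (deriv f) p / 2 * u ^ 2
      - deriv (deriv (deriv f)) p / 6 * u ^ 3)
    (by simp [hfp]) hM0.le
    (fun u hu => ((((hc hf u hu).sub
      ((hasDerivAt_id u).const_mul _)).sub ((hasDerivAt_pow 2 u).const_mul _)).sub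
      ((hasDerivAt_pow 3 u).const_mul _)).congr_deriv (by push_cast; ring)) b1 hu
  refine ⟨min (d / 2) 1, M, by positivity, min_le_right _ _, fun u hu => ?_⟩
  rw [← (by decide : Even 4).pow_abs]
  exact b0 u hu

/-- If all small oscillations about a nondegenerate equilibrium have commensurable periods, then
they have a common multiple of the period of the linearized oscillator as a period, and the
second order condition for isochronism holds. -/
theorem local_isochronism {I : Set ℝ} (hI : IsOpen I) {ρ Ψ : ℝ → ℝ}
    (hρ : ContDiffOn ℝ ∞ ρ I) (hΨ : ContDiffOn ℝ ∞ Ψ I) {K p ε : ℝ}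
    (h : IsNondegStableEquilibrium I ρ Ψ K p) (hε : 0 < ε)
    (hcomm : PeriodicCommensurable
      {z | IsBddNonconstSolution I ρ Ψ K z ∧ range z ⊆ Icc (p - ε) (p + ε)}) :
    (∃ z T, IsBddNonconstSolution I ρ Ψ K z ∧ range z ⊆ Icc (p - ε) (p + ε) ∧ 0 < T ∧
      Function.Periodic z T ∧ cos (√(deriv (force ρ Ψ K) p) * T) = 1) ∧
    5 * deriv (deriv (force ρ Ψ K)) p ^ 2
      = 3 * deriv (force ρ Ψ K) p * deriv (deriv (deriv (force ρ Ψ K))) p := by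
  have hf := contDiffOn_force hρ hΨ K
  obtain ⟨hfp, hd⟩ := h.force_eq
  set f := force ρ Ψ K with hfdef
  obtain ⟨r, F, L, φ, ψ, hr, hrε, hsub, hFL, hFf, hφ, h0, h0', hs⟩ := exists_small_oscillations hI
    hf h.1.2.1 hfp hd hε
  have hamp : ∀ s ∈ Ioo (p - r / 2) p, ∀ t, |φ s t - p| ≤ r := by
    intro s hs' t
    refine ((hs s hs').2 t).trans ?_
    rw [abs_of_neg (by linarith [hs'.2] : s - p < 0)]
    linarith [hs'.1]
  have hS : ∀ s ∈ Ioo (p - r / 2) p, IsBddNonconstSolution I ρ Ψ K (φ s) ∧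
      range (φ s) ⊆ Icc (p - ε) (p + ε) := fun s hs' =>
    ⟨(hφ s).isBddNonconstSolution h.1.1 hsub hFf (range_subset_Icc (hamp s hs'))
      (by rw [h0]; exact (hs s hs').1.ne),
      range_subset_Icc fun t => (hamp s hs' t).trans hrε⟩
  obtain ⟨T, hT, hper⟩ := exists_common_period hFL hφ h0 h0' (by linarith : p - r / 2 < p)
    (fun s hs' => (hs s hs').1) (fun s hs' => hcomm.1 _ (hS s hs'))
    (fun s hs' s' hs'' T T' => hcomm.2 _ (hS s hs') _ (hS s' hs'') T T')
  have hsmall : HasSmallPeriodicOrbits (fun u => F (p + u)) T 2 := by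
    intro e he
    set q := min (e / 2) (r / 4) with hq
    have hq0 : 0 < q := by positivity
    have hqe : q ≤ e / 2 := min_le_left _ _
    have hqr : q ≤ r / 4 := min_le_right _ _
    have hmem : p - q ∈ Ioo (p - r / 2) p := ⟨by linarith, by linarith⟩
    have hx0 : φ (p - q) 0 - p = -q := by rw [h0]; ring
    refine ⟨fun t => φ (p - q) t - p, ψ (p - q), ⟨fun t => ((hφ _).1 t).sub_const p, fun t => ?_⟩,
      h0' _, ?_, ?_, fun t => ?_, fun t => ?_⟩
    · simpa using (hφ (p - q)).2 t
    · simpa only [hx0, abs_neg, abs_of_pos hq0] using hq0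
    · simp only [hx0, abs_neg, abs_of_pos hq0]
      linarith
    · simp only [hper _ hmem t]
    · have := (hs _ hmem).2 t
      simp only [h0]
      exact this
  obtain ⟨r', M, hr'0, hr'1, htay⟩ := taylor_third hI hf h.1.2.1 hfp
  set l := deriv f p with hl
  have hν : 0 < √l := sqrt_pos.2 hd
  have hν2 : √l ^ 2 = l := sq_sqrt hd.le
  have htay' : ∀ u, |u| ≤ min r r' → |F (p + u) - √l ^ 2 * u - deriv (deriv f) p / 2 * u ^ 2
      - deriv (deriv (deriv f)) p / 6 * u ^ 3| ≤ M * u ^ 4 := by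
    intro u hu
    have hu' := abs_le.1 (hu.trans (min_le_left _ _))
    rw [hFf _ ⟨by linarith, by linarith⟩, hν2]
    exact htay u (hu.trans (min_le_right _ _))
  have hcos : cos (√l * T) = 1 := by
    refine hsmall.cos_eq_one (B := |deriv (deriv f) p / 2| + |deriv (deriv (deriv f)) p / 6| + |M|)
      hν hT two_pos (lt_min hr hr'0) fun u hu => ?_
    have hu1 : |u| ≤ 1 := (hu.trans (min_le_right _ _)).trans hr'1
    have h1 := htay' u hu
    have e : F (p + u) - √l ^ 2 * u = (F (p + u) - √l ^ 2 * u - deriv (deriv f) p / 2 * u ^ 2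
      - deriv (deriv (deriv f)) p / 6 * u ^ 3) + deriv (deriv f) p / 2 * u ^ 2
      + deriv (deriv (deriv f)) p / 6 * u ^ 3 := by ring
    rw [e]
    refine (abs_add_three _ _ _).trans ?_
    rw [abs_mul, abs_mul, abs_pow, abs_pow]
    have h2 : |u| ^ 3 ≤ |u| ^ 2 := pow_le_pow_of_le_one (abs_nonneg u) hu1 (by norm_num)
    have h3 : M * u ^ 4 ≤ |M| * |u| ^ 2 := by
      rw [← (by decide : Even 4).pow_abs]
      have : |u| ^ 4 ≤ |u| ^ 2 := pow_le_pow_of_le_one (abs_nonneg u) hu1 (by norm_num)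
      calc M * |u| ^ 4 ≤ |M| * |u| ^ 4 := by gcongr; exact le_abs_self M
        _ ≤ _ := by gcongr
    have h4 : |deriv (deriv (deriv f)) p / 6| * |u| ^ 3
        ≤ |deriv (deriv (deriv f)) p / 6| * |u| ^ 2 := by gcongr
    rw [← sq_abs u] at *
    linarith
  refine ⟨?_, ?_⟩
  · have hmem : p - r / 4 ∈ Ioo (p - r / 2) p := ⟨by linarith, by linarith⟩
    exact ⟨φ (p - r / 4), T, (hS _ hmem).1, (hS _ hmem).2, hT, hper _ hmem, hcos⟩
  · have := hsmall.coeff_relation hν hT two_pos (lt_min hr hr'0)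
      ((min_le_right _ _).trans hr'1) htay' hcos
    rw [hν2] at this
    linarith

theorem IsBddNonconstSolution.continuous {I : Set ℝ} {ρ Ψ z : ℝ → ℝ} {K : ℝ}
    (h : IsBddNonconstSolution I ρ Ψ K z) : Continuous z :=
  continuous_iff_continuousAt.2 fun t => (h.2.1 t (mem_univ t)).2.1.continuousAt

theorem eventually_lt_of_deriv_pos {U F : ℝ → ℝ} {a : ℝ} (hF : Continuous F)
    (hU : ∀ x, HasDerivAt U (F x) x) (ha : 0 < F a) :
    ∃ d > 0, StrictMonoOn U (Icc (a - d) (a + d)) := by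
  obtain ⟨d, hd, hd'⟩ := Metric.eventually_nhds_iff.1 (hF.continuousAt.eventually_const_lt ha)
  refine ⟨d / 2, by positivity, ?_⟩
  apply strictMonoOn_of_deriv_pos (convex_Icc _ _)
    (fun x _ => (hU x).continuousAt.continuousWithinAt)
  intro x hx
  rw [interior_Icc] at hx
  rw [(hU x).deriv]
  apply hd'
  rw [Real.dist_eq, abs_lt]
  constructor <;> linarith [hx.1, hx.2]

/-- A bounded nonconstant solution all of whose inner solutions have commensurable periods encloses
a nondegenerate minimum of the potential. -/
theorem exists_nondeg_of_semilocal {I : Set ℝ} (hI : IsOpen I) {ρ Ψ : ℝ → ℝ}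
    (hρ : ContDiffOn ℝ ∞ ρ I) (hΨ : ContDiffOn ℝ ∞ Ψ I) {K : ℝ} {w : ℝ → ℝ}
    (hw : IsBddNonconstSolution I ρ Ψ K w)
    (hcomm : PeriodicCommensurable {z | IsBddNonconstSolution I ρ Ψ K z ∧ range z ⊆ range w}) :
    ∃ p, IsNondegStableEquilibrium I ρ Ψ K p := by
  have hf := contDiffOn_force hρ hΨ K
  obtain ⟨T₀, hT₀, hper₀⟩ := hcomm.1 w ⟨hw, subset_rfl⟩
  obtain ⟨α, β, hrange⟩ : ∃ α β, range w = Icc α β := by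
    refine ⟨_, _, eq_Icc_of_connected_compact (isConnected_range hw.continuous) ?_⟩
    rw [← hper₀.image_Icc hT₀ 0]
    exact isCompact_Icc.image hw.continuous
  have hαβ' : α ≤ β := by
    have := hrange ▸ mem_range_self (f := w) 0
    exact this.1.trans this.2
  obtain ⟨t₁, ht₁⟩ : α ∈ range w := hrange ▸ left_mem_Icc.2 hαβ'
  obtain ⟨t₂, ht₂⟩ : β ∈ range w := hrange ▸ right_mem_Icc.2 hαβ'
  have hbd : ∀ t, w t ∈ Icc α β := fun t => hrange ▸ mem_range_self t
  have hαβ : α < β := by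
    rcases hαβ'.lt_or_eq with h | h
    · exact h
    · exact absurd ⟨α, fun t => le_antisymm (h ▸ (hbd t).2) (hbd t).1⟩ hw.2.2.2
  have hsub : Icc α β ⊆ I := by
    rw [← hrange]
    rintro _ ⟨t, rfl⟩
    exact (hw.2.1 t (mem_univ t)).1
  obtain ⟨F, L, M, hFL, hFM, hFf⟩ := exists_bounded_lipschitz_extension hI hf hαβ' hsub
  obtain ⟨U, hU⟩ := exists_antideriv hFL.continuous
  have ho : IsOrbit F w (deriv w) := hw.2.1.isOrbit (by rw [hrange]; exact hFf)
  have hz : ∀ t ∈ (univ : Set ℝ), w t ∈ (univ : Set ℝ) ∧ HasDerivAt w (deriv w t) t ∧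
      HasDerivAt (deriv w) (-F (w t)) t := fun t _ => ⟨trivial, ho.1 t, ho.2 t⟩
  have hE : ∀ t t', deriv w t ^ 2 / 2 + U (w t) = deriv w t' ^ 2 / 2 + U (w t') := fun t t' =>
    energy_const isOpen_univ isPreconnected_univ (fun x _ => hU x) hz (mem_univ t') (mem_univ t)
  have hv₁ : deriv w t₁ = 0 :=
    IsLocalMin.deriv_eq_zero (Eventually.of_forall fun t => ht₁ ▸ (hbd t).1)
  have hv₂ : deriv w t₂ = 0 :=
    IsLocalMax.deriv_eq_zero (Eventually.of_forall fun t => ht₂ ▸ (hbd t).2)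
  have hUαβ : U β = U α := by
    have := hE t₂ t₁
    rw [hv₁, hv₂, ht₁, ht₂] at this
    simpa using this
  have hUle : ∀ x ∈ Icc α β, U x ≤ U α := by
    intro x hx
    obtain ⟨t, rfl⟩ : x ∈ range w := hrange ▸ hx
    have := hE t t₁
    rw [hv₁, ht₁] at this
    nlinarith [sq_nonneg (deriv w t)]
  have hFα : F α < 0 := by
    refine lt_of_le_of_ne ?_ (ht₁ ▸ ho.force_ne_zero hFL hw.2.2.2 hv₁)
    by_contra hpos
    obtain ⟨d, hd, hmono⟩ := eventually_lt_of_deriv_pos hFL.continuous hU (not_le.1 hpos)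
    have h1 : α < min (α + d) β := lt_min (by linarith) hαβ
    have h2 := hmono ⟨by linarith, by linarith⟩ ⟨by linarith, min_le_left _ β⟩ h1
    linarith [hUle _ ⟨h1.le, min_le_right _ _⟩]
  have hFβ : 0 < F β := by
    refine lt_of_le_of_ne ?_ (ht₂ ▸ ho.force_ne_zero hFL hw.2.2.2 hv₂).symm
    by_contra hneg
    obtain ⟨d, hd, hmono⟩ := eventually_lt_of_deriv_pos (U := fun x => -U x) hFL.continuous.neg
      (fun x => (hU x).neg) (by simpa using hneg : 0 < (-F) β)
    have h1 : max (β - d) α < β := max_lt (by linarith) hαβ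
    have h2 := hmono ⟨le_max_left _ α, by linarith⟩ ⟨by linarith, by linarith⟩ h1
    simp only at h2
    linarith [hUle _ ⟨le_max_right _ _, h1.le⟩]
  have hUlt : ∀ x ∈ Ioo α β, U x < U α := by
    intro x hx
    refine lt_of_le_of_ne (hUle x (Ioo_subset_Icc_self hx)) fun heq => ?_
    obtain ⟨t, rfl⟩ : x ∈ range w := hrange ▸ Ioo_subset_Icc_self hx
    have h1 := hE t t₁
    rw [hv₁, ht₁, heq] at h1
    have h2 : deriv w t = 0 := by nlinarith
    refine ho.force_ne_zero hFL hw.2.2.2 h2 (IsLocalMax.hasDerivAt_eq_zero ?_ (hU (w t)))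
    filter_upwards [Icc_mem_nhds hx.1 hx.2] with y hy
    rw [heq]
    exact hUle y hy
  -- the leftmost equilibrium
  let A : Set ℝ := {x | x ∈ Icc α β ∧ 0 ≤ F x}
  have hA : IsClosed A := isClosed_Icc.inter (isClosed_le continuous_const hFL.continuous)
  have hAb : BddBelow A := ⟨α, fun x hx => hx.1.1⟩
  have hpA := hA.csInf_mem ⟨β, right_mem_Icc.2 hαβ', hFβ.le⟩ hAb
  set p := sInf A with hp
  have hneg : ∀ s ∈ Ico α p, F s < 0 := by
    intro s hs
    by_contra h
    exact absurd (csInf_le hAb (show s ∈ A from ⟨⟨hs.1, hs.2.le.trans hpA.1.2⟩, not_lt.1 h⟩))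
      (not_le.2 hs.2)
  have hαp : α < p := lt_of_le_of_ne hpA.1.1 fun h => by linarith [h ▸ hpA.2]
  have hFp : F p = 0 := by
    refine le_antisymm ?_ hpA.2
    have hcl : p ∈ closure (Ico α p) := by
      rw [closure_Ico hαp.ne]
      exact right_mem_Icc.2 hαp.le
    exact closure_minimal (fun u hu => (hneg u hu).le)
      (isClosed_le hFL.continuous continuous_const) hcl
  have hpβ : p < β := lt_of_le_of_ne hpA.1.2 fun h => by rw [h] at hFp; linarith
  have hpI : p ∈ I := hsub hpA.1
  have hfp : force ρ Ψ K p = 0 := by rw [← hFf p hpA.1, hFp]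
  have hdF : HasDerivAt F (deriv (force ρ Ψ K) p) p := by
    refine (hasDerivAt_of_contDiffOn hI hf hpI).congr_of_eventuallyEq ?_
    filter_upwards [Icc_mem_nhds hαp hpβ] with y hy using hFf y hy
  refine ⟨p, ⟨hw.1, hpI, sub_eq_zero.1 hfp⟩, ?_⟩
  change 0 < deriv (force ρ Ψ K) p
  have hnonneg : 0 ≤ deriv (force ρ Ψ K) p := by
    have h1 : Tendsto (slope F p) (𝓝[<] p) (𝓝 (deriv (force ρ Ψ K) p)) :=
      (hasDerivWithinAt_iff_tendsto_slope' self_notMem_Iio).1 hdF.hasDerivWithinAt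
    refine ge_of_tendsto h1 ?_
    filter_upwards [Ioo_mem_nhdsLT hαp] with y hy
    rw [slope_def_field, hFp, sub_zero]
    exact div_nonneg_of_nonpos (hneg y ⟨hy.1.le, hy.2⟩).le (by linarith [hy.2])
  refine lt_of_le_of_ne hnonneg fun hzero => ?_
  choose φ ψ hφ using fun s => exists_orbit hFL hFM s 0
  have hs : ∀ s ∈ Ioo α p, F s < 0 ∧ (IsBddNonconstSolution I ρ Ψ K (φ s) ∧
      range (φ s) ⊆ range w) := by
    intro s hs
    have hFs := hneg s ⟨hs.1.le, hs.2⟩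
    have hE0 : ψ s 0 ^ 2 / 2 + U (φ s 0) = U s := by rw [(hφ s).2.2, (hφ s).2.1]; simp
    have hsαβ : s ∈ Ioo α β := ⟨hs.1, hs.2.trans hpβ⟩
    have hr : range (φ s) ⊆ Icc α β := by
      rintro _ ⟨t, rfl⟩
      exact Ioo_subset_Icc_self (energy_trap (I := univ) isOpen_univ isPreconnected_univ (fun x _ => hU x)
        (fun t _ => ⟨trivial, (hφ s).1.1 t, (hφ s).1.2 t⟩) (mem_univ 0) (mem_univ t)
        (by rw [(hφ s).2.1]; exact hsαβ) (by rw [hE0]; exact hUlt s hsαβ)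
        (by rw [hE0, hUαβ]; exact hUlt s hsαβ))
    exact ⟨hFs, (hφ s).1.isBddNonconstSolution hw.1 hsub hFf hr (by rw [(hφ s).2.1]; exact hFs.ne),
      hrange ▸ hr⟩
  obtain ⟨T, hT, hper⟩ := exists_common_period hFL (fun s => (hφ s).1) (fun s => (hφ s).2.1)
    (fun s => (hφ s).2.2) hαp (fun s h => (hs s h).1) (fun s h => hcomm.1 _ (hs s h).2)
    (fun s h s' h' T T' => hcomm.2 _ (hs s h).2 _ (hs s' h').2 T T')
  exact no_common_period_of_deriv_eq_zero hFL (fun s => (hφ s).1) (fun s => (hφ s).2.1)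
    (fun s => (hφ s).2.2) hαp (fun s h => (hs s h).1) hT hper hFp
    (by rw [hzero]; exact hdF.hasDerivWithinAt)

/-- A nondegenerate minimum of the potential is Lyapunov stable. -/
theorem IsNondegStableEquilibrium.isStable {I : Set ℝ} (hI : IsOpen I) (hord : I.OrdConnected)
    {ρ Ψ : ℝ → ℝ} (hρ : ContDiffOn ℝ ∞ ρ I) (hΨ : ContDiffOn ℝ ∞ Ψ I) {K p : ℝ}
    (h : IsNondegStableEquilibrium I ρ Ψ K p) : IsStableEquilibrium I ρ Ψ K p := by
  refine ⟨h.1, fun ε hε => ?_⟩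
  have hf := contDiffOn_force hρ hΨ K
  obtain ⟨hfp, hd⟩ := h.force_eq
  obtain ⟨r, hr0, hrε, hlin⟩ := exists_linear_bound hI hf h.1.2.1 hfp hd (half_pos hε)
  set f := force ρ Ψ K with hfdef
  set l := deriv f p with hl
  obtain ⟨U, hU⟩ : ∃ U : ℝ → ℝ, ∀ x ∈ I, HasDerivAt U (f x) x := by
    refine ⟨fun x => ∫ t in p..x, f t, fun x hx => ?_⟩
    exact intervalIntegral.integral_hasDerivAt_right
      ((hf.continuousOn.mono (hord.uIcc_subset h.1.2.1 hx)).intervalIntegrable)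
      (hf.continuousOn.stronglyMeasurableAtFilter hI x hx)
      (hf.continuousOn.continuousAt (hI.mem_nhds hx))
  have hmem : ∀ x, |x| ≤ r → p + x ∈ Icc (p - r) (p + r) := by
    intro x hx
    rw [abs_le] at hx
    exact ⟨by linarith, by linarith⟩
  have hb := fun x hx => potential_bounds (F := f) (U := U) (p := p) (l := l) (r := r) (x := x)
    (fun x hx => hU _ (hlin _ (hmem x hx)).2)
    (fun x hx => by simpa using (hlin _ (hmem x hx)).1) hx
  set m := min (l / 4 * r ^ 2) (ε ^ 2 / 2) with hm
  have hm0 : 0 < m := by positivity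
  set δ := min r (min 1 (m / (1 + l))) with hδ
  have hδ0 : 0 < δ := by positivity
  have hδr : δ ≤ r := min_le_left _ _
  have hδ1 : δ ≤ 1 := (min_le_right _ _).trans (min_le_left _ _)
  have hδm : δ * (1 + l) ≤ m := by
    rw [← le_div_iff₀ (by positivity)]
    exact (min_le_right _ _).trans (min_le_right _ _)
  refine ⟨δ, hδ0, fun z s T hs hT hsol hz0 hv0 t ht => ?_⟩
  have hz : ∀ u ∈ Ioo s T, z u ∈ I ∧ HasDerivAt z (deriv z u) u ∧
      HasDerivAt (deriv z) (-f (z u)) u := fun u hu => hsol.hasDerivAt hu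
  have h0 : (0 : ℝ) ∈ Ioo s T := ⟨hs, hT⟩
  have htm : t ∈ Ioo s T := ⟨hs.trans_le ht.1, ht.2⟩
  have hE0 : deriv z 0 ^ 2 / 2 + U (z 0) - U p < m := by
    have h1 := (hb (z 0 - p) (hz0.le.trans hδr)).2
    rw [add_sub_cancel] at h1
    have h2 : (z 0 - p) ^ 2 ≤ δ ^ 2 := by rw [← sq_abs]; gcongr
    have h3 : deriv z 0 ^ 2 ≤ δ ^ 2 := by rw [← sq_abs]; gcongr
    have h4 : δ ^ 2 ≤ δ := by nlinarith
    nlinarith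
  have hUr : ∀ x, |x| = r → deriv z 0 ^ 2 / 2 + U (z 0) < U (p + x) := by
    intro x hx
    have h1 := (hb x hx.le).1
    rw [← sq_abs, hx] at h1
    have h2 : m ≤ l / 4 * r ^ 2 := min_le_left _ _
    linarith
  have hz0' := abs_lt.1 hz0
  have htrap := energy_trap isOpen_Ioo isPreconnected_Ioo hU hz h0 htm (α := p - r) (β := p + r)
    ⟨by linarith, by linarith⟩
    (by rw [sub_eq_add_neg]; exact hUr _ (by rw [abs_neg, abs_of_pos hr0]))
    (hUr _ (abs_of_pos hr0))
  have hzt : |z t - p| < r := by rw [abs_lt]; constructor <;> linarith [htrap.1, htrap.2]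
  refine ⟨by linarith, ?_⟩
  have hEt := energy_const isOpen_Ioo isPreconnected_Ioo hU hz h0 htm
  have hlow := (hb _ hzt.le).1
  rw [add_sub_cancel] at hlow
  have h2 : m ≤ ε ^ 2 / 2 := min_le_right _ _
  apply abs_lt_of_sq_lt_sq _ hε.le
  nlinarith [sq_nonneg (z t - p)]

/-- An equilibrium towards which the force nowhere points is not stable. -/
theorem not_isStable_of_repelling {I : Set ℝ} (hI : IsOpen I) {ρ Ψ : ℝ → ℝ}
    (hρ : ContDiffOn ℝ ∞ ρ I) (hΨ : ContDiffOn ℝ ∞ Ψ I) {K p : ℝ}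
    (hrep : ∀ᶠ x in 𝓝 p, (x - p) * force ρ Ψ K x ≤ 0) : ¬ IsStableEquilibrium I ρ Ψ K p := by
  intro hst
  have hf := contDiffOn_force hρ hΨ K
  obtain ⟨d, hd0, hd⟩ := Metric.eventually_nhds_iff.1 (hrep.and (hI.mem_nhds hst.1.2.1))
  set r := d / 2 with hr
  have hr0 : 0 < r := by positivity
  have hmem : ∀ x ∈ Icc (p - r) (p + r), dist x p < d := by
    intro x hx
    rw [Real.dist_eq, abs_lt]
    constructor <;> linarith [hx.1, hx.2]
  have hsub : Icc (p - r) (p + r) ⊆ I := fun x hx => (hd (hmem x hx)).2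
  obtain ⟨F, L, M, hFL, hFM, hFf⟩ := exists_bounded_lipschitz_extension hI hf
    (by linarith : p - r ≤ p + r) hsub
  obtain ⟨δ, hδ0, hδ⟩ := hst.2 (r / 2) (by positivity)
  set s := min (δ / 2) (r / 4) with hs
  have hs0 : 0 < s := by positivity
  have hsδ : s < δ := (min_le_left _ _).trans_lt (by linarith)
  have hsr : s ≤ r / 4 := min_le_right _ _
  obtain ⟨x, v, ho, hx0, hv0⟩ := exists_orbit hFL hFM (p + s) s
  have hcx := ho.continuous.1
  have hx0' : |x 0 - p| = s := by rw [hx0, add_sub_cancel_left, abs_of_pos hs0]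
  have hstay : ∀ t, 0 ≤ t → |x t - p| < r / 2 := by
    by_contra hcon
    push Not at hcon
    obtain ⟨t₁, ht₁, hle⟩ := hcon
    let A : Set ℝ := {t | 0 ≤ t ∧ r / 2 ≤ |x t - p|}
    have hA : IsClosed A := (isClosed_le continuous_const continuous_id).inter
      (isClosed_le continuous_const (by fun_prop : Continuous fun t => |x t - p|))
    have hbd : BddBelow A := ⟨0, fun t ht => ht.1⟩
    have hm := hA.csInf_mem ⟨t₁, ht₁, hle⟩ hbd
    set σ := sInf A with hσ
    have hbefore : ∀ t ∈ Ico 0 σ, |x t - p| < r / 2 := by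
      intro t ht
      by_contra h
      exact absurd (csInf_le hbd (show t ∈ A from ⟨ht.1, not_lt.1 h⟩)) (not_le.2 ht.2)
    have hσ0 : 0 < σ := by
      rcases hm.1.lt_or_eq with h | h
      · exact h
      · have := hm.2
        rw [← h, hx0'] at this
        linarith
    have hσr : |x σ - p| ≤ r / 2 := by
      have hcl : σ ∈ closure (Ico 0 σ) := by
        rw [closure_Ico hσ0.ne]
        exact right_mem_Icc.2 hσ0.le
      exact closure_minimal (fun u hu => (hbefore u hu).le)
        (isClosed_le (by fun_prop : Continuous fun u => |x u - p|) continuous_const) hcl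
    have hnear : ∀ t₀, |x t₀ - p| < r → ∃ η > 0, ∀ t, dist t t₀ < η → |x t - p| < r := by
      intro t₀ h
      obtain ⟨η, hη, h'⟩ := Metric.eventually_nhds_iff.1
        ((by fun_prop : Continuous fun u => |x u - p|).continuousAt.eventually_lt_const h)
      exact ⟨η, hη, fun t ht => h' ht⟩
    obtain ⟨η₀, hη₀, hn₀⟩ := hnear 0 (by linarith)
    obtain ⟨η₁, hη₁, hn₁⟩ := hnear σ (by linarith)
    have hin : ∀ t ∈ Ioo (-η₀) (σ + η₁), |x t - p| < r := by
      intro t ht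
      rcases lt_or_ge t 0 with h | h
      · exact hn₀ t (by rw [Real.dist_eq, abs_lt]; constructor <;> linarith [ht.1])
      rcases lt_or_ge t σ with h' | h'
      · linarith [hbefore t ⟨h, h'⟩]
      · exact hn₁ t (by rw [Real.dist_eq, abs_lt]; constructor <;> linarith [ht.2])
    have hsol : IsSolutionOn I ρ Ψ K x (Ioo (-η₀) (σ + η₁)) := by
      refine isSolutionOn_of_hasDerivAt isOpen_Ioo (v := v) fun t ht => ?_
      have h1 := abs_lt.1 (hin t ht)
      have h2 : x t ∈ Icc (p - r) (p + r) := ⟨by linarith, by linarith⟩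
      exact ⟨hsub h2, ho.1 t, by rw [← hFf _ h2]; exact ho.2 t⟩
    have := (hδ x (-η₀) (σ + η₁) (by linarith) (by linarith) hsol (by rw [hx0']; exact hsδ)
      (by rw [(ho.1 0).deriv, hv0, abs_of_pos hs0]; exact hsδ) σ ⟨hm.1, by linarith⟩).1
    linarith [hm.2]
  have hforce : ∀ t, 0 ≤ t → (x t - p) * F (x t) ≤ 0 := by
    intro t ht
    have h1 := abs_lt.1 (hstay t ht)
    have h2 : x t ∈ Icc (p - r) (p + r) := ⟨by linarith, by linarith⟩
    rw [hFf _ h2]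
    exact (hd (hmem _ h2)).1
  have hmono : MonotoneOn (fun t => (x t - p) * v t) (Ici 0) := by
    have hder : ∀ t, HasDerivAt (fun t => (x t - p) * v t)
        (v t * v t + (x t - p) * -F (x t)) t := fun t => ((ho.1 t).sub_const p).mul (ho.2 t)
    apply monotoneOn_of_deriv_nonneg (convex_Ici 0)
      (fun t _ => (hder t).continuousAt.continuousWithinAt)
      (fun t _ => (hder t).differentiableAt.differentiableWithinAt)
    intro t ht
    rw [interior_Ici] at ht
    rw [(hder t).deriv]
    nlinarith [hforce t (mem_Ioi.1 ht).le, mul_self_nonneg (v t)]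
  have hgrow : MonotoneOn (fun t => (x t - p) ^ 2 - 2 * s ^ 2 * t) (Ici 0) := by
    have hder : ∀ t, HasDerivAt (fun t => (x t - p) ^ 2 - 2 * s ^ 2 * t)
        (2 * ((x t - p) * v t) - 2 * s ^ 2) t := fun t =>
      ((((ho.1 t).sub_const p).pow 2).sub ((hasDerivAt_id t).const_mul (2 * s ^ 2))).congr_deriv
        (by push_cast; ring)
    apply monotoneOn_of_deriv_nonneg (convex_Ici 0)
      (fun t _ => (hder t).continuousAt.continuousWithinAt)
      (fun t _ => (hder t).differentiableAt.differentiableWithinAt)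
    intro t ht
    rw [interior_Ici] at ht
    rw [(hder t).deriv]
    have := hmono (mem_Ici.2 le_rfl) (mem_Ici.2 (mem_Ioi.1 ht).le) (mem_Ioi.1 ht).le
    simp only [hx0, hv0, add_sub_cancel_left] at this
    nlinarith
  have hT : 0 ≤ r ^ 2 / s ^ 2 := by positivity
  have h1 := hgrow (mem_Ici.2 le_rfl) (mem_Ici.2 hT) hT
  simp only [hx0, add_sub_cancel_left, mul_zero, sub_zero] at h1
  have h2 : 2 * s ^ 2 * (r ^ 2 / s ^ 2) = 2 * r ^ 2 := by field_simp
  rw [h2] at h1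
  have h3 : (x (r ^ 2 / s ^ 2) - p) ^ 2 ≤ (r / 2) ^ 2 := by
    rw [← sq_abs]
    gcongr
    exact (hstay _ hT).le
  nlinarith

/-- If every point is a stable equilibrium, then some equilibrium is nondegenerate. -/
theorem exists_nondeg_of_forall_stable {I : Set ℝ} (hI : IsOpen I) (hne : I.Nonempty)
    {ρ Ψ : ℝ → ℝ} (hρ : ContDiffOn ℝ ∞ ρ I) (hΨ : ContDiffOn ℝ ∞ Ψ I)
    (hst : ∀ z₀ ∈ I, ∃ K₀, IsStableEquilibrium I ρ Ψ K₀ z₀) :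
    ∃ K p, IsNondegStableEquilibrium I ρ Ψ K p := by
  by_contra hnd
  push Not at hnd
  by_cases hall : ∀ z ∈ I, ρ z = 0
  · obtain ⟨z₀, hz₀⟩ := hne
    obtain ⟨K₀, hK₀⟩ := hst z₀ hz₀
    refine not_isStable_of_repelling hI hρ hΨ ?_ hK₀
    filter_upwards [hI.mem_nhds hz₀] with x hx
    obtain ⟨K, hK⟩ := hst x hx
    have h1 := hK.1.2.2
    rw [hall x hx, eq_comm, div_eq_zero_iff] at h1
    have h2 : Ψ x = 0 := h1.resolve_right (pow_ne_zero 2 hK.1.1)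
    simp [force, hall x hx, h2]
  · push Not at hall
    obtain ⟨z₀, hz₀, hρz₀⟩ := hall
    obtain ⟨K₀, hK₀⟩ := hst z₀ hz₀
    refine not_isStable_of_repelling hI hρ hΨ ?_ hK₀
    have hcont := hρ.continuousOn.continuousAt (hI.mem_nhds hz₀)
    obtain ⟨d, hd0, hd⟩ := Metric.eventually_nhds_iff.1
      ((hcont.eventually_ne hρz₀).and (hI.mem_nhds hz₀))
    have hball : ∀ x ∈ Metric.ball z₀ d, x ∈ I ∧ Ψ x ≠ 0 ∧
        deriv ρ x - deriv Ψ x * (ρ x / Ψ x) ≤ 0 := by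
      intro x hx
      obtain ⟨hρx, hxI⟩ := hd hx
      obtain ⟨K, hK⟩ := hst x hxI
      have hΨx : Ψ x ≠ 0 := by
        intro h0
        have := hK.1.2.2
        rw [h0, zero_div] at this
        exact hρx this
      have hκ : 1 / K ^ 2 = ρ x / Ψ x := by
        rw [hK.1.2.2]
        field_simp
      have h1 : ¬ 0 < deriv (fun z => ρ z - Ψ z / K ^ 2) x := fun h => hnd K x ⟨hK.1, h⟩
      have h2 : HasDerivAt (fun z => ρ z - Ψ z / K ^ 2) (deriv ρ x - deriv Ψ x / K ^ 2) x :=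
        (hasDerivAt_of_contDiffOn hI hρ hxI).sub
          ((hasDerivAt_of_contDiffOn hI hΨ hxI).div_const _)
      rw [h2.deriv, not_lt] at h1
      refine ⟨hxI, hΨx, ?_⟩
      rw [← hκ, mul_one_div]
      exact h1
    have hz₀b : z₀ ∈ Metric.ball z₀ d := Metric.mem_ball_self hd0
    have hsign : ∀ x ∈ Metric.ball z₀ d, 0 < Ψ x * Ψ z₀ := by
      intro x hx
      by_contra hle
      have hcΨ : ContinuousOn (fun x => Ψ x * Ψ z₀) (Metric.ball z₀ d) :=
        (hΨ.continuousOn.mono fun y hy => (hball y hy).1).mul_const _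
      obtain ⟨y, hy, hy0⟩ := (convex_ball z₀ d).isPreconnected.intermediate_value hx hz₀b hcΨ
        (show (0 : ℝ) ∈ Icc _ _ from ⟨not_lt.1 hle, mul_self_nonneg _⟩)
      exact mul_ne_zero (hball y hy).2.1 (hball z₀ hz₀b).2.1 hy0
    have hder : ∀ x ∈ Metric.ball z₀ d, HasDerivAt (fun x => -Ψ z₀ * (ρ x / Ψ x))
        (-Ψ z₀ * ((deriv ρ x * Ψ x - ρ x * deriv Ψ x) / Ψ x ^ 2)) x := fun x hx =>
      ((hasDerivAt_of_contDiffOn hI hρ (hball x hx).1).div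
        (hasDerivAt_of_contDiffOn hI hΨ (hball x hx).1) (hball x hx).2.1).const_mul _
    have hmono : MonotoneOn (fun x => -Ψ z₀ * (ρ x / Ψ x)) (Metric.ball z₀ d) := by
      apply monotoneOn_of_deriv_nonneg (convex_ball z₀ d)
        (fun x hx => (hder x hx).continuousAt.continuousWithinAt)
        (fun x hx => (hder x (interior_subset hx)).differentiableAt.differentiableWithinAt)
      intro x hx
      have hx' := interior_subset hx
      rw [(hder x hx').deriv]
      obtain ⟨-, hΨx, hle⟩ := hball x hx'
      have h1 : -Ψ z₀ * ((deriv ρ x * Ψ x - ρ x * deriv Ψ x) / Ψ x ^ 2)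
          = (Ψ x * Ψ z₀) * -(deriv ρ x - deriv Ψ x * (ρ x / Ψ x)) / Ψ x ^ 2 := by
        field_simp
      rw [h1]
      have := hsign x hx'
      have h2 : 0 ≤ -(deriv ρ x - deriv Ψ x * (ρ x / Ψ x)) := by linarith
      positivity
    filter_upwards [Metric.ball_mem_nhds z₀ hd0] with x hx
    have hΨx := (hball x hx).2.1
    have hΨz := (hball z₀ hz₀b).2.1
    have hκ : force ρ Ψ K₀ x = Ψ x * Ψ z₀ / Ψ z₀ ^ 2 * (Ψ z₀ * (ρ x / Ψ x)
        - Ψ z₀ * (ρ z₀ / Ψ z₀)) := by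
      rw [force, hK₀.1.2.2]
      have := hK₀.1.1
      field_simp
    rw [hκ]
    have hc : 0 < Ψ x * Ψ z₀ / Ψ z₀ ^ 2 := div_pos (hsign x hx) (by positivity)
    have hprod : (x - z₀) * (Ψ z₀ * (ρ x / Ψ x) - Ψ z₀ * (ρ z₀ / Ψ z₀)) ≤ 0 := by
      rcases le_total x z₀ with h | h
      · have := hmono hx hz₀b h
        simp only at this
        nlinarith
      · have := hmono hz₀b hx h
        simp only at this
        nlinarith
    nlinarith

/-- The second derivative of the potential at `z`, for the parameter `K` for which `z` is an
equilibrium. -/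
noncomputable def stiffness (ρ Ψ : ℝ → ℝ) (z : ℝ) : ℝ := deriv ρ z - deriv Ψ z * (ρ z / Ψ z)

/-- The set of nondegenerate stable equilibria. -/
def stableSet (I : Set ℝ) (ρ Ψ : ℝ → ℝ) : Set ℝ :=
  {z | z ∈ I ∧ 0 < Ψ z / ρ z ∧ 0 < stiffness ρ Ψ z}

/-- `ρ' = c` and `Ψ = A`. -/
def LinearForm (I : Set ℝ) (ρ Ψ : ℝ → ℝ) (c A : ℝ) : Prop :=
  0 < c ∧ ∀ z ∈ I, deriv ρ z = c ∧ Ψ z = A ∧ 0 < A * ρ z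

/-- `ρ = ((z - ζ) ^ 4 + D) / (μ ^ 2 (z - ζ) ^ 3)` and `Ψ = A / (z - ζ) ^ 3`. -/
def CubicForm (I : Set ℝ) (ρ Ψ : ℝ → ℝ) (ζ D μ A : ℝ) : Prop :=
  0 < μ ∧ ζ ∉ I ∧ ∀ z ∈ I, ρ z = ((z - ζ) ^ 4 + D) / (μ ^ 2 * (z - ζ) ^ 3) ∧
    Ψ z = A / (z - ζ) ^ 3 ∧ 0 < A * ((z - ζ) ^ 4 + D)

section

variable {I : Set ℝ} {ρ Ψ : ℝ → ℝ}

theorem hasDerivAt_force (hI : IsOpen I) (hρ : ContDiffOn ℝ ∞ ρ I) (hΨ : ContDiffOn ℝ ∞ Ψ I)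
    (K : ℝ) {z : ℝ} (hz : z ∈ I) :
    HasDerivAt (force ρ Ψ K) (force (deriv ρ) (deriv Ψ) K z) z :=
  (hasDerivAt_of_contDiffOn hI hρ hz).sub ((hasDerivAt_of_contDiffOn hI hΨ hz).div_const _)

theorem deriv_force_eventuallyEq (hI : IsOpen I) (hρ : ContDiffOn ℝ ∞ ρ I)
    (hΨ : ContDiffOn ℝ ∞ Ψ I) (K : ℝ) {z : ℝ} (hz : z ∈ I) :
    deriv (force ρ Ψ K) =ᶠ[𝓝 z] force (deriv ρ) (deriv Ψ) K := by
  filter_upwards [hI.mem_nhds hz] with x hx using (hasDerivAt_force hI hρ hΨ K hx).deriv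

theorem force_eq_of_sq {κ : ℝ} {ρ' Ψ' : ℝ → ℝ} {K z : ℝ} (hK : K ^ 2 = Ψ z / ρ z)
    (h : κ = ρ z / Ψ z) : force ρ' Ψ' K z = ρ' z - Ψ' z * κ := by
  rw [force, hK, h, div_eq_mul_inv, inv_div]

theorem isNondegStableEquilibrium_of_mem (hI : IsOpen I) (hρ : ContDiffOn ℝ ∞ ρ I)
    (hΨ : ContDiffOn ℝ ∞ Ψ I) {z K : ℝ} (hz : z ∈ stableSet I ρ Ψ) (hK : K ^ 2 = Ψ z / ρ z) :
    IsNondegStableEquilibrium I ρ Ψ K z := by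
  obtain ⟨hzI, hpos, hst⟩ := hz
  have hΨ0 : Ψ z ≠ 0 := by rintro h; simp [h] at hpos
  have hρ0 : ρ z ≠ 0 := by rintro h; simp [h] at hpos
  refine ⟨⟨?_, hzI, ?_⟩, ?_⟩
  · rintro rfl
    rw [← hK] at hpos
    simp at hpos
  · rw [hK]
    field_simp
  · change 0 < deriv (force ρ Ψ K) z
    rw [(hasDerivAt_force hI hρ hΨ K hzI).deriv, force_eq_of_sq hK rfl]
    exact hst

theorem IsEquilibrium.sq_eq (hρ0 : ∀ z ∈ I, ρ z ≠ 0) {z K : ℝ}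
    (h : IsEquilibrium I ρ Ψ K z) : K ^ 2 = Ψ z / ρ z := by
  obtain ⟨hK, hz, h⟩ := h
  have := hρ0 z hz
  rw [eq_div_iff this, h]
  field_simp

theorem IsNondegStableEquilibrium.mem_stableSet (hI : IsOpen I) (hρ : ContDiffOn ℝ ∞ ρ I)
    (hΨ : ContDiffOn ℝ ∞ Ψ I) (hρ0 : ∀ z ∈ I, ρ z ≠ 0) {z K : ℝ}
    (h : IsNondegStableEquilibrium I ρ Ψ K z) : z ∈ stableSet I ρ Ψ := by
  have hK := h.1.sq_eq hρ0
  have hK0 := h.1.1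
  refine ⟨h.1.2.1, by rw [← hK]; positivity, ?_⟩
  have := h.force_eq.2
  rw [(hasDerivAt_force hI hρ hΨ K h.1.2.1).deriv, force_eq_of_sq hK rfl] at this
  exact this

theorem continuousAt_stiffness (hI : IsOpen I) (hρ : ContDiffOn ℝ ∞ ρ I)
    (hΨ : ContDiffOn ℝ ∞ Ψ I) {z : ℝ} (hz : z ∈ I) (hΨ0 : Ψ z ≠ 0) :
    ContinuousAt (stiffness ρ Ψ) z := by
  have h1 := (contDiffOn_deriv hI hρ).continuousOn.continuousAt (hI.mem_nhds hz)
  have h2 := (contDiffOn_deriv hI hΨ).continuousOn.continuousAt (hI.mem_nhds hz)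
  have h3 := hρ.continuousOn.continuousAt (hI.mem_nhds hz)
  have h4 := hΨ.continuousOn.continuousAt (hI.mem_nhds hz)
  exact h1.sub (h2.mul (h3.div h4 hΨ0))

theorem ne_zero_of_mem_stableSet {z : ℝ} (hz : z ∈ stableSet I ρ Ψ) : ρ z ≠ 0 ∧ Ψ z ≠ 0 := by
  constructor <;> rintro h <;> simpa [h] using hz.2.1

theorem continuousAt_ratio (hI : IsOpen I) (hρ : ContDiffOn ℝ ∞ ρ I)
    (hΨ : ContDiffOn ℝ ∞ Ψ I) {z : ℝ} (hz : z ∈ I) (h0 : ρ z ≠ 0) :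
    ContinuousAt (fun z => Ψ z / ρ z) z :=
  (hΨ.continuousOn.continuousAt (hI.mem_nhds hz)).div
    (hρ.continuousOn.continuousAt (hI.mem_nhds hz)) h0

theorem isOpen_stableSet (hI : IsOpen I) (hρ : ContDiffOn ℝ ∞ ρ I)
    (hΨ : ContDiffOn ℝ ∞ Ψ I) : IsOpen (stableSet I ρ Ψ) := by
  rw [isOpen_iff_mem_nhds]
  intro z hz
  obtain ⟨hρ0, hΨ0⟩ := ne_zero_of_mem_stableSet hz
  exact (hI.eventually_mem hz.1).and
    (((continuousAt_ratio hI hρ hΨ hz.1 hρ0).eventually_const_lt hz.2.1).and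
      ((continuousAt_stiffness hI hρ hΨ hz.1 hΨ0).eventually_const_lt hz.2.2))

theorem PeriodicCommensurable.mono {S S' : Set (ℝ → ℝ)} (h : PeriodicCommensurable S)
    (hS : S' ⊆ S) : PeriodicCommensurable S' :=
  ⟨fun z hz => h.1 z (hS hz), fun z hz w hw => h.2 z (hS hz) w (hS hw)⟩

theorem ClosesNear.local_isochronism (hI : IsOpen I) (hρ : ContDiffOn ℝ ∞ ρ I)
    (hΨ : ContDiffOn ℝ ∞ Ψ I) {K₀ z₀ ε δ : ℝ}
    (hS : PeriodicCommensurable {z | ∃ K ∈ Ioo (K₀ - δ) (K₀ + δ),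
      IsBddNonconstSolution I ρ Ψ K z ∧ range z ⊆ Icc (z₀ - ε) (z₀ + ε)}) {z K : ℝ}
    (hz : z ∈ stableSet I ρ Ψ) (hK : K ^ 2 = Ψ z / ρ z) (hKδ : |K - K₀| < δ) (hε : 0 < ε)
    (hzε : |z - z₀| ≤ ε / 2) :
    (∃ w T, w ∈ {z | ∃ K ∈ Ioo (K₀ - δ) (K₀ + δ),
      IsBddNonconstSolution I ρ Ψ K z ∧ range z ⊆ Icc (z₀ - ε) (z₀ + ε)} ∧ 0 < T ∧
      Function.Periodic w T ∧ cos (√(stiffness ρ Ψ z) * T) = 1) ∧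
    5 * force (deriv (deriv ρ)) (deriv (deriv Ψ)) K z ^ 2 = 3 * stiffness ρ Ψ z *
      force (deriv (deriv (deriv ρ))) (deriv (deriv (deriv Ψ))) K z := by
  have hKI : K ∈ Ioo (K₀ - δ) (K₀ + δ) := by
    have := abs_lt.1 hKδ
    constructor <;> linarith
  have hzε' := abs_le.1 hzε
  have hsub : ∀ w, IsBddNonconstSolution I ρ Ψ K w ∧ range w ⊆ Icc (z - ε / 2) (z + ε / 2) →
      ∃ K ∈ Ioo (K₀ - δ) (K₀ + δ),
        IsBddNonconstSolution I ρ Ψ K w ∧ range w ⊆ Icc (z₀ - ε) (z₀ + ε) := fun w hw =>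
    ⟨K, hKI, hw.1, hw.2.trans (Icc_subset_Icc (by linarith) (by linarith))⟩
  have hst : deriv (force ρ Ψ K) z = stiffness ρ Ψ z := by
    rw [(hasDerivAt_force hI hρ hΨ K hz.1).deriv, force_eq_of_sq hK rfl, stiffness]
  have hρ1 := contDiffOn_deriv hI hρ
  have hΨ1 := contDiffOn_deriv hI hΨ
  have hρ2 := contDiffOn_deriv hI hρ1
  have hΨ2 := contDiffOn_deriv hI hΨ1
  have e2 : deriv (deriv (force ρ Ψ K)) =ᶠ[𝓝 z] force (deriv (deriv ρ)) (deriv (deriv Ψ)) K :=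
    (deriv_force_eventuallyEq hI hρ hΨ K hz.1).deriv.trans
      (deriv_force_eventuallyEq hI hρ1 hΨ1 K hz.1)
  have e3 := e2.deriv.trans (deriv_force_eventuallyEq hI hρ2 hΨ2 K hz.1)
  obtain ⟨⟨w, T, hw, hwr, hT, hper, hcos⟩, hrel⟩ := Bertrand.local_isochronism hI hρ hΨ
    (isNondegStableEquilibrium_of_mem hI hρ hΨ hz hK) (half_pos hε) (hS.mono hsub)
  rw [hst] at hcos hrel
  rw [e2.eq_of_nhds, e3.eq_of_nhds] at hrel
  exact ⟨⟨w, T, hsub w ⟨hw, hwr⟩, hT, hper, hcos⟩, hrel⟩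

theorem exists_nat_of_cos_eq_one {x : ℝ} (hx : 0 < x) (h : cos x = 1) :
    ∃ n : ℤ, n ≠ 0 ∧ x = n * (2 * π) := by
  obtain ⟨n, hn⟩ := (cos_eq_one_iff x).1 h
  refine ⟨n, ?_, hn.symm⟩
  rintro rfl
  simp at hn
  linarith

/-- Under local commensurability the stiffness is locally constant on the set of equilibria. -/
theorem stiffness_eventually_eq (hI : IsOpen I) (hρ : ContDiffOn ℝ ∞ ρ I)
    (hΨ : ContDiffOn ℝ ∞ Ψ I)
    (hloc : ∀ K₀ z₀, IsNondegStableEquilibrium I ρ Ψ K₀ z₀ → ClosesNear I ρ Ψ K₀ z₀)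
    {z₀ : ℝ} (hz₀ : z₀ ∈ stableSet I ρ Ψ) :
    ∀ᶠ z in 𝓝 z₀, stiffness ρ Ψ z = stiffness ρ Ψ z₀ := by
  obtain ⟨hρ0, hΨ0⟩ := ne_zero_of_mem_stableSet hz₀
  obtain ⟨ε, δ, hε, hδ, hS⟩ := hloc (√(Ψ z₀ / ρ z₀)) z₀
    (isNondegStableEquilibrium_of_mem hI hρ hΨ hz₀ (sq_sqrt hz₀.2.1.le))
  have hSopen := isOpen_stableSet hI hρ hΨ
  have hcK : ContinuousAt (fun z => |√(Ψ z / ρ z) - √(Ψ z₀ / ρ z₀)|) z₀ :=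
    (((continuousAt_ratio hI hρ hΨ hz₀.1 hρ0).sqrt).sub_const _).abs
  have hcz : ContinuousAt (fun z => |z - z₀|) z₀ := by fun_prop
  have hev := ((hSopen.eventually_mem hz₀).and
    ((hcK.eventually_lt_const (by simpa using hδ)).and
      (hcz.eventually_lt_const (show |z₀ - z₀| < ε / 2 by simpa using hε))))
  obtain ⟨d, hd0, hd⟩ := Metric.eventually_nhds_iff_ball.1 hev
  have hz₀b := Metric.mem_ball_self (x := z₀) hd0
  have hper : ∀ z ∈ Metric.ball z₀ d, _ := fun z hz =>
    (ClosesNear.local_isochronism hI hρ hΨ hS (hd z hz).1 (sq_sqrt (hd z hz).1.2.1.le)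
      (hd z hz).2.1 hε (hd z hz).2.2.le).1
  obtain ⟨w₀, T₀, hw₀, hT₀, hp₀, hc₀⟩ := hper z₀ hz₀b
  have hpos : ∀ z ∈ Metric.ball z₀ d, 0 < √(stiffness ρ Ψ z) := fun z hz =>
    sqrt_pos.2 (hd z hz).1.2.2
  obtain ⟨m, hm, hm'⟩ := exists_nat_of_cos_eq_one (mul_pos (hpos z₀ hz₀b) hT₀) hc₀
  have hrat : ((fun z => √(stiffness ρ Ψ z)) '' Metric.ball z₀ d).Countable := by
    refine (countable_range fun q : ℚ => (q : ℝ) * √(stiffness ρ Ψ z₀)).mono ?_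
    rintro _ ⟨z, hz, rfl⟩
    obtain ⟨w, T, hw, hT, hp, hc⟩ := hper z hz
    obtain ⟨n, hn, hn'⟩ := exists_nat_of_cos_eq_one (mul_pos (hpos z hz) hT) hc
    obtain ⟨q, hq⟩ := hS.2 w₀ hw₀ w hw T₀ T hT₀ hp₀ hT hp
    refine ⟨(n / m : ℚ) * q, ?_⟩
    simp only
    push_cast
    rw [← hq]
    have hm0 : (m : ℝ) ≠ 0 := by exact_mod_cast hm
    have hπ := pi_pos
    field_simp
    have h1 : √(stiffness ρ Ψ z) * T * (m * (2 * π))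
        = √(stiffness ρ Ψ z₀) * T₀ * (n * (2 * π)) := by rw [hn', hm']; ring
    have h2 : (2 * π) * (√(stiffness ρ Ψ z) * T * m) = (2 * π) * (√(stiffness ρ Ψ z₀) * T₀ * n) := by
      linear_combination h1
    have h3 := mul_left_cancel₀ (by positivity) h2
    linear_combination -h3
  have hcont : ContinuousOn (fun z => √(stiffness ρ Ψ z)) (Metric.ball z₀ d) := fun z hz =>
    ((continuousAt_stiffness hI hρ hΨ (hd z hz).1.1
      (ne_zero_of_mem_stableSet (hd z hz).1).2).sqrt).continuousWithinAt
  have hsub := hrat.isTotallyDisconnected _ subset_rfl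
    ((convex_ball z₀ d).isPreconnected.image _ hcont)
  filter_upwards [Metric.ball_mem_nhds z₀ hd0] with z hz
  have := hsub (mem_image_of_mem _ hz) (mem_image_of_mem _ hz₀b)
  exact (sqrt_inj (hd z hz).1.2.2.le hz₀.2.2.le).1 this

/-- The differential equation for `Ψ` on the set of equilibria. -/
theorem four_mul_sq_deriv_eq (hI : IsOpen I) (hρ : ContDiffOn ℝ ∞ ρ I)
    (hΨ : ContDiffOn ℝ ∞ Ψ I)
    (hloc : ∀ K₀ z₀, IsNondegStableEquilibrium I ρ Ψ K₀ z₀ → ClosesNear I ρ Ψ K₀ z₀)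
    {z : ℝ} (hz : z ∈ stableSet I ρ Ψ) :
    4 * deriv Ψ z ^ 2 = 3 * Ψ z * deriv (deriv Ψ) z := by
  obtain ⟨hρ0, hΨ0⟩ := ne_zero_of_mem_stableSet hz
  have hρ1 := contDiffOn_deriv hI hρ
  have hΨ1 := contDiffOn_deriv hI hΨ
  have hρ2 := contDiffOn_deriv hI hρ1
  have hΨ2 := contDiffOn_deriv hI hΨ1
  set l := stiffness ρ Ψ z with hl
  have hl0 : 0 < l := hz.2.2
  obtain ⟨ε, δ, hε, hδ, hS⟩ := hloc (√(Ψ z / ρ z)) z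
    (isNondegStableEquilibrium_of_mem hI hρ hΨ hz (sq_sqrt hz.2.1.le))
  have hrel := (ClosesNear.local_isochronism hI hρ hΨ hS hz (sq_sqrt hz.2.1.le)
    (by simpa using hδ) hε (by simpa using (half_pos hε).le)).2
  rw [force_eq_of_sq (sq_sqrt hz.2.1.le) rfl, force_eq_of_sq (sq_sqrt hz.2.1.le) rfl,
    ← hl] at hrel
  have hev := (stiffness_eventually_eq hI hρ hΨ hloc hz).and
    ((isOpen_stableSet hI hρ hΨ).eventually_mem hz)
  have w0 : (fun x => deriv ρ x * Ψ x - ρ x * deriv Ψ x) =ᶠ[𝓝 z] fun x => l * Ψ x := by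
    filter_upwards [hev] with x hx
    have h0 := (ne_zero_of_mem_stableSet hx.2).2
    rw [hl, ← hx.1, stiffness]
    field_simp
  have hd : ∀ {g : ℝ → ℝ}, ContDiffOn ℝ ∞ g I → ∀ {x}, x ∈ I → HasDerivAt g (deriv g x) x :=
    fun hg _ hx => hasDerivAt_of_contDiffOn hI hg hx
  have w1 : (fun x => deriv (deriv ρ) x * Ψ x - ρ x * deriv (deriv Ψ) x)
      =ᶠ[𝓝 z] fun x => l * deriv Ψ x := by
    filter_upwards [w0.eventuallyEq_nhds, hI.mem_nhds hz.1] with x hx hxI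
    have h1 := (((hd hρ1 hxI).mul (hd hΨ hxI)).sub ((hd hρ hxI).mul (hd hΨ1 hxI)))
    have h2 := (h1.congr_of_eventuallyEq hx.symm).unique ((hd hΨ hxI).const_mul l)
    linear_combination h2
  have w2 : deriv (deriv (deriv ρ)) z * Ψ z + deriv (deriv ρ) z * deriv Ψ z
      - (deriv ρ z * deriv (deriv Ψ) z + ρ z * deriv (deriv (deriv Ψ)) z)
      = l * deriv (deriv Ψ) z := by
    have h1 := (((hd hρ2 hz.1).mul (hd hΨ hz.1)).sub ((hd hρ hz.1).mul (hd hΨ2 hz.1)))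
    exact (h1.congr_of_eventuallyEq w1.symm).unique ((hd hΨ1 hz.1).const_mul l)
  have w0 := w0.eq_of_nhds
  have w1 := w1.eq_of_nhds
  have f2 : deriv (deriv ρ) z - deriv (deriv Ψ) z * (ρ z / Ψ z) = l * deriv Ψ z / Ψ z := by
    field_simp
    linear_combination w1
  have f3 : deriv (deriv (deriv ρ)) z - deriv (deriv (deriv Ψ)) z * (ρ z / Ψ z)
      = l * (2 * Ψ z * deriv (deriv Ψ) z - deriv Ψ z ^ 2) / Ψ z ^ 2 := by
    field_simp
    linear_combination Ψ z * w2 - deriv Ψ z * w1 + deriv (deriv Ψ) z * w0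
  rw [f2, f3] at hrel
  field_simp at hrel
  nlinarith

theorem exists_const_of_deriv_eq_zero {C : Set ℝ} (hC : IsOpen C) (hCc : IsPreconnected C)
    {g g' : ℝ → ℝ} (hg : ∀ z ∈ C, HasDerivAt g (g' z) z) (h0 : ∀ z ∈ C, g' z = 0) :
    ∃ c, ∀ z ∈ C, g z = c := by
  rcases C.eq_empty_or_nonempty with rfl | ⟨z₀, hz₀⟩
  · exact ⟨0, fun z hz => hz.elim⟩
  · exact ⟨g z₀, fun z hz => hC.is_const_of_deriv_eq_zero hCc
      (fun z hz => (hg z hz).differentiableAt.differentiableWithinAt)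
      (fun z hz => by rw [(hg z hz).deriv, h0 z hz]; rfl) hz hz₀⟩

/-- Solutions of `4 Ψ' ^ 2 = 3 Ψ Ψ''`. -/
theorem const_or_cubic {C : Set ℝ} (hC : IsOpen C) (hCc : IsPreconnected C) (hne : C.Nonempty)
    (hΨ : ContDiffOn ℝ ∞ Ψ C) (h0 : ∀ z ∈ C, Ψ z ≠ 0)
    (hode : ∀ z ∈ C, 4 * deriv Ψ z ^ 2 = 3 * Ψ z * deriv (deriv Ψ) z) :
    ∃ A ≠ 0, (∀ z ∈ C, Ψ z = A) ∨ ∃ ζ, ∀ z ∈ C, Ψ z * (z - ζ) ^ 3 = A := by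
  have hd : ∀ z ∈ C, HasDerivAt Ψ (deriv Ψ z) z := fun z hz => hasDerivAt_of_contDiffOn hC hΨ hz
  have hd' : ∀ z ∈ C, HasDerivAt (deriv Ψ) (deriv (deriv Ψ) z) z := fun z hz =>
    hasDerivAt_of_contDiffOn hC (contDiffOn_deriv hC hΨ) hz
  obtain ⟨z₀, hz₀⟩ := hne
  obtain ⟨k, hk⟩ := exists_const_of_deriv_eq_zero hC hCc
    (fun z hz => ((hd' z hz).pow 3).div ((hd z hz).pow 4) (pow_ne_zero 4 (h0 z hz)))
    (fun z hz => by
      rw [div_eq_zero_iff]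
      left
      simp only [Pi.pow_apply]
      push_cast
      linear_combination (-deriv Ψ z ^ 2 * Ψ z ^ 3) * hode z hz)
  by_cases hk0 : k = 0
  · obtain ⟨A, hA⟩ := exists_const_of_deriv_eq_zero hC hCc hd (fun z hz => by
      have := hk z hz
      simp only [Pi.div_apply, Pi.pow_apply, hk0, div_eq_zero_iff] at this
      exact pow_eq_zero_iff (by norm_num) |>.1
        (this.resolve_right (pow_ne_zero 4 (h0 z hz))))
    exact ⟨A, hA z₀ hz₀ ▸ h0 z₀ hz₀, Or.inl hA⟩
  · have hk' : ∀ z ∈ C, deriv Ψ z ^ 3 = k * Ψ z ^ 4 := by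
      intro z hz
      have := hk z hz
      have h1 := h0 z hz
      simp only [Pi.div_apply, Pi.pow_apply] at this
      rw [← this]
      field_simp
    have hd0 : ∀ z ∈ C, deriv Ψ z ≠ 0 := by
      intro z hz h
      have := hk' z hz
      rw [h] at this
      exact mul_ne_zero hk0 (pow_ne_zero 4 (h0 z hz)) (by linear_combination -this)
    obtain ⟨ζ, hζ⟩ := exists_const_of_deriv_eq_zero hC hCc
      (fun z hz => (hasDerivAt_id z).add (((hd z hz).div (hd' z hz) (hd0 z hz)).const_mul 3))
      (fun z hz => by
        have := hd0 z hz
        field_simp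
        linear_combination hode z hz)
    refine ⟨-27 / k, by simp [hk0], Or.inr ⟨ζ, fun z hz => ?_⟩⟩
    have h1 := hζ z hz
    simp only [Pi.add_apply, id, Pi.div_apply] at h1
    have h2 := hd0 z hz
    have h3 : z - ζ = -3 * (Ψ z / deriv Ψ z) := by linear_combination h1
    have h4 := hk' z hz
    rw [h3]
    field_simp
    linear_combination 27 * h4

theorem stableSet_eq (hI : IsOpen I) (hIc : IsPreconnected I) (hρ : ContDiffOn ℝ ∞ ρ I)
    (hΨ : ContDiffOn ℝ ∞ Ψ I) (hρ0 : ∀ z ∈ I, ρ z ≠ 0)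
    (hloc : ∀ K₀ z₀, IsNondegStableEquilibrium I ρ Ψ K₀ z₀ → ClosesNear I ρ Ψ K₀ z₀)
    (hne : (stableSet I ρ Ψ).Nonempty) : I ⊆ stableSet I ρ Ψ := by
  obtain ⟨z₀, hz₀⟩ := hne
  have hSo := isOpen_stableSet hI hρ hΨ
  set C := connectedComponentIn (stableSet I ρ Ψ) z₀ with hCdef
  have hC : IsOpen C := hSo.connectedComponentIn
  have hCc : IsPreconnected C := isPreconnected_connectedComponentIn
  have hCS : C ⊆ stableSet I ρ Ψ := connectedComponentIn_subset _ _
  have hz₀C : z₀ ∈ C := mem_connectedComponentIn hz₀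
  have hCI : C ⊆ I := fun z hz => (hCS hz).1
  obtain ⟨A, hA, hform⟩ := const_or_cubic hC hCc ⟨z₀, hz₀C⟩ (hΨ.mono hCI)
    (fun z hz => (ne_zero_of_mem_stableSet (hCS hz)).2)
    (fun z hz => four_mul_sq_deriv_eq hI hρ hΨ hloc (hCS hz))
  obtain ⟨l, hl⟩ : ∃ l, ∀ z ∈ C, stiffness ρ Ψ z = l :=
    exists_const_of_deriv_eq_zero hC hCc (g' := fun _ => 0)
      (fun z hz => (hasDerivAt_const z (stiffness ρ Ψ z)).congr_of_eventuallyEq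
        (stiffness_eventually_eq hI hρ hΨ hloc (hCS hz))) (fun _ _ => rfl)
  refine (hIc.subset_of_closure_inter_subset hC ⟨z₀, hz₀.1, hz₀C⟩ ?_).trans hCS
  rintro p ⟨hpC, hpI⟩
  have hlim : ∀ {g : ℝ → ℝ} {c : ℝ}, ContinuousAt g p → (∀ z ∈ C, g z = c) → g p = c := by
    intro g c hg hgc
    have := mem_closure_iff_nhdsWithin_neBot.1 hpC
    refine tendsto_nhds_unique (hg.mono_left nhdsWithin_le_nhds : Tendsto g (𝓝[C] p) _) ?_
    exact tendsto_const_nhds.congr' (by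
      filter_upwards [self_mem_nhdsWithin] with z hz using (hgc z hz).symm)
  have hcΨ := hΨ.continuousOn.continuousAt (hI.mem_nhds hpI)
  have hΨp : Ψ p ≠ 0 := by
    rcases hform with h | ⟨ζ, h⟩
    · rw [hlim hcΨ h]
      exact hA
    · intro h0
      have := hlim (g := fun z => Ψ z * (z - ζ) ^ 3) (hcΨ.mul (by fun_prop)) h
      simp only [h0, zero_mul] at this
      exact hA this.symm
  have hpS : p ∈ stableSet I ρ Ψ := by
    refine ⟨hpI, ?_, ?_⟩
    · have hcr := continuousAt_ratio hI hρ hΨ hpI (hρ0 p hpI)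
      have := mem_closure_iff_nhdsWithin_neBot.1 hpC
      have h0 : 0 ≤ Ψ p / ρ p := by
        refine ge_of_tendsto (hcr.mono_left nhdsWithin_le_nhds :
          Tendsto (fun z => Ψ z / ρ z) (𝓝[C] p) _) ?_
        filter_upwards [self_mem_nhdsWithin] with z hz using (hCS hz).2.1.le
      exact lt_of_le_of_ne h0 (div_ne_zero hΨp (hρ0 p hpI)).symm
    · rw [hlim (continuousAt_stiffness hI hρ hΨ hpI hΨp) hl, ← hl z₀ hz₀C]
      exact hz₀.2.2
  have hins : IsPreconnected (insert p C) := hCc.subset_closure (subset_insert p C)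
    (insert_subset hpC subset_closure)
  exact hins.subset_connectedComponentIn (mem_insert_of_mem p hz₀C)
    (insert_subset hpS hCS) (mem_insert p C)

/-- The classification of locally closing functions. -/
theorem IsLocallyClosing.form (hI : IsOpen I) (hIc : IsPreconnected I)
    (hρ : ContDiffOn ℝ ∞ ρ I) (hΨ : ContDiffOn ℝ ∞ Ψ I) (hρ0 : ∀ z ∈ I, ρ z ≠ 0)
    (h : IsLocallyClosing I ρ Ψ) :
    (∃ c A, LinearForm I ρ Ψ c A) ∨ ∃ ζ D μ A, CubicForm I ρ Ψ ζ D μ A := by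
  obtain ⟨⟨K₀, z₀, hnd⟩, hloc⟩ := h
  have hz₀ := hnd.mem_stableSet hI hρ hΨ hρ0
  have hIS := stableSet_eq hI hIc hρ hΨ hρ0 hloc ⟨z₀, hz₀⟩
  obtain ⟨A, hA, hform⟩ := const_or_cubic hI hIc ⟨z₀, hz₀.1⟩ hΨ
    (fun z hz => (ne_zero_of_mem_stableSet (hIS hz)).2)
    (fun z hz => four_mul_sq_deriv_eq hI hρ hΨ hloc (hIS hz))
  obtain ⟨l, hl⟩ : ∃ l, ∀ z ∈ I, stiffness ρ Ψ z = l :=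
    exists_const_of_deriv_eq_zero hI hIc (g' := fun _ => 0)
      (fun z hz => (hasDerivAt_const z (stiffness ρ Ψ z)).congr_of_eventuallyEq
        (stiffness_eventually_eq hI hρ hΨ hloc (hIS hz))) (fun _ _ => rfl)
  have hl0 : 0 < l := hl z₀ hz₀.1 ▸ hz₀.2.2
  have hdρ : ∀ z ∈ I, HasDerivAt ρ (deriv ρ z) z := fun z hz => hasDerivAt_of_contDiffOn hI hρ hz
  have hdΨ : ∀ z ∈ I, HasDerivAt Ψ (deriv Ψ z) z := fun z hz => hasDerivAt_of_contDiffOn hI hΨ hz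
  have hprod : ∀ z ∈ I, 0 < Ψ z * ρ z := by
    intro z hz
    have h1 := (hIS hz).2.1
    have h2 := hρ0 z hz
    have h3 : Ψ z * ρ z = Ψ z / ρ z * ρ z ^ 2 := by field_simp
    rw [h3]
    positivity
  rcases hform with h | ⟨ζ, h⟩
  · refine Or.inl ⟨l, A, hl0, fun z hz => ⟨?_, h z hz, h z hz ▸ hprod z hz⟩⟩
    have h0 : deriv Ψ z = 0 := by
      refine (hdΨ z hz).unique ((hasDerivAt_const z A).congr_of_eventuallyEq ?_)
      filter_upwards [hI.mem_nhds hz] with x hx using h x hx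
    rw [← hl z hz, stiffness, h0]
    ring
  · have hζ : ∀ z ∈ I, z - ζ ≠ 0 := by
      intro z hz h0
      have := h z hz
      rw [h0] at this
      exact hA (by simpa using this.symm)
    have hΨ' : ∀ z ∈ I, deriv Ψ z * (z - ζ) + 3 * Ψ z = 0 := by
      intro z hz
      have h1 := (hdΨ z hz).mul (((hasDerivAt_id z).sub_const ζ).pow 3)
      have h2 := h1.unique ((hasDerivAt_const z A).congr_of_eventuallyEq (by
        filter_upwards [hI.mem_nhds hz] with x hx using h x hx))
      simp only [id, Pi.pow_apply] at h2
      push_cast at h2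
      have h3 : (z - ζ) ^ 2 * (deriv Ψ z * (z - ζ) + 3 * Ψ z) = 0 := by linear_combination h2
      exact (mul_eq_zero.1 h3).resolve_left (pow_ne_zero 2 (hζ z hz))
    obtain ⟨E, hE⟩ := exists_const_of_deriv_eq_zero hI hIc
      (g := fun z => ρ z * (z - ζ) ^ 3 - l / 4 * (z - ζ) ^ 4)
      (fun z hz => ((hdρ z hz).mul (((hasDerivAt_id z).sub_const ζ).pow 3)).sub
        ((((hasDerivAt_id z).sub_const ζ).pow 4).const_mul (l / 4)))
      (fun z hz => by
        have h1 := hl z hz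
        have h2 := hΨ' z hz
        have h3 := (ne_zero_of_mem_stableSet (hIS hz)).2
        rw [stiffness] at h1
        have h4 : deriv Ψ z * (ρ z / Ψ z) * (z - ζ) = -3 * ρ z := by
          field_simp
          linear_combination ρ z * h2
        simp only [id, Pi.pow_apply]
        push_cast
        linear_combination (z - ζ) ^ 3 * h1 + (z - ζ) ^ 2 * h4)
    have hsq : (2 / √l) ^ 2 = 4 / l := by
      rw [div_pow, sq_sqrt hl0.le]
      norm_num
    have hρE : ∀ z ∈ I, ρ z = ((z - ζ) ^ 4 + 4 * E / l) / ((2 / √l) ^ 2 * (z - ζ) ^ 3) := by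
      intro z hz
      have h1 := hE z hz
      have h2 := hζ z hz
      rw [hsq]
      field_simp
      linear_combination 4 * h1
    have hΨE : ∀ z ∈ I, Ψ z = A / (z - ζ) ^ 3 := by
      intro z hz
      rw [eq_div_iff (pow_ne_zero 3 (hζ z hz)), h z hz]
    refine Or.inr ⟨ζ, 4 * E / l, 2 / √l, A, by positivity, fun hmem => hζ ζ hmem (sub_self ζ),
      fun z hz => ⟨hρE z hz, hΨE z hz, ?_⟩⟩
    have h1 := hprod z hz
    have h2 := hζ z hz
    have h3 : A * ((z - ζ) ^ 4 + 4 * E / l) = Ψ z * ρ z * (4 / l) * (z - ζ) ^ 6 := by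
      rw [hρE z hz, hΨE z hz, hsq]
      field_simp
    rw [h3]
    have h4 : 0 < (z - ζ) ^ 6 := by
      rw [← (by decide : Even 6).pow_abs]
      exact pow_pos (abs_pos.2 h2) 6
    positivity

end

theorem IsMinimalPeriod.exists_int_mul {z : ℝ → ℝ} {τ T : ℝ} (h : IsMinimalPeriod z τ)
    (hp : Function.Periodic z T) : ∃ n : ℤ, T = n * τ := by
  obtain ⟨⟨hτ, hτp⟩, hmin⟩ := h
  refine ⟨⌊T / τ⌋, ?_⟩
  have hper : Function.Periodic z (T - ⌊T / τ⌋ * τ) := hp.sub_period (hτp.int_mul _)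
  have h1 : ⌊T / τ⌋ * τ ≤ T := (le_div_iff₀ hτ).1 (Int.floor_le _)
  have h2 : T < (⌊T / τ⌋ + 1) * τ := (div_lt_iff₀ hτ).1 (Int.lt_floor_add_one _)
  by_contra hne
  have h3 : 0 < T - ⌊T / τ⌋ * τ := sub_pos.2 (lt_of_le_of_ne h1 (Ne.symm hne))
  have := hmin ⟨h3, hper⟩
  linarith

theorem periodicCommensurable_of_minimalPeriod {S : Set (ℝ → ℝ)} {τ : ℝ}
    (h : ∀ z ∈ S, IsMinimalPeriod z τ) : PeriodicCommensurable S := by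
  refine ⟨fun z hz => ⟨τ, (h z hz).1⟩, fun z hz w hw T T' _ hp hT' hp' => ?_⟩
  have hτ := (h z hz).1.1
  obtain ⟨n, rfl⟩ := (h z hz).exists_int_mul hp
  obtain ⟨m, rfl⟩ := (h w hw).exists_int_mul hp'
  refine ⟨n / m, ?_⟩
  push_cast
  rw [mul_div_mul_right _ _ hτ.ne']

/-- Harmonic oscillations about `e / ν ^ 2`. -/
theorem harmonic_isMinimalPeriod {y v : ℝ → ℝ} {ν e : ℝ} (hν : 0 < ν)
    (hy : ∀ t, HasDerivAt y (v t) t) (hv : ∀ t, HasDerivAt v (e - ν ^ 2 * y t) t)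
    (hn : ¬ ∃ c, ∀ t, y t = c) : IsMinimalPeriod y (2 * π / ν) := by
  have hLip : LipschitzWith (Real.toNNReal (ν ^ 2)) fun x => ν ^ 2 * x - e := by
    apply LipschitzWith.of_dist_le_mul
    intro a b
    rw [Real.dist_eq, Real.dist_eq, coe_toNNReal _ (by positivity),
      show ν ^ 2 * a - e - (ν ^ 2 * b - e) = ν ^ 2 * (a - b) by ring, abs_mul,
      abs_of_pos (by positivity : 0 < ν ^ 2)]
  have ho : IsOrbit (fun x => ν ^ 2 * x - e) y v := ⟨hy, fun t => by simpa using hv t⟩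
  set P := y 0 - e / ν ^ 2 with hP
  set Q := v 0 / ν with hQ
  have ho' : IsOrbit (fun x => ν ^ 2 * x - e)
      (fun t => e / ν ^ 2 + (P * cos (ν * t) + Q * sin (ν * t)))
      (fun t => P * -(ν * sin (ν * t)) + Q * (ν * cos (ν * t))) := by
    constructor
    · intro t
      exact (((hasDerivAt_cos_mul ν t).const_mul P).add
        ((hasDerivAt_sin_mul ν t).const_mul Q)).const_add _
    · intro t
      refine ((((hasDerivAt_sin_mul ν t).const_mul ν).neg.const_mul P).add
        (((hasDerivAt_cos_mul ν t).const_mul ν).const_mul Q)).congr_deriv ?_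
      field_simp
      ring
  obtain ⟨hyeq, hveq⟩ := ho.unique hLip ho' (t₀ := 0) (by simp [hP])
    (by simp [hQ]; field_simp)
  have hPQ : 0 < P ^ 2 + Q ^ 2 := by
    by_contra hle
    have hP0 : P = 0 := by nlinarith [sq_nonneg P, sq_nonneg Q]
    have hQ0 : Q = 0 := by nlinarith [sq_nonneg P, sq_nonneg Q]
    exact hn ⟨e / ν ^ 2, fun t => by simp [hyeq, hP0, hQ0]⟩
  refine ⟨⟨by positivity, fun t => ?_⟩, ?_⟩
  · have : ν * (t + 2 * π / ν) = ν * t + 2 * π := by field_simp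
    simp only [hyeq, this, cos_add_two_pi, sin_add_two_pi]
  · rintro T ⟨hT, hp⟩
    have h1 := hp 0
    have h2 := ho.velocity_periodic hp 0
    simp only [hyeq, hveq, zero_add, mul_zero, cos_zero, sin_zero] at h1 h2
    have h3 : P * (cos (ν * T) - 1) + Q * sin (ν * T) = 0 := by linear_combination h1
    have h4 : Q * (cos (ν * T) - 1) - P * sin (ν * T) = 0 := by
      have : ν * (Q * (cos (ν * T) - 1) - P * sin (ν * T)) = 0 := by linear_combination h2
      exact (mul_eq_zero.1 this).resolve_left hν.ne'
    have h5 : (P ^ 2 + Q ^ 2) * (cos (ν * T) - 1) = 0 := by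
      linear_combination P * h3 + Q * h4
    have h6 : cos (ν * T) = 1 := by
      have := (mul_eq_zero.1 h5).resolve_left hPQ.ne'
      linarith
    obtain ⟨n, hn0, hn⟩ := exists_nat_of_cos_eq_one (mul_pos hν hT) h6
    have hnpos : 0 < (n : ℝ) := by
      have : 0 < (n : ℝ) * (2 * π) := hn ▸ mul_pos hν hT
      exact pos_of_mul_pos_left this (by positivity)
    have hn1 : (1 : ℝ) ≤ n := by exact_mod_cast Int.cast_pos.1 hnpos
    rw [div_le_iff₀ hν]
    nlinarith [pi_pos]

section

variable {I : Set ℝ} {ρ Ψ : ℝ → ℝ}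

theorem exists_affine_of_deriv_eq (hI : IsOpen I) (hIc : IsPreconnected I)
    (hρ : ContDiffOn ℝ ∞ ρ I) {c : ℝ} (h : ∀ z ∈ I, deriv ρ z = c) :
    ∃ d, ∀ z ∈ I, ρ z = c * z + d := by
  obtain ⟨d, hd⟩ := exists_const_of_deriv_eq_zero hI hIc (g := fun z => ρ z - c * z)
    (fun z hz => (hasDerivAt_of_contDiffOn hI hρ hz).sub ((hasDerivAt_id z).const_mul c))
    (fun z hz => by rw [h z hz]; ring)
  exact ⟨d, fun z hz => by linarith [hd z hz]⟩

theorem LinearForm.isMinimalPeriod (hI : IsOpen I) (hIc : IsPreconnected I)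
    (hρ : ContDiffOn ℝ ∞ ρ I) {c A K : ℝ} (h : LinearForm I ρ Ψ c A) {z : ℝ → ℝ}
    (hz : IsBddNonconstSolution I ρ Ψ K z) : IsMinimalPeriod z (2 * π / √c) := by
  obtain ⟨d, hd⟩ := exists_affine_of_deriv_eq hI hIc hρ fun z hz => (h.2 z hz).1
  refine harmonic_isMinimalPeriod (e := A / K ^ 2 - d) (sqrt_pos.2 h.1)
    (fun t => (hz.2.1.hasDerivAt (mem_univ t)).2.1) (fun t => ?_) hz.2.2.2
  obtain ⟨h1, -, h2⟩ := hz.2.1.hasDerivAt (mem_univ t)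
  refine h2.congr_deriv ?_
  rw [force, hd _ h1, (h.2 _ h1).2.1, sq_sqrt h.1.le]
  ring

theorem CubicForm.sub_ne_zero {ζ D μ A : ℝ} (h : CubicForm I ρ Ψ ζ D μ A) {z : ℝ} (hz : z ∈ I) :
    z - ζ ≠ 0 := by
  intro h0
  exact h.2.1 (sub_eq_zero.1 h0 ▸ hz)

theorem CubicForm.isMinimalPeriod {ζ D μ A K : ℝ} (h : CubicForm I ρ Ψ ζ D μ A) {z : ℝ → ℝ}
    (hz : IsBddNonconstSolution I ρ Ψ K z) : IsMinimalPeriod z (π * μ) := by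
  have hμ := h.1
  have hsol := fun t => hz.2.1.hasDerivAt (mem_univ t)
  set v := deriv z with hv
  set x : ℝ → ℝ := fun t => z t - ζ with hx
  have hx0 : ∀ t, x t ≠ 0 := fun t => h.sub_ne_zero (hsol t).1
  have hxd : ∀ t, HasDerivAt x (v t) t := fun t => (hsol t).2.1.sub_const ζ
  set B := D / μ ^ 2 - A / K ^ 2 with hB
  have hforce : ∀ t, force ρ Ψ K (z t) = x t / μ ^ 2 + B / x t ^ 3 := by
    intro t
    have h1 : z t - ζ ≠ 0 := hx0 t
    have h2 := hz.1
    obtain ⟨hρz, hΨz, -⟩ := h.2.2 _ (hsol t).1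
    rw [force, hρz, hΨz]
    simp only [hx, hB]
    field_simp
    ring
  have hvd : ∀ t, HasDerivAt v (-(x t / μ ^ 2 + B / x t ^ 3)) t := fun t =>
    hforce t ▸ (hsol t).2.2
  obtain ⟨E, hE⟩ := exists_const_of_deriv_eq_zero isOpen_univ isPreconnected_univ
    (g := fun t => v t ^ 2 + x t ^ 2 / μ ^ 2 - B / x t ^ 2)
    (fun t _ => (((hvd t).pow 2).add (((hxd t).pow 2).div_const (μ ^ 2))).sub
      ((hasDerivAt_const t B).div ((hxd t).pow 2) (pow_ne_zero 2 (hx0 t))))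
    (fun t _ => by
      have := hx0 t
      simp only [Pi.pow_apply]
      push_cast
      field_simp
      ring)
  have hsame : ∀ t t', 0 < x t * x t' := by
    intro t t'
    by_contra hle
    have hc : Continuous fun u => x u * x t' :=
      (continuous_iff_continuousAt.2 fun u => (hxd u).continuousAt).mul_const _
    obtain ⟨u, -, hu⟩ := isPreconnected_univ.intermediate_value (mem_univ t) (mem_univ t')
      hc.continuousOn (show (0 : ℝ) ∈ Icc _ _ from ⟨not_lt.1 hle, mul_self_nonneg _⟩)
    exact mul_ne_zero (hx0 u) (hx0 t') hu
  have hinj : ∀ t t', x t ^ 2 = x t' ^ 2 → z t = z t' := by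
    intro t t' heq
    have : (x t - x t') * (x t + x t') = 0 := by linear_combination heq
    rcases mul_eq_zero.1 this with h1 | h1
    · simp only [hx] at h1
      linarith
    · have h2 := hsame t t'
      have h3 : x t = -x t' := by linarith
      rw [h3] at h2
      nlinarith [sq_nonneg (x t')]
  have hyn : ¬ ∃ c, ∀ t, x t ^ 2 = c := by
    rintro ⟨c, hc⟩
    exact hz.2.2.2 ⟨z 0, fun t => hinj t 0 (by rw [hc, hc])⟩
  have hmin := harmonic_isMinimalPeriod (y := fun t => x t ^ 2) (v := fun t => 2 * (x t * v t))
    (ν := 2 / μ) (e := 2 * E) (by positivity)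
    (fun t => ((hxd t).pow 2).congr_deriv (by push_cast; ring))
    (fun t => (((hxd t).mul (hvd t)).const_mul 2).congr_deriv (by
      have h1 := hx0 t
      have h2 := hE t (mem_univ t)
      rw [← h2]
      field_simp
      ring)) hyn
  have hτ : 2 * π / (2 / μ) = π * μ := by field_simp
  rw [hτ] at hmin
  have hset : {T | 0 < T ∧ Function.Periodic z T}
      = {T | 0 < T ∧ Function.Periodic (fun t => x t ^ 2) T} := by
    ext T
    refine and_congr_right fun _ => ⟨fun hp t => ?_, fun hp t => hinj _ _ (hp t)⟩
    simp only [hx, hp t]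
  rw [IsMinimalPeriod, hset]
  exact hmin

theorem LinearForm.subset_stableSet (hI : IsOpen I) {c A : ℝ} (h : LinearForm I ρ Ψ c A) :
    I ⊆ stableSet I ρ Ψ := by
  intro z hz
  obtain ⟨h1, h2, h3⟩ := h.2 z hz
  have hρ0 : ρ z ≠ 0 := by rintro h0; simp [h0] at h3
  have hd : deriv Ψ z = 0 := by
    have : Ψ =ᶠ[𝓝 z] fun _ => A := by
      filter_upwards [hI.mem_nhds hz] with x hx using (h.2 x hx).2.1
    rw [this.deriv_eq, deriv_const]
  refine ⟨hz, ?_, ?_⟩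
  · rw [h2, show A / ρ z = A * ρ z / ρ z ^ 2 by field_simp]
    positivity
  · rw [stiffness, hd, h1, zero_mul, sub_zero]
    exact h.1

theorem CubicForm.subset_stableSet (hI : IsOpen I) (hρ : ContDiffOn ℝ ∞ ρ I)
    (hΨ : ContDiffOn ℝ ∞ Ψ I) {ζ D μ A : ℝ}
    (h : CubicForm I ρ Ψ ζ D μ A) : I ⊆ stableSet I ρ Ψ := by
  intro z hz
  have hμ := h.1
  have hu := h.sub_ne_zero hz
  obtain ⟨h1, h2, h3⟩ := h.2.2 z hz
  have hDz : (z - ζ) ^ 4 + D ≠ 0 := by rintro h0; simp [h0] at h3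
  have hA : A ≠ 0 := by rintro rfl; simp at h3
  have hratio : Ψ z / ρ z = μ ^ 2 * (A * ((z - ζ) ^ 4 + D)) / ((z - ζ) ^ 4 + D) ^ 2 := by
    rw [h1, h2]
    field_simp
  have hΨ0 : Ψ z ≠ 0 := by
    rw [h2]
    exact div_ne_zero hA (pow_ne_zero 3 hu)
  refine ⟨hz, by rw [hratio]; positivity, ?_⟩
  have hcube := ((hasDerivAt_id z).sub_const ζ).pow 3
  have e1 := ((hasDerivAt_of_contDiffOn hI hΨ hz).mul hcube).unique
    ((hasDerivAt_const z A).congr_of_eventuallyEq (by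
      filter_upwards [hI.mem_nhds hz] with x hx
      have := h.sub_ne_zero hx
      simp only [Pi.mul_apply, Pi.pow_apply, id, (h.2.2 x hx).2.1]
      field_simp))
  have e2 := (((hasDerivAt_of_contDiffOn hI hρ hz).mul hcube).const_mul (μ ^ 2)).unique
    ((((((hasDerivAt_id z).sub_const ζ).pow 4)).add_const D).congr_of_eventuallyEq (by
      filter_upwards [hI.mem_nhds hz] with x hx
      have := h.sub_ne_zero hx
      simp only [Pi.mul_apply, Pi.pow_apply, id, (h.2.2 x hx).1]
      field_simp))
  simp only [Pi.pow_apply, id] at e1 e2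
  push_cast at e1 e2
  have e3 : deriv Ψ z * (z - ζ) = -3 * Ψ z := by
    have : (z - ζ) ^ 2 * (deriv Ψ z * (z - ζ) + 3 * Ψ z) = 0 := by linear_combination e1
    have := (mul_eq_zero.1 this).resolve_left (pow_ne_zero 2 hu)
    linarith
  have e4 : stiffness ρ Ψ z = 4 / μ ^ 2 := by
    have : μ ^ 2 * (z - ζ) ^ 3 * (stiffness ρ Ψ z - 4 / μ ^ 2) = 0 := by
      rw [stiffness]
      field_simp
      linear_combination Ψ z * e2 - μ ^ 2 * (z - ζ) ^ 2 * ρ z * e3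
    have := (mul_eq_zero.1 this).resolve_left (by positivity)
    linarith
  rw [e4]
  positivity

/-- If all points are nondegenerate equilibria and all bounded solutions have the same minimal
period, then the function is closing in every sense. -/
theorem closing_of_minimalPeriod (hI : IsOpen I) (hord : I.OrdConnected) (hne : I.Nonempty)
    (hρ : ContDiffOn ℝ ∞ ρ I) (hΨ : ContDiffOn ℝ ∞ Ψ I) (hIS : I ⊆ stableSet I ρ Ψ) {τ : ℝ}
    (hτ : ∀ K z, IsBddNonconstSolution I ρ Ψ K z → IsMinimalPeriod z τ) :
    IsClosing I ρ Ψ ∧ IsSemilocallyClosing I ρ Ψ ∧ IsStronglyClosing I ρ Ψ ∧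
      IsWeaklyClosing I ρ Ψ := by
  have hnear : ∀ K₀ z₀, ClosesNear I ρ Ψ K₀ z₀ := fun K₀ z₀ =>
    ⟨1, 1, one_pos, one_pos, periodicCommensurable_of_minimalPeriod (τ := τ) (by
      rintro z ⟨K, -, hz, -⟩
      exact hτ K z hz)⟩
  have hnd : ∀ z₀ ∈ I, IsNondegStableEquilibrium I ρ Ψ (√(Ψ z₀ / ρ z₀)) z₀ := fun z₀ hz₀ =>
    isNondegStableEquilibrium_of_mem hI hρ hΨ (hIS hz₀) (sq_sqrt (hIS hz₀).2.1.le)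
  obtain ⟨z₀, hz₀⟩ := hne
  obtain ⟨w, hw, -⟩ := exists_bdd_solution_near hI hρ hΨ (hnd z₀ hz₀) one_pos
  refine ⟨⟨⟨_, w, hw⟩, periodicCommensurable_of_minimalPeriod (τ := τ) ?_⟩,
    ⟨⟨_, w, hw, periodicCommensurable_of_minimalPeriod (τ := τ) ?_⟩, fun _ _ _ => hnear _ _⟩,
    ⟨fun z hz => ⟨_, hnd z hz⟩, fun _ _ _ => hnear _ _⟩,
    ⟨fun z hz => ⟨_, (hnd z hz).isStable hI hord hρ hΨ⟩, fun _ _ _ => hnear _ _⟩⟩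
  · rintro z ⟨K, hz⟩
    exact hτ K z hz
  · rintro z ⟨hz, -⟩
    exact hτ _ z hz

theorem equilibria_of_mem_stableSet (hI : IsOpen I) (hρ : ContDiffOn ℝ ∞ ρ I)
    (hΨ : ContDiffOn ℝ ∞ Ψ I) (hρ0 : ∀ z ∈ I, ρ z ≠ 0) {z κ : ℝ} (hz : z ∈ stableSet I ρ Ψ)
    (hκ : κ ^ 2 = Ψ z / ρ z) :
    IsNondegStableEquilibrium I ρ Ψ κ z ∧ IsNondegStableEquilibrium I ρ Ψ (-κ) z ∧
      ∀ K, K ≠ κ → K ≠ -κ → ¬ IsEquilibrium I ρ Ψ K z := by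
  refine ⟨isNondegStableEquilibrium_of_mem hI hρ hΨ hz hκ,
    isNondegStableEquilibrium_of_mem hI hρ hΨ hz (by rw [neg_sq, hκ]), fun K h1 h2 h => ?_⟩
  rcases sq_eq_sq_iff_eq_or_eq_neg.1 ((h.sq_eq hρ0).trans hκ.symm) with h3 | h3
  · exact h1 h3
  · exact h2 h3

/-- Semilocally, fully, strongly and weakly closing functions are locally closing. -/
theorem isLocallyClosing_of_closing (hI : IsOpen I) (hord : I.OrdConnected) (hne : I.Nonempty)
    (hρ : ContDiffOn ℝ ∞ ρ I) (hΨ : ContDiffOn ℝ ∞ Ψ I)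
    (h : IsSemilocallyClosing I ρ Ψ ∨ IsClosing I ρ Ψ ∨ IsStronglyClosing I ρ Ψ ∨
      IsWeaklyClosing I ρ Ψ) : IsLocallyClosing I ρ Ψ := by
  have hsemi : IsSemilocallyClosing I ρ Ψ → IsLocallyClosing I ρ Ψ := by
    rintro ⟨⟨K, w, hw, hcomm⟩, hloc⟩
    obtain ⟨p, hp⟩ := exists_nondeg_of_semilocal hI hρ hΨ hw hcomm
    exact ⟨⟨K, p, hp⟩, hloc⟩
  rcases h with h | ⟨⟨K, w, hw⟩, hcomm⟩ | ⟨hex, hloc⟩ | ⟨hex, hloc⟩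
  · exact hsemi h
  · refine hsemi ⟨⟨K, w, hw, hcomm.mono fun z hz => ⟨K, hz.1⟩⟩, fun K₀ z₀ _ =>
      ⟨1, 1, one_pos, one_pos, hcomm.mono ?_⟩⟩
    rintro z ⟨K, -, hz, -⟩
    exact ⟨K, hz⟩
  · obtain ⟨z₀, hz₀⟩ := hne
    obtain ⟨K₀, hK₀⟩ := hex z₀ hz₀
    exact ⟨⟨K₀, z₀, hK₀⟩, hloc⟩
  · exact ⟨exists_nondeg_of_forall_stable hI hne hρ hΨ hex, fun K₀ z₀ h =>
      hloc K₀ z₀ (h.isStable hI hord hρ hΨ)⟩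

theorem LinearForm.closing (hI : IsOpen I) (hord : I.OrdConnected) (hne : I.Nonempty)
    (hρ : ContDiffOn ℝ ∞ ρ I) (hΨ : ContDiffOn ℝ ∞ Ψ I) {c A : ℝ} (h : LinearForm I ρ Ψ c A) :
    IsClosing I ρ Ψ ∧ IsSemilocallyClosing I ρ Ψ ∧ IsStronglyClosing I ρ Ψ ∧
      IsWeaklyClosing I ρ Ψ :=
  closing_of_minimalPeriod hI hord hne hρ hΨ (h.subset_stableSet hI)
    fun _ _ hz => h.isMinimalPeriod hI hord.isPreconnected hρ hz

theorem CubicForm.closing (hI : IsOpen I) (hord : I.OrdConnected) (hne : I.Nonempty)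
    (hρ : ContDiffOn ℝ ∞ ρ I) (hΨ : ContDiffOn ℝ ∞ Ψ I) {ζ D μ A : ℝ}
    (h : CubicForm I ρ Ψ ζ D μ A) :
    IsClosing I ρ Ψ ∧ IsSemilocallyClosing I ρ Ψ ∧ IsStronglyClosing I ρ Ψ ∧
      IsWeaklyClosing I ρ Ψ :=
  closing_of_minimalPeriod hI hord hne hρ hΨ (h.subset_stableSet hI hρ hΨ)
    fun _ _ hz => h.isMinimalPeriod hz

theorem LinearForm.contDiffOn {c A : ℝ} (h : LinearForm I ρ Ψ c A) : ContDiffOn ℝ ∞ Ψ I :=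
  contDiffOn_const.congr fun z hz => (h.2 z hz).2.1

theorem CubicForm.contDiffOn {ζ D μ A : ℝ} (h : CubicForm I ρ Ψ ζ D μ A) :
    ContDiffOn ℝ ∞ Ψ I :=
  (contDiffOn_const.div ((contDiffOn_id.sub contDiffOn_const).pow 3)
    fun _ hz => pow_ne_zero 3 (h.sub_ne_zero hz)).congr fun z hz => (h.2.2 z hz).2.1

theorem IsSmoothClosing.form (hI : IsOpen I) (hord : I.OrdConnected) (hne : I.Nonempty)
    (hρ : ContDiffOn ℝ ∞ ρ I) (hρ0 : ∀ z ∈ I, ρ z ≠ 0) (h : IsSmoothClosing I ρ Ψ) :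
    (∃ c A, LinearForm I ρ Ψ c A) ∨ ∃ ζ D μ A, CubicForm I ρ Ψ ζ D μ A :=
  (isLocallyClosing_of_closing hI hord hne hρ h.1 (Or.inr (Or.inl h.2))).form hI
    hord.isPreconnected hρ h.1 hρ0

theorem polynomial_eval_eq_zero (hI : IsOpen I) (hne : I.Nonempty) {p : Polynomial ℝ}
    (h : ∀ z ∈ I, p.eval z = 0) (z : ℝ) : p.eval z = 0 := by
  have hinf : I.Infinite := by
    obtain ⟨x, hx⟩ := hne
    exact infinite_of_mem_nhds x (hI.mem_nhds hx)
  rw [Polynomial.eq_zero_of_infinite_isRoot p (hinf.mono fun z hz => h z hz), Polynomial.eval_zero]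

/-- The form `((z - ζ) ^ 4 + D) / (μ ^ 2 (z - ζ) ^ 3)` determines `ζ`. -/
theorem rational_form_unique (hI : IsOpen I) (hne : I.Nonempty) {ζ D μ ζ' D' μ' : ℝ} (hμ : 0 < μ)
    (hμ' : 0 < μ') (hζ : ζ ∉ I) (hζ' : ζ' ∉ I)
    (h : ∀ z ∈ I, ((z - ζ) ^ 4 + D) / (μ ^ 2 * (z - ζ) ^ 3)
      = ((z - ζ') ^ 4 + D') / (μ' ^ 2 * (z - ζ') ^ 3)) : ζ = ζ' := by
  have hsub : ∀ {ξ : ℝ}, ξ ∉ I → ∀ z ∈ I, z - ξ ≠ 0 := fun hξ z hz h0 =>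
    hξ (sub_eq_zero.1 h0 ▸ hz)
  have key : ∀ z : ℝ, ((z - ζ) ^ 4 + D) * (μ' ^ 2 * (z - ζ') ^ 3)
      = ((z - ζ') ^ 4 + D') * (μ ^ 2 * (z - ζ) ^ 3) := by
    intro z
    have := polynomial_eval_eq_zero hI hne (p := ((Polynomial.X - Polynomial.C ζ) ^ 4
      + Polynomial.C D) * (Polynomial.C (μ' ^ 2) * (Polynomial.X - Polynomial.C ζ') ^ 3)
      - ((Polynomial.X - Polynomial.C ζ') ^ 4 + Polynomial.C D')
        * (Polynomial.C (μ ^ 2) * (Polynomial.X - Polynomial.C ζ) ^ 3)) (fun z hz => by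
        have h1 := h z hz
        have h2 := hsub hζ z hz
        have h3 := hsub hζ' z hz
        rw [div_eq_div_iff (by positivity) (by positivity)] at h1
        simp only [Polynomial.eval_sub, Polynomial.eval_mul, Polynomial.eval_add,
          Polynomial.eval_pow, Polynomial.eval_X, Polynomial.eval_C]
        linear_combination h1) z
    simp only [Polynomial.eval_sub, Polynomial.eval_mul, Polynomial.eval_add,
      Polynomial.eval_pow, Polynomial.eval_X, Polynomial.eval_C] at this
    linear_combination this
  by_cases hD : D = 0
  · by_cases hD' : D' = 0
    · have := polynomial_eval_eq_zero hI hne (p := (Polynomial.X - Polynomial.C ζ)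
        * Polynomial.C (μ' ^ 2) - (Polynomial.X - Polynomial.C ζ') * Polynomial.C (μ ^ 2))
        (fun z hz => by
          have h1 := key z
          have h2 := hsub hζ z hz
          have h3 := hsub hζ' z hz
          simp only [Polynomial.eval_sub, Polynomial.eval_mul, Polynomial.eval_X,
            Polynomial.eval_C]
          have h4 : ((z - ζ) ^ 3 * (z - ζ') ^ 3)
              * ((z - ζ) * μ' ^ 2 - (z - ζ') * μ ^ 2) = 0 := by
            rw [hD, hD'] at h1
            linear_combination h1
          exact (mul_eq_zero.1 h4).resolve_left (by positivity)) ζ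
      simp only [Polynomial.eval_sub, Polynomial.eval_mul, Polynomial.eval_X, Polynomial.eval_C,
        sub_self, zero_mul, zero_sub, neg_eq_zero, mul_eq_zero] at this
      exact sub_eq_zero.1 (this.resolve_right (by positivity))
    · have h1 := key ζ'
      simp only [sub_self, ne_eq, OfNat.ofNat_ne_zero, not_false_eq_true, zero_pow, mul_zero,
        zero_add] at h1
      have h2 := (mul_eq_zero.1 h1.symm).resolve_left hD'
      have h3 := (mul_eq_zero.1 h2).resolve_left (by positivity)
      exact (sub_eq_zero.1 (pow_eq_zero_iff (by norm_num) |>.1 h3)).symm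
  · have h1 := key ζ
    simp only [sub_self, ne_eq, OfNat.ofNat_ne_zero, not_false_eq_true, zero_pow, mul_zero,
      zero_add] at h1
    have h2 := (mul_eq_zero.1 h1).resolve_left hD
    have h3 := (mul_eq_zero.1 h2).resolve_left (by positivity)
    exact sub_eq_zero.1 (pow_eq_zero_iff (by norm_num) |>.1 h3)

theorem rational_form_affine (hI : IsOpen I) (hne : I.Nonempty) {ζ D μ c d : ℝ} (hμ : 0 < μ)
    (hζ : ζ ∉ I)
    (h : ∀ z ∈ I, ((z - ζ) ^ 4 + D) / (μ ^ 2 * (z - ζ) ^ 3) = c * z + d) : D = 0 := by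
  have := polynomial_eval_eq_zero hI hne (p := ((Polynomial.X - Polynomial.C ζ) ^ 4
    + Polynomial.C D) - (Polynomial.C c * Polynomial.X + Polynomial.C d)
      * (Polynomial.C (μ ^ 2) * (Polynomial.X - Polynomial.C ζ) ^ 3)) (fun z hz => by
      have h1 := h z hz
      have h2 : z - ζ ≠ 0 := fun h0 => hζ (sub_eq_zero.1 h0 ▸ hz)
      rw [div_eq_iff (by positivity)] at h1
      simp only [Polynomial.eval_sub, Polynomial.eval_mul, Polynomial.eval_add,
        Polynomial.eval_pow, Polynomial.eval_X, Polynomial.eval_C]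
      linear_combination h1) ζ
  simpa using this

theorem posProportional_of_eq_mul (hne : I.Nonempty) {Ψ₁ Ψ₂ g : ℝ → ℝ} {A₁ A₂ : ℝ}
    (h₁ : I ⊆ stableSet I ρ Ψ₁) (h₂ : I ⊆ stableSet I ρ Ψ₂) (e₁ : ∀ z ∈ I, Ψ₁ z = A₁ * g z)
    (e₂ : ∀ z ∈ I, Ψ₂ z = A₂ * g z) : PosProportional I Ψ₁ Ψ₂ := by
  obtain ⟨z, hz⟩ := hne
  have p₁ := (h₁ hz).2.1
  have p₂ := (h₂ hz).2.1
  obtain ⟨hρ0, hΨ0⟩ := ne_zero_of_mem_stableSet (h₂ hz)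
  have hA₂ : A₂ ≠ 0 := by
    rintro rfl
    exact hΨ0 (by rw [e₂ z hz, zero_mul])
  have hg : g z ≠ 0 := by
    intro h0
    exact hΨ0 (by rw [e₂ z hz, h0, mul_zero])
  refine ⟨A₁ / A₂, ?_, fun x hx => ?_⟩
  · have := div_pos p₁ p₂
    rw [e₁ z hz, e₂ z hz] at this
    have he : A₁ * g z / ρ z / (A₂ * g z / ρ z) = A₁ / A₂ := by field_simp
    rwa [he] at this
  · rw [e₁ x hx, e₂ x hx]
    field_simp

theorem LinearForm.posProportional (hI : IsOpen I) (hne : I.Nonempty) {Ψ₁ Ψ₂ : ℝ → ℝ}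
    {c₁ c₂ A₁ A₂ : ℝ} (h₁ : LinearForm I ρ Ψ₁ c₁ A₁) (h₂ : LinearForm I ρ Ψ₂ c₂ A₂) :
    PosProportional I Ψ₁ Ψ₂ :=
  posProportional_of_eq_mul hne (g := fun _ => 1) (h₁.subset_stableSet hI)
    (h₂.subset_stableSet hI) (fun z hz => by rw [(h₁.2 z hz).2.1, mul_one])
    (fun z hz => by rw [(h₂.2 z hz).2.1, mul_one])

theorem CubicForm.posProportional (hI : IsOpen I) (hne : I.Nonempty) (hρ : ContDiffOn ℝ ∞ ρ I)
    {Ψ₁ Ψ₂ : ℝ → ℝ} {ζ₁ ζ₂ D₁ D₂ μ₁ μ₂ A₁ A₂ : ℝ} (h₁ : CubicForm I ρ Ψ₁ ζ₁ D₁ μ₁ A₁)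
    (h₂ : CubicForm I ρ Ψ₂ ζ₂ D₂ μ₂ A₂) : PosProportional I Ψ₁ Ψ₂ := by
  obtain rfl := rational_form_unique hI hne h₁.1 h₂.1 h₁.2.1 h₂.2.1 fun z hz => by
    rw [← (h₁.2.2 z hz).1, ← (h₂.2.2 z hz).1]
  exact posProportional_of_eq_mul hne (g := fun z => ((z - ζ₁) ^ 3)⁻¹)
    (h₁.subset_stableSet hI hρ h₁.contDiffOn) (h₂.subset_stableSet hI hρ h₂.contDiffOn)
    (fun z hz => by rw [(h₁.2.2 z hz).2.1, div_eq_mul_inv])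
    (fun z hz => by rw [(h₂.2.2 z hz).2.1, div_eq_mul_inv])

theorem CubicForm.eq_affine_of_zero {ζ μ A : ℝ} (h : CubicForm I ρ Ψ ζ 0 μ A) {z : ℝ}
    (hz : z ∈ I) : ρ z = (z - ζ) / μ ^ 2 := by
  have h1 := h.sub_ne_zero hz
  have h2 := h.1
  rw [(h.2.2 z hz).1]
  field_simp
  ring

end

section

variable {I : Set ℝ} {ρ Ψ : ℝ → ℝ}

theorem mul_pos_of_ne_zero (hIc : IsPreconnected I) (hρ : ContDiffOn ℝ ∞ ρ I)
    (hρ0 : ∀ z ∈ I, ρ z ≠ 0) {z z' : ℝ} (hz : z ∈ I) (hz' : z' ∈ I) : 0 < ρ z * ρ z' := by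
  by_contra hle
  obtain ⟨u, hu, hu0⟩ := hIc.intermediate_value hz hz'
    (f := fun x => ρ x * ρ z') (hρ.continuousOn.mul continuousOn_const)
    (show (0 : ℝ) ∈ Icc _ _ from ⟨not_lt.1 hle, mul_self_nonneg _⟩)
  exact mul_ne_zero (hρ0 u hu) (hρ0 z' hz') hu0

theorem linearForm_iff {c : ℝ} (hc : 0 < c) (hρ' : ∀ z ∈ I, deriv ρ z = c) {A : ℝ} :
    LinearForm I ρ Ψ c A ↔ (∀ z ∈ I, 0 < A * ρ z ^ 1) ∧ ∀ z ∈ I, Ψ z = A / ρ z ^ (1 ^ 2 - 1) := by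
  simp only [LinearForm, pow_one, one_pow, tsub_self, pow_zero, div_one]
  exact ⟨fun h => ⟨fun z hz => (h.2 z hz).2.2, fun z hz => (h.2 z hz).2.1⟩,
    fun h => ⟨hc, fun z hz => ⟨hρ' z hz, h.2 z hz, h.1 z hz⟩⟩⟩

theorem exists_cubicForm_of_affine (hI : IsOpen I) (hIc : IsPreconnected I)
    (hρ : ContDiffOn ℝ ∞ ρ I) (hρ0 : ∀ z ∈ I, ρ z ≠ 0) {c : ℝ} (hc : 0 < c)
    (hρ' : ∀ z ∈ I, deriv ρ z = c) {A : ℝ} (hA : ∀ z ∈ I, 0 < A * ρ z ^ 2)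
    (hΨ : ∀ z ∈ I, Ψ z = A / ρ z ^ (2 ^ 2 - 1)) :
    ∃ ζ, CubicForm I ρ Ψ ζ 0 (1 / √c) (A / c ^ 3) := by
  obtain ⟨d, hd⟩ := exists_affine_of_deriv_eq hI hIc hρ hρ'
  have hd' : ∀ z ∈ I, ρ z = c * (z - -d / c) := by
    intro z hz
    rw [hd z hz]
    field_simp
    ring
  have hsq : (1 / √c) ^ 2 = 1 / c := by rw [div_pow, sq_sqrt hc.le, one_pow]
  refine ⟨-d / c, by positivity, fun hmem => hρ0 _ hmem (by rw [hd' _ hmem]; simp),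
    fun z hz => ?_⟩
  have h0 := hρ0 z hz
  have h1 := hA z hz
  have h2 := hΨ z hz
  rw [hd' z hz] at h0 h1 h2
  have hu : z - -d / c ≠ 0 := right_ne_zero_of_mul h0
  refine ⟨?_, ?_, ?_⟩
  · rw [hd' z hz, hsq, add_zero]
    generalize z - -d / c = u at hu ⊢
    field_simp
  · rw [h2, show (2 ^ 2 - 1 : ℕ) = 3 from rfl, mul_pow, div_div]
  · generalize z - -d / c = u at hu h1 ⊢
    have : A / c ^ 3 * (u ^ 4 + 0) = A * (c * u) ^ 2 * (u ^ 2 / c ^ 5) := by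
      field_simp
      ring
    rw [this]
    positivity

theorem CubicForm.pow_form {ζ μ A : ℝ} (h : CubicForm I ρ Ψ ζ 0 μ A) (hne : I.Nonempty) :
    A / (μ ^ 2) ^ 3 ≠ 0 ∧ (∀ z ∈ I, 0 < A / (μ ^ 2) ^ 3 * ρ z ^ 2) ∧
      ∀ z ∈ I, Ψ z = A / (μ ^ 2) ^ 3 / ρ z ^ (2 ^ 2 - 1) := by
  have hμ := h.1
  have hpos : ∀ z ∈ I, 0 < A / (μ ^ 2) ^ 3 * ρ z ^ 2 := by
    intro z hz
    have h1 := h.sub_ne_zero hz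
    have h2 := (h.2.2 z hz).2.2
    rw [h.eq_affine_of_zero hz]
    have : A / (μ ^ 2) ^ 3 * ((z - ζ) / μ ^ 2) ^ 2
        = A * ((z - ζ) ^ 4 + 0) / (μ ^ 10 * (z - ζ) ^ 2) := by
      field_simp
      ring
    rw [this]
    positivity
  refine ⟨?_, hpos, fun z hz => ?_⟩
  · obtain ⟨z, hz⟩ := hne
    exact left_ne_zero_of_mul (hpos z hz).ne'
  · have h1 := h.sub_ne_zero hz
    rw [(h.2.2 z hz).2.1, h.eq_affine_of_zero hz,
      show (2 ^ 2 - 1 : ℕ) = 3 from rfl]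
    field_simp

theorem isSmoothClosing_iff_of_affine (hI : IsOpen I) (hord : I.OrdConnected) (hne : I.Nonempty)
    (hρ : ContDiffOn ℝ ∞ ρ I) (hρ0 : ∀ z ∈ I, ρ z ≠ 0) {c : ℝ} (hc : 0 < c)
    (hρ' : ∀ z ∈ I, deriv ρ z = c) (Ψ : ℝ → ℝ) :
    IsSmoothClosing I ρ Ψ ↔ ∃ i : ℕ, (i = 1 ∨ i = 2) ∧ ∃ A : ℝ, A ≠ 0 ∧
      (∀ z ∈ I, 0 < A * ρ z ^ i) ∧ ∀ z ∈ I, Ψ z = A / ρ z ^ (i ^ 2 - 1) := by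
  constructor
  · intro h
    rcases h.form hI hord hne hρ hρ0 with ⟨c', A, hf⟩ | ⟨ζ, D, μ, A, hf⟩
    · obtain ⟨z, hz⟩ := hne
      obtain rfl : c' = c := by rw [← (hf.2 z hz).1, hρ' z hz]
      exact ⟨1, Or.inl rfl, A, left_ne_zero_of_mul (hf.2 z hz).2.2.ne', (linearForm_iff hc hρ').1 hf⟩
    · obtain ⟨d, hd⟩ := exists_affine_of_deriv_eq hI hord.isPreconnected hρ hρ'
      obtain rfl := rational_form_affine hI hne hf.1 hf.2.1 fun z hz => by
        rw [← (hf.2.2 z hz).1, hd z hz]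
      exact ⟨2, Or.inr rfl, _, hf.pow_form hne⟩
  · rintro ⟨i, rfl | rfl, A, hA, hpos, hΨ⟩
    · have hf := (linearForm_iff hc hρ').2 ⟨hpos, hΨ⟩
      exact ⟨hf.contDiffOn, (hf.closing hI hord hne hρ hf.contDiffOn).1⟩
    · obtain ⟨ζ, hf⟩ := exists_cubicForm_of_affine hI hord.isPreconnected hρ hρ0 hc hρ' hpos hΨ
      exact ⟨hf.contDiffOn, (hf.closing hI hord hne hρ hf.contDiffOn).1⟩

theorem not_posProportional_const_cubic (hI : IsOpen I) (hne : I.Nonempty)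
    (hρ : ContDiffOn ℝ ∞ ρ I) (hρ0 : ∀ z ∈ I, ρ z ≠ 0) {c : ℝ} (hc : 0 < c)
    (hρ' : ∀ z ∈ I, deriv ρ z = c) {A : ℝ} (hA : A ≠ 0) {B : ℝ} :
    ¬ PosProportional I (fun _ => A) (fun z => B / ρ z ^ 3) := by
  rintro ⟨k, hk, h⟩
  obtain ⟨z, hz⟩ := hne
  have hev : (fun z => ρ z ^ 3) =ᶠ[𝓝 z] fun _ => k * B / A := by
    filter_upwards [hI.mem_nhds hz] with x hx
    have h1 := h x hx
    have h2 := hρ0 x hx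
    field_simp at h1 ⊢
    linear_combination h1
  have := (((hasDerivAt_of_contDiffOn hI hρ hz).pow 3).congr_of_eventuallyEq
    (EventuallyEq.refl _ (fun z => ρ z ^ 3))).unique
    ((hasDerivAt_const z (k * B / A)).congr_of_eventuallyEq hev)
  rw [hρ' z hz] at this
  have h3 := hρ0 z hz
  push_cast at this
  have h4 : 3 * ρ z ^ 2 * c ≠ 0 := by positivity
  exact h4 (by simpa using this)

theorem linear_case_solutions (hI : IsOpen I) (hord : I.OrdConnected)
    (hρ : ContDiffOn ℝ ∞ ρ I) (hρ0 : ∀ z ∈ I, ρ z ≠ 0) {c : ℝ} (hc : 0 < c)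
    (hρ' : ∀ z ∈ I, deriv ρ z = c) {i : ℕ} (hi : i = 1 ∨ i = 2) {A : ℝ}
    (hpos : ∀ z ∈ I, 0 < A * ρ z ^ i) (hΨ : ∀ z ∈ I, Ψ z = A / ρ z ^ (i ^ 2 - 1)) :
    (∀ (K : ℝ) (z : ℝ → ℝ), IsBddNonconstSolution I ρ Ψ K z →
      IsMinimalPeriod z (2 * π / (i * √c))) ∧
    ∀ z ∈ I, IsNondegStableEquilibrium I ρ Ψ (√(A / ρ z ^ (i ^ 2))) z ∧
      IsNondegStableEquilibrium I ρ Ψ (-√(A / ρ z ^ (i ^ 2))) z ∧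
      ∀ K : ℝ, K ≠ √(A / ρ z ^ (i ^ 2)) → K ≠ -√(A / ρ z ^ (i ^ 2)) →
        ¬ IsEquilibrium I ρ Ψ K z := by
  have hratio : ∀ z ∈ I, A / ρ z ^ (i ^ 2) = Ψ z / ρ z := by
    intro z hz
    have h0 := hρ0 z hz
    rw [hΨ z hz, div_div]
    congr 1
    rcases hi with rfl | rfl <;> ring
  have hconc : ContDiffOn ℝ ∞ Ψ I → I ⊆ stableSet I ρ Ψ → ∀ z ∈ I,
      IsNondegStableEquilibrium I ρ Ψ (√(A / ρ z ^ (i ^ 2))) z ∧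
      IsNondegStableEquilibrium I ρ Ψ (-√(A / ρ z ^ (i ^ 2))) z ∧
      ∀ K : ℝ, K ≠ √(A / ρ z ^ (i ^ 2)) → K ≠ -√(A / ρ z ^ (i ^ 2)) →
        ¬ IsEquilibrium I ρ Ψ K z := by
    intro hs hIS z hz
    rw [hratio z hz]
    exact equilibria_of_mem_stableSet hI hρ hs hρ0 (hIS hz) (sq_sqrt (hIS hz).2.1.le)
  rcases hi with rfl | rfl
  · have hf := (linearForm_iff hc hρ').2 ⟨hpos, hΨ⟩
    refine ⟨fun K z hz => ?_, hconc hf.contDiffOn (hf.subset_stableSet hI)⟩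
    simpa using hf.isMinimalPeriod hI hord.isPreconnected hρ hz
  · obtain ⟨ζ, hf⟩ := exists_cubicForm_of_affine hI hord.isPreconnected hρ hρ0 hc hρ' hpos hΨ
    refine ⟨fun K z hz => ?_, hconc hf.contDiffOn (hf.subset_stableSet hI hρ hf.contDiffOn)⟩
    have h1 := hf.isMinimalPeriod hz
    have h2 : π * (1 / √c) = 2 * π / ((2 : ℕ) * √c) := by
      push_cast
      field_simp
    rwa [h2] at h1

theorem HasRationalForm.cubicForm {ζ D μ : ℝ} (h : HasRationalForm I ρ ζ D μ) {A : ℝ}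
    (hpos : ∀ z ∈ I, 0 < A * ((z - ζ) ^ 4 + D)) (hΨ : ∀ z ∈ I, Ψ z = A / (z - ζ) ^ 3) :
    CubicForm I ρ Ψ ζ D μ A :=
  ⟨h.2.1, h.2.2.1, fun z hz => ⟨h.2.2.2 z hz, hΨ z hz, hpos z hz⟩⟩

theorem isSmoothClosing_iff_of_rational (hI : IsOpen I) (hord : I.OrdConnected)
    (hne : I.Nonempty) (hρ : ContDiffOn ℝ ∞ ρ I) (hρ0 : ∀ z ∈ I, ρ z ≠ 0) {ζ D μ : ℝ}
    (h : HasRationalForm I ρ ζ D μ) (Ψ : ℝ → ℝ) :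
    IsSmoothClosing I ρ Ψ ↔ ∃ A : ℝ, A ≠ 0 ∧ (∀ z ∈ I, 0 < A * ((z - ζ) ^ 4 + D)) ∧
      ∀ z ∈ I, Ψ z = A / (z - ζ) ^ 3 := by
  obtain ⟨hD, hμ, hζ, hform⟩ := h
  constructor
  · intro hcl
    rcases hcl.form hI hord hne hρ hρ0 with ⟨c, A, hf⟩ | ⟨ζ', D', μ', A, hf⟩
    · obtain ⟨d, hd⟩ := exists_affine_of_deriv_eq hI hord.isPreconnected hρ
        fun z hz => (hf.2 z hz).1
      exact absurd (rational_form_affine hI hne hμ hζ fun z hz => by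
        rw [← hform z hz, hd z hz]) hD
    · obtain rfl := rational_form_unique hI hne hμ hf.1 hζ hf.2.1 fun z hz => by
        rw [← hform z hz, ← (hf.2.2 z hz).1]
      have hpos : ∀ z ∈ I, 0 < A * ((z - ζ) ^ 4 + D) := by
        intro z hz
        have h1 := hf.sub_ne_zero hz
        have h2 := (hf.subset_stableSet hI hρ hcl.1 hz).2.1
        have h3 := hρ0 z hz
        have h4 : A * ((z - ζ) ^ 4 + D) = Ψ z / ρ z * (ρ z ^ 2 * μ ^ 2 * ((z - ζ) ^ 3) ^ 2) := by
          have h5 : (z - ζ) ^ 4 + D = ρ z * (μ ^ 2 * (z - ζ) ^ 3) := by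
            rw [hform z hz]
            field_simp
          rw [h5, (hf.2.2 z hz).2.1]
          field_simp
        rw [h4]
        positivity
      obtain ⟨z, hz⟩ := hne
      exact ⟨A, left_ne_zero_of_mul (hpos z hz).ne', hpos, fun z hz => (hf.2.2 z hz).2.1⟩
  · rintro ⟨A, hA, hpos, hΨ⟩
    have hf : CubicForm I ρ Ψ ζ D μ A :=
      HasRationalForm.cubicForm ⟨hD, hμ, hζ, hform⟩ hpos hΨ
    exact ⟨hf.contDiffOn, (hf.closing hI hord hne hρ hf.contDiffOn).1⟩

theorem HasRationalForm.exists_const (hIc : IsPreconnected I) (hne : I.Nonempty)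
    (hρ0 : ∀ z ∈ I, ρ z ≠ 0) {ζ D μ : ℝ} (h : HasRationalForm I ρ ζ D μ) :
    ∃ A, ∀ z ∈ I, 0 < A * ((z - ζ) ^ 4 + D) := by
  obtain ⟨z₀, hz₀⟩ := hne
  refine ⟨(z₀ - ζ) ^ 4 + D, fun z hz => ?_⟩
  rw [mul_comm]
  refine mul_pos_of_ne_zero (ρ := fun z => (z - ζ) ^ 4 + D) hIc
    (((contDiff_id.sub contDiff_const).pow 4).add contDiff_const).contDiffOn
    (fun z hz h0 => hρ0 z hz ?_) hz hz₀
  rw [h.2.2.2 z hz, h0, zero_div]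

theorem CubicForm.equilibria (hI : IsOpen I) (hρ : ContDiffOn ℝ ∞ ρ I)
    (hρ0 : ∀ z ∈ I, ρ z ≠ 0) {ζ D μ A : ℝ} (hf : CubicForm I ρ Ψ ζ D μ A) {z : ℝ} (hz : z ∈ I) :
    IsNondegStableEquilibrium I ρ Ψ (μ * √(A / ((z - ζ) ^ 4 + D))) z ∧
      IsNondegStableEquilibrium I ρ Ψ (-(μ * √(A / ((z - ζ) ^ 4 + D)))) z ∧
      ∀ K : ℝ, K ≠ μ * √(A / ((z - ζ) ^ 4 + D)) → K ≠ -(μ * √(A / ((z - ζ) ^ 4 + D))) →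
        ¬ IsEquilibrium I ρ Ψ K z := by
  refine equilibria_of_mem_stableSet hI hρ hf.contDiffOn hρ0
    (hf.subset_stableSet hI hρ hf.contDiffOn hz) ?_
  obtain ⟨h1, h2, h3⟩ := hf.2.2 z hz
  have hu := hf.sub_ne_zero hz
  have hμ := hf.1
  have hE : (z - ζ) ^ 4 + D ≠ 0 := by rintro h0; simp [h0] at h3
  have hnn : 0 ≤ A / ((z - ζ) ^ 4 + D) := by
    rw [show A / ((z - ζ) ^ 4 + D) = A * ((z - ζ) ^ 4 + D) / ((z - ζ) ^ 4 + D) ^ 2 by field_simp]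
    positivity
  rw [mul_pow, sq_sqrt hnn, h1, h2]
  field_simp

theorem posProportional_of_three (hI : IsOpen I) (hord : I.OrdConnected) (hne : I.Nonempty)
    (hρ : ContDiffOn ℝ ∞ ρ I) (hρ0 : ∀ z ∈ I, ρ z ≠ 0) {Ψ₁ Ψ₂ Ψ₃ : ℝ → ℝ}
    (h₁ : IsSmoothClosing I ρ Ψ₁) (h₂ : IsSmoothClosing I ρ Ψ₂) (h₃ : IsSmoothClosing I ρ Ψ₃) :
    PosProportional I Ψ₁ Ψ₂ ∨ PosProportional I Ψ₁ Ψ₃ ∨ PosProportional I Ψ₂ Ψ₃ := by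
  rcases h₁.form hI hord hne hρ hρ0 with ⟨c₁, A₁, f₁⟩ | ⟨ζ₁, D₁, μ₁, A₁, f₁⟩ <;>
  rcases h₂.form hI hord hne hρ hρ0 with ⟨c₂, A₂, f₂⟩ | ⟨ζ₂, D₂, μ₂, A₂, f₂⟩ <;>
  rcases h₃.form hI hord hne hρ hρ0 with ⟨c₃, A₃, f₃⟩ | ⟨ζ₃, D₃, μ₃, A₃, f₃⟩
  · exact Or.inl (f₁.posProportional hI hne f₂)
  · exact Or.inl (f₁.posProportional hI hne f₂)
  · exact Or.inr (Or.inl (f₁.posProportional hI hne f₃))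
  · exact Or.inr (Or.inr (f₂.posProportional hI hne hρ f₃))
  · exact Or.inr (Or.inr (f₂.posProportional hI hne f₃))
  · exact Or.inr (Or.inl (f₁.posProportional hI hne hρ f₃))
  · exact Or.inl (f₁.posProportional hI hne hρ f₂)
  · exact Or.inl (f₁.posProportional hI hne hρ f₂)

theorem IsLocallyClosing.closing (hI : IsOpen I) (hord : I.OrdConnected) (hne : I.Nonempty)
    (hρ : ContDiffOn ℝ ∞ ρ I) (hΨ : ContDiffOn ℝ ∞ Ψ I) (hρ0 : ∀ z ∈ I, ρ z ≠ 0)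
    (h : IsLocallyClosing I ρ Ψ) :
    IsClosing I ρ Ψ ∧ IsSemilocallyClosing I ρ Ψ ∧ IsStronglyClosing I ρ Ψ ∧
      IsWeaklyClosing I ρ Ψ := by
  rcases h.form hI hord.isPreconnected hρ hΨ hρ0 with ⟨c, A, hf⟩ | ⟨ζ, D, μ, A, hf⟩
  · exact hf.closing hI hord hne hρ hΨ
  · exact hf.closing hI hord hne hρ hΨ

theorem CubicForm.deriv_eq (hI : IsOpen I) {ζ μ A : ℝ} (h : CubicForm I ρ Ψ ζ 0 μ A) {z : ℝ}
    (hz : z ∈ I) : deriv ρ z = 1 / μ ^ 2 := by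
  have hev : ρ =ᶠ[𝓝 z] fun z => (z - ζ) / μ ^ 2 := by
    filter_upwards [hI.mem_nhds hz] with x hx using h.eq_affine_of_zero hx
  rw [hev.deriv_eq]
  exact (((hasDerivAt_id z).sub_const ζ).div_const (μ ^ 2)).deriv

theorem exists_two_closing (hI : IsOpen I) (hord : I.OrdConnected) (hne : I.Nonempty)
    (hρ : ContDiffOn ℝ ∞ ρ I) (hρ0 : ∀ z ∈ I, ρ z ≠ 0) {c : ℝ} (hc : 0 < c)
    (hρ' : ∀ z ∈ I, deriv ρ z = c) :
    ∃ Ψ₁ Ψ₂ : ℝ → ℝ, IsSmoothClosing I ρ Ψ₁ ∧ IsSmoothClosing I ρ Ψ₂ ∧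
      ¬ PosProportional I Ψ₁ Ψ₂ ∧ ∀ Ψ : ℝ → ℝ, IsSmoothClosing I ρ Ψ →
        PosProportional I Ψ Ψ₁ ∨ PosProportional I Ψ Ψ₂ := by
  obtain ⟨z₀, hz₀⟩ := hne
  have hA : ∀ z ∈ I, 0 < ρ z₀ * ρ z := fun z hz =>
    mul_pos_of_ne_zero hord.isPreconnected hρ hρ0 hz₀ hz
  have hf₁ : LinearForm I ρ (fun _ => ρ z₀) c (ρ z₀) := ⟨hc, fun z hz => ⟨hρ' z hz, rfl, hA z hz⟩⟩
  obtain ⟨ζ, hf₂⟩ := exists_cubicForm_of_affine (Ψ := fun z => 1 / ρ z ^ 3) hI hord.isPreconnected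
    hρ hρ0 hc hρ' (A := 1) (fun z hz => by have := hρ0 z hz; positivity) (fun z hz => rfl)
  have hne : I.Nonempty := ⟨z₀, hz₀⟩
  refine ⟨_, _, ⟨hf₁.contDiffOn, (hf₁.closing hI hord hne hρ hf₁.contDiffOn).1⟩,
    ⟨hf₂.contDiffOn, (hf₂.closing hI hord hne hρ hf₂.contDiffOn).1⟩,
    not_posProportional_const_cubic hI hne hρ hρ0 hc hρ' (hρ0 z₀ hz₀), fun Ψ hΨ => ?_⟩
  rcases hΨ.form hI hord hne hρ hρ0 with ⟨c', A, hf⟩ | ⟨ζ', D, μ, A, hf⟩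
  · exact Or.inl (hf.posProportional hI hne hf₁)
  · exact Or.inr (hf.posProportional hI hne hρ hf₂)

end

end Bertrand

theorem mainTheorem1 (a b : EReal) (hab : a < b) (ρ : ℝ → ℝ)
    (hρ : ContDiffOn ℝ ∞ ρ (interval a b)) :
    -- semilocally, fully, strongly or weakly closing functions are locally closing
    (∀ Ψ : ℝ → ℝ, ContDiffOn ℝ ∞ Ψ (interval a b) →
      (IsSemilocallyClosing (interval a b) ρ Ψ ∨ IsClosing (interval a b) ρ Ψ ∨
        IsStronglyClosing (interval a b) ρ Ψ ∨ IsWeaklyClosing (interval a b) ρ Ψ) →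
      IsLocallyClosing (interval a b) ρ Ψ) ∧
    ((∀ z ∈ interval a b, ρ z ≠ 0) →
      -- the five classes coincide
      (∀ Ψ : ℝ → ℝ, ContDiffOn ℝ ∞ Ψ (interval a b) →
        (IsClosing (interval a b) ρ Ψ ↔ IsLocallyClosing (interval a b) ρ Ψ) ∧
        (IsSemilocallyClosing (interval a b) ρ Ψ ↔ IsLocallyClosing (interval a b) ρ Ψ) ∧
        (IsStronglyClosing (interval a b) ρ Ψ ↔ IsLocallyClosing (interval a b) ρ Ψ) ∧
        (IsWeaklyClosing (interval a b) ρ Ψ ↔ IsLocallyClosing (interval a b) ρ Ψ)) ∧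
      -- there are at most two closing functions up to a positive constant
      (∀ Ψ₁ Ψ₂ Ψ₃ : ℝ → ℝ, IsSmoothClosing (interval a b) ρ Ψ₁ →
        IsSmoothClosing (interval a b) ρ Ψ₂ → IsSmoothClosing (interval a b) ρ Ψ₃ →
        PosProportional (interval a b) Ψ₁ Ψ₂ ∨ PosProportional (interval a b) Ψ₁ Ψ₃ ∨
          PosProportional (interval a b) Ψ₂ Ψ₃) ∧
      -- (a)
      (∀ c : ℝ, 0 < c → (∀ z ∈ interval a b, deriv ρ z = c) →
        (∃ Ψ₁ Ψ₂ : ℝ → ℝ, IsSmoothClosing (interval a b) ρ Ψ₁ ∧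
          IsSmoothClosing (interval a b) ρ Ψ₂ ∧ ¬ PosProportional (interval a b) Ψ₁ Ψ₂ ∧
          ∀ Ψ : ℝ → ℝ, IsSmoothClosing (interval a b) ρ Ψ →
            PosProportional (interval a b) Ψ Ψ₁ ∨ PosProportional (interval a b) Ψ Ψ₂) ∧
        (∀ Ψ : ℝ → ℝ, IsSmoothClosing (interval a b) ρ Ψ ↔
          ∃ i : ℕ, (i = 1 ∨ i = 2) ∧ ∃ A : ℝ, A ≠ 0 ∧
            (∀ z ∈ interval a b, 0 < A * ρ z ^ i) ∧
            ∀ z ∈ interval a b, Ψ z = A / ρ z ^ (i ^ 2 - 1)) ∧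
        (∀ i : ℕ, i = 1 ∨ i = 2 → ∃ A : ℝ, A ≠ 0 ∧ ∀ z ∈ interval a b, 0 < A * ρ z ^ i) ∧
        (∀ i : ℕ, i = 1 ∨ i = 2 → ∀ A : ℝ, A ≠ 0 → (∀ z ∈ interval a b, 0 < A * ρ z ^ i) →
          ∀ Ψ : ℝ → ℝ, (∀ z ∈ interval a b, Ψ z = A / ρ z ^ (i ^ 2 - 1)) →
            (∀ (K : ℝ) (z : ℝ → ℝ), IsBddNonconstSolution (interval a b) ρ Ψ K z →
              IsMinimalPeriod z (2 * π / (i * √c))) ∧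
            ∀ z ∈ interval a b,
              IsNondegStableEquilibrium (interval a b) ρ Ψ (√(A / ρ z ^ (i ^ 2))) z ∧
              IsNondegStableEquilibrium (interval a b) ρ Ψ (-√(A / ρ z ^ (i ^ 2))) z ∧
              ∀ K : ℝ, K ≠ √(A / ρ z ^ (i ^ 2)) → K ≠ -√(A / ρ z ^ (i ^ 2)) →
                ¬ IsEquilibrium (interval a b) ρ Ψ K z)) ∧
      -- (b)
      (∀ ζ D μ : ℝ, HasRationalForm (interval a b) ρ ζ D μ →
        (∃ Ψ₂ : ℝ → ℝ, IsSmoothClosing (interval a b) ρ Ψ₂ ∧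
          ∀ Ψ : ℝ → ℝ, IsSmoothClosing (interval a b) ρ Ψ →
            PosProportional (interval a b) Ψ Ψ₂) ∧
        (∀ Ψ : ℝ → ℝ, IsSmoothClosing (interval a b) ρ Ψ ↔
          ∃ A : ℝ, A ≠ 0 ∧ (∀ z ∈ interval a b, 0 < A * ((z - ζ) ^ 4 + D)) ∧
            ∀ z ∈ interval a b, Ψ z = A / (z - ζ) ^ 3) ∧
        (∀ A : ℝ, A ≠ 0 → (∀ z ∈ interval a b, 0 < A * ((z - ζ) ^ 4 + D)) →
          ∀ Ψ : ℝ → ℝ, (∀ z ∈ interval a b, Ψ z = A / (z - ζ) ^ 3) →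
            (∀ (K : ℝ) (z : ℝ → ℝ), IsBddNonconstSolution (interval a b) ρ Ψ K z →
              IsMinimalPeriod z (π * μ)) ∧
            ∀ z ∈ interval a b,
              IsNondegStableEquilibrium (interval a b) ρ Ψ (μ * √(A / ((z - ζ) ^ 4 + D))) z ∧
              IsNondegStableEquilibrium (interval a b) ρ Ψ
                (-(μ * √(A / ((z - ζ) ^ 4 + D)))) z ∧
              ∀ K : ℝ, K ≠ μ * √(A / ((z - ζ) ^ 4 + D)) →
                K ≠ -(μ * √(A / ((z - ζ) ^ 4 + D))) →
                ¬ IsEquilibrium (interval a b) ρ Ψ K z)) ∧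
      -- (c)
      ((¬ ∃ c : ℝ, 0 < c ∧ ∀ z ∈ interval a b, deriv ρ z = c) →
        (¬ ∃ ζ D μ : ℝ, HasRationalForm (interval a b) ρ ζ D μ) →
        ∀ Ψ : ℝ → ℝ, ¬ IsSmoothClosing (interval a b) ρ Ψ)) := by
  have hI := isOpen_interval a b
  have hord := ordConnected_interval a b
  have hne := nonempty_interval hab
  have hIc := hord.isPreconnected
  refine ⟨fun Ψ hΨ h => isLocallyClosing_of_closing hI hord hne hρ hΨ h, fun hρ0 => ?_⟩
  refine ⟨fun Ψ hΨ => ?_, fun Ψ₁ Ψ₂ Ψ₃ h₁ h₂ h₃ =>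
    posProportional_of_three hI hord hne hρ hρ0 h₁ h₂ h₃, fun c hc hρ' => ?_,
    fun ζ D μ hform => ?_, fun hlin hrat Ψ hΨ => ?_⟩
  · have hloc := isLocallyClosing_of_closing hI hord hne hρ hΨ
    have hall := fun h : IsLocallyClosing (interval a b) ρ Ψ => h.closing hI hord hne hρ hΨ hρ0
    exact ⟨⟨fun h => hloc (Or.inr (Or.inl h)), fun h => (hall h).1⟩,
      ⟨fun h => hloc (Or.inl h), fun h => (hall h).2.1⟩,
      ⟨fun h => hloc (Or.inr (Or.inr (Or.inl h))), fun h => (hall h).2.2.1⟩,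
      ⟨fun h => hloc (Or.inr (Or.inr (Or.inr h))), fun h => (hall h).2.2.2⟩⟩
  · refine ⟨exists_two_closing hI hord hne hρ hρ0 hc hρ',
      isSmoothClosing_iff_of_affine hI hord hne hρ hρ0 hc hρ', fun i _ => ?_,
      fun i hi A _ hpos Ψ hΨ => linear_case_solutions hI hord hρ hρ0 hc hρ' hi hpos hΨ⟩
    obtain ⟨z₀, hz₀⟩ := hne
    refine ⟨ρ z₀ ^ i, pow_ne_zero i (hρ0 z₀ hz₀), fun z hz => ?_⟩
    rw [← mul_pow]
    exact pow_pos (mul_pos_of_ne_zero hIc hρ hρ0 hz₀ hz) i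
  · refine ⟨?_, isSmoothClosing_iff_of_rational hI hord hne hρ hρ0 hform,
      fun A _ hpos Ψ hΨ => ?_⟩
    · obtain ⟨A, hA⟩ := hform.exists_const hIc hne hρ0
      have hf := hform.cubicForm (Ψ := fun z => A / (z - ζ) ^ 3) hA fun z _ => rfl
      refine ⟨_, ⟨hf.contDiffOn, (hf.closing hI hord hne hρ hf.contDiffOn).1⟩, fun Ψ hΨ => ?_⟩
      obtain ⟨B, -, hB, hΨB⟩ :=
        (isSmoothClosing_iff_of_rational hI hord hne hρ hρ0 hform Ψ).1 hΨ
      exact (hform.cubicForm hB hΨB).posProportional hI hne hρ hf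
    · have hf := hform.cubicForm hpos hΨ
      exact ⟨fun K z hz => hf.isMinimalPeriod hz,
        fun z hz => hf.equilibria hI hρ hρ0 hz⟩
  · rcases hΨ.form hI hord hne hρ hρ0 with ⟨c, A, hf⟩ | ⟨ζ, D, μ, A, hf⟩
    · exact hlin ⟨c, hf.1, fun z hz => (hf.2 z hz).1⟩
    · by_cases hD : D = 0
      · subst hD
        have hμ := hf.1
        exact hlin ⟨1 / μ ^ 2, by positivity, fun z hz => hf.deriv_eq hI hz⟩
      · exact hrat ⟨ζ, D, μ, hD, hf.1, hf.2.1, fun z hz => (hf.2.2 z hz).1⟩
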